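/- **Theorem.** Let $m\ge 1$ be an integer and let $\tau\in\mathbb C$ with $\operatorname{Im}\tau>0$. Let $$\theta(z)=-\sum_{j\in\mathbb Z}e^{\pi i(j+\frac12)^2\tau+2\pi i(j+\frac12)(z+\frac12)},$$ and for $\eta\in\mathbb C\setminus\{0\}$ let $L$ be the $q$-Lamé difference operator $$L\psi(\lambda)=\frac{\theta(\lambda+2\eta m)}{\theta(\lambda)}\psi(\lambda-2\eta)+\frac{\theta(\lambda-2\eta m)}{\theta(\lambda)}\psi(\lambda+2\eta).$$ A pair $(t,c)=(t_1,\dots,t_m,c)\in\mathbb C^m\times\mathbb C$ is called a *solution of the Bethe ansatz equations* if $t_i\not\equiv t_j \pmod{\mathbb Z+\tau\mathbb Z}$ for $i\neq j$ and $$\frac{\theta(t_i-\eta(1+2m))}{\theta(t_i-\eta(1-2m))}\prod_{j\ne i}\frac{\theta(t_j-t_i-2\eta)}{\theta(t_j-t_i+2\eta)}=e^{4\eta c},\qquad i=1,\dots,m,$$ all theta factors being nonzero. Its *eigenvalue* and its *Bethe function* are $$\epsilon(t,c)=e^{-2\eta c}\,\frac{\theta(4\eta m)}{\theta(2\eta m)}\prod_{j=1}^m\frac{\theta(t_j+(2m-3)\eta)}{\theta(t_j+(2m-1)\eta)},\qquad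 \psi_{(t,c)}(\lambda)=e^{c\lambda}\prod_{j=1}^m\theta(\lambda+t_j-\eta).$$ Pairs $(t,c)$ are identified if they differ by a composition of permutations of the $t_i$, translations $t_i\mapsto t_i+ 1$, translations $(t_i,c)\mapsto(t_i+\tau,\,c+2\pi i)$, $c\mapsto c+\pi i/\eta$, and their inverses; these operations preserve the Bethe ansatz equations and the eigenvalue, and multiply $\psi_{(t,c)}$ by a nonvanishing $2\eta$-periodic entire function. Let $K$ be the field of $2\eta$-periodic meromorphic functions on $\mathbb C$. Then there is a countable set $N\subset\mathbb C$ (depending on $m,\tau$) such that for every $\eta\in\mathbb C\setminus N$, $\eta\neq0$, there is a finite set $F\subset\mathbb C$ such that for every $\epsilon\in\mathbb C\setminus F$ the following holds. Up to the above identification there are exactly two distinct solutions of the Bethe ansatz equations with eigenvalue $\epsilon$, and they are of the form $(t_1,\dots,t_m,c)$ and $(2\eta-t_1,\dots,2\eta-t_m,-c)$. The corresponding Bethe functions $\psi_+,\psi_-$ satisfy $L\psi_\pm=\epsilon\psi_\pm$ and are linearly independent over $K$, and every meromorphic function $\psi$ on $\mathbb C$ with $L\psi=\epsilon\psi$ is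 a linear combination of $\psi_+$ and $\psi_-$ with coefficients in $K$. -/

import Mathlib

open Complex Filter

noncomputable section

namespace LameBethe

/-- Jacobi's (odd) theta function
`θ(z) = -∑_{j ∈ ℤ} exp(π i (j + 1/2)² τ + 2 π i (j + 1/2)(z + 1/2))`. -/
def theta (τ z : ℂ) : ℂ :=
  -∑' j : ℤ, cexp (Real.pi * I * ((j : ℂ) + 1 / 2) ^ 2 * τ
    + 2 * Real.pi * I * ((j : ℂ) + 1 / 2) * (z + 1 / 2))

/-- The `q`-deformed Lamé operator
`(L ψ)(x) = θ(x + 2ηm)/θ(x) · ψ(x - 2η) + θ(x - 2ηm)/θ(x) · ψ(x + 2η)`. -/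
def lameOp (τ η : ℂ) (m : ℕ) (ψ : ℂ → ℂ) (x : ℂ) : ℂ :=
  theta τ (x + 2 * η * m) / theta τ x * ψ (x - 2 * η)
    + theta τ (x - 2 * η * m) / theta τ x * ψ (x + 2 * η)

/-- `ψ` is a meromorphic function on `ℂ` that solves `L ψ = ε ψ`, as an identity of meromorphic
functions, i.e. off a closed discrete set. -/
def IsLameSolution (τ η : ℂ) (m : ℕ) (ε : ℂ) (ψ : ℂ → ℂ) : Prop :=
  Meromorphic ψ ∧ ∀ᶠ x in codiscrete ℂ, lameOp τ η m ψ x = ε * ψ x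

/-- `A` represents an element of the field `K` of `2η`-periodic meromorphic functions on `ℂ`
(two functions represent the same element if they agree off a closed discrete set). -/
def IsPeriodicMeromorphic (η : ℂ) (A : ℂ → ℂ) : Prop :=
  Meromorphic A ∧ ∀ᶠ x in codiscrete ℂ, A (x + 2 * η) = A x

/-- `f` and `g` are linearly independent over `K`. -/
def LinIndepOverPeriodic (η : ℂ) (f g : ℂ → ℂ) : Prop :=
  ∀ A B : ℂ → ℂ, IsPeriodicMeromorphic η A → IsPeriodicMeromorphic η B →
    (∀ᶠ x in codiscrete ℂ, A x * f x + B x * g x = 0) →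
    (∀ᶠ x in codiscrete ℂ, A x = 0) ∧ (∀ᶠ x in codiscrete ℂ, B x = 0)

/-- `F` is a linear combination of `f` and `g` with coefficients in `K`. -/
def IsCombOverPeriodic (η : ℂ) (f g F : ℂ → ℂ) : Prop :=
  ∃ A B : ℂ → ℂ, IsPeriodicMeromorphic η A ∧ IsPeriodicMeromorphic η B ∧
    ∀ᶠ x in codiscrete ℂ, F x = A x * f x + B x * g x

/-- Representatives `(t₁, …, t_m, c)`. -/
abbrev Param (m : ℕ) : Type := (Fin m → ℂ) × ℂ

/-- `(t, c)` solves the Bethe ansatz equations, with the `t_i` pairwise distinct modulo `ℤ + τℤ`.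
Since the right-hand side of the equations is nonzero, and division by zero gives zero,
the equations force every theta factor on the left-hand side to be nonzero. -/
def IsBetheSolution (τ η : ℂ) (m : ℕ) (p : Param m) : Prop :=
  (∀ i j : Fin m, i ≠ j → ¬ ∃ k l : ℤ, p.1 i - p.1 j = k + l * τ) ∧
  ∀ i : Fin m,
    theta τ (p.1 i - η * (1 + 2 * m)) / theta τ (p.1 i - η * (1 - 2 * m))
      * ∏ j ∈ Finset.univ.erase i,
          (theta τ (p.1 j - p.1 i - 2 * η) / theta τ (p.1 j - p.1 i + 2 * η))
    = cexp (4 * η * p.2)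

/-- The eigenvalue attached to `(t, c)`:
`e^{-2ηc} θ(4ηm)/θ(2ηm) ∏_j θ(t_j + (2m-3)η)/θ(t_j + (2m-1)η)`. -/
def betheEigenvalue (τ η : ℂ) (m : ℕ) (p : Param m) : ℂ :=
  cexp (-2 * η * p.2) * (theta τ (4 * η * m) / theta τ (2 * η * m))
    * ∏ j : Fin m,
        (theta τ (p.1 j + (2 * m - 3) * η) / theta τ (p.1 j + (2 * m - 1) * η))

/-- The Bethe function `ψ(x) = e^{cx} ∏_j θ(x + t_j - η)` attached to `(t, c)`. -/
def betheFunction (τ η : ℂ) (m : ℕ) (p : Param m) (x : ℂ) : ℂ :=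
  cexp (p.2 * x) * ∏ j : Fin m, theta τ (x + p.1 j - η)

/-- The reflection `(t, c) ↦ (2η - t, -c)`. -/
def reflect (η : ℂ) {m : ℕ} (p : Param m) : Param m :=
  (fun i => 2 * η - p.1 i, -p.2)

/-- The identification of representatives: permutations of the `t_i`, the translations
`t_i ↦ t_i + 1` and `(t_i, c) ↦ (t_i + τ, c + 2πi)`, and `c ↦ c + πi/η`.
The translation by `τ` has to move `c`, because `θ(x + τ) = -e^{-πi(τ + 2x)} θ(x)`: this is what
preserves the Bethe equations and the eigenvalue, and changes the Bethe function only by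
a constant factor. -/
def Related (τ η : ℂ) {m : ℕ} (p q : Param m) : Prop :=
  ∃ (σ : Equiv.Perm (Fin m)) (k l : Fin m → ℤ) (n : ℤ),
    (∀ i, q.1 i = p.1 (σ i) + k i + l i * τ) ∧
    q.2 = p.2 + 2 * Real.pi * I * ((∑ i, l i : ℤ) : ℂ) + Real.pi * I / η * n

theorem Related.refl (τ η : ℂ) {m : ℕ} (p : Param m) : Related τ η p p :=
  ⟨1, 0, 0, 0, by simp, by simp⟩

theorem Related.symm {τ η : ℂ} {m : ℕ} {p q : Param m} (h : Related τ η p q) :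
    Related τ η q p := by
  obtain ⟨σ, k, l, n, h1, h2⟩ := h
  refine ⟨σ⁻¹, fun i => -k (σ⁻¹ i), fun i => -l (σ⁻¹ i), -n, fun i => ?_, ?_⟩
  · rw [h1 (σ⁻¹ i)]
    simp
    ring
  · rw [h2, Finset.sum_neg_distrib, Equiv.sum_comp σ⁻¹ l]
    push_cast
    ring

theorem Related.trans {τ η : ℂ} {m : ℕ} {p q r : Param m} (h : Related τ η p q)
    (h' : Related τ η q r) : Related τ η p r := by
  obtain ⟨σ, k, l, n, h1, h2⟩ := h
  obtain ⟨σ', k', l', n', h1', h2'⟩ := h'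
  refine ⟨σ * σ', fun i => k (σ' i) + k' i, fun i => l (σ' i) + l' i, n + n', fun i => ?_, ?_⟩
  · rw [h1', h1]
    simp only [Equiv.Perm.mul_apply]
    push_cast
    ring
  · rw [h2', h2, Finset.sum_add_distrib, Equiv.sum_comp σ' l]
    push_cast
    ring

/-- The identification as a setoid. -/
def paramSetoid (τ η : ℂ) (m : ℕ) : Setoid (Param m) where
  r := Related τ η
  iseqv := ⟨Related.refl τ η, Related.symm, Related.trans⟩

/-- The space in which solutions of the Bethe equations are counted: a twisted form of
`S^m E_τ × ℂ/πiη⁻¹ℤ`. -/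
abbrev ParamSpace (τ η : ℂ) (m : ℕ) : Type := Quotient (paramSetoid τ η m)

/-- The class of a representative. -/
def toClass (τ η : ℂ) {m : ℕ} (p : Param m) : ParamSpace τ η m :=
  Quotient.mk (paramSetoid τ η m) p

/-- The classes of solutions of the Bethe equations with eigenvalue `ε`. -/
def solutionClasses (τ η : ℂ) (m : ℕ) (ε : ℂ) : Set (ParamSpace τ η m) :=
  toClass τ η '' {p : Param m | IsBetheSolution τ η m p ∧ betheEigenvalue τ η m p = ε}

end LameBethe

end

/-!
Write `w = 2η`. A solution `ψ = e^{cz} ∏ θ(z - b_i)` of the equation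
`θ(z + mw) ψ(z - w) + θ(z - mw) ψ(z + w) = ε θ(z) ψ(z)` is recovered from the even theta function
`Φ(z) = ψ(z) ψ(-z)` of degree `2m`. At the multiples of `w` the equation is a recursion, which
determines the values of `Φ` there up to a common factor, and these values determine `Φ`.
The two terms of the difference Wronskian of `ψ(z)` and `ψ(-z)` are `ψ(z) ψ(-z - w)` and
`ψ(z + w) ψ(-z)`. Their product is `Φ(z) Φ(z + w)`, their difference is, by the equation, a multiple
of a product of theta functions independent of `ψ`, and their sum `s` is a theta function that is
again determined by its values at the multiples of `w`. Hence they are the roots of a quadratic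
polynomial which depends on `ε` only, and this leaves no choice but `ψ(z)` and `ψ(-z)`.

Conversely, for all but finitely many `ε` the even function `Φ` attached to the recursion has simple
zeros `± a_i`. The discriminant of the quadratic is a square, so each zero `± a_i` of `Φ` is a zero
of one of the two roots, and this assigns the zeros of `Φ` to `ψ(z)` and `ψ(-z)`. The Wronskian of
these two solutions is not zero; it gives their independence, and Cramer's rule gives all other
solutions.
-/

noncomputable section

namespace LameBethe

open scoped Real

/-! ### Quasi-periodicity of the theta function -/

/-- The constant in `θ(z + τ) = tauFactor τ · e^{-2πiz} θ(z)`. -/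
def tauFactor (τ : ℂ) : ℂ := -cexp (-(π * I * τ))

theorem tauFactor_ne_zero (τ : ℂ) : tauFactor τ ≠ 0 := neg_ne_zero.mpr (exp_ne_zero _)

theorem theta_eq_exp_mul_jacobiTheta₂ (τ z : ℂ) :
    theta τ z = -(cexp (π * I * τ / 4 + π * I * (z + 1 / 2))
      * jacobiTheta₂ (z + 1 / 2 + τ / 2) τ) := by
  rw [theta, jacobiTheta₂, ← tsum_mul_left]
  congr 2
  ext j
  rw [jacobiTheta₂_term, ← Complex.exp_add]
  congr 1
  ring

theorem differentiable_theta {τ : ℂ} (hτ : 0 < τ.im) : Differentiable ℂ (theta τ) := by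
  have hJ : Differentiable ℂ fun z => jacobiTheta₂ (z + 1 / 2 + τ / 2) τ := fun z =>
    (differentiableAt_jacobiTheta₂_fst (z + 1 / 2 + τ / 2) hτ).comp
      (f := fun z : ℂ => z + 1 / 2 + τ / 2) z (by fun_prop)
  rw [funext (theta_eq_exp_mul_jacobiTheta₂ τ)]
  fun_prop

theorem theta_add_one (τ z : ℂ) : theta τ (z + 1) = -theta τ z := by
  rw [theta_eq_exp_mul_jacobiTheta₂, theta_eq_exp_mul_jacobiTheta₂,
    show z + 1 + 1 / 2 + τ / 2 = (z + 1 / 2 + τ / 2) + 1 by ring, jacobiTheta₂_add_left,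
    show (π * I * τ / 4 + π * I * (z + 1 + 1 / 2) : ℂ)
      = (π * I * τ / 4 + π * I * (z + 1 / 2)) + π * I by ring,
    Complex.exp_add _ (π * I), exp_pi_mul_I]
  ring

theorem theta_add_tau (τ z : ℂ) :
    theta τ (z + τ) = tauFactor τ * cexp (-(2 * π * I * z)) * theta τ z := by
  have hexp : cexp (π * I * τ / 4 + π * I * (z + τ + 1 / 2))
      * cexp (-π * I * (τ + 2 * (z + 1 / 2 + τ / 2)))
      = -(cexp (-(π * I * τ)) * cexp (-(2 * π * I * z))
        * cexp (π * I * τ / 4 + π * I * (z + 1 / 2))) := by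
    rw [← Complex.exp_add, ← Complex.exp_add, ← Complex.exp_add, ← Complex.exp_sub_pi_mul_I]
    ring_nf
  rw [theta_eq_exp_mul_jacobiTheta₂, theta_eq_exp_mul_jacobiTheta₂, tauFactor,
    show z + τ + 1 / 2 + τ / 2 = (z + 1 / 2 + τ / 2) + τ by ring, jacobiTheta₂_add_left']
  linear_combination (-jacobiTheta₂ (z + 1 / 2 + τ / 2) τ) * hexp

theorem theta_neg (τ z : ℂ) : theta τ (-z) = -theta τ z := by
  have hexp : cexp (π * I * τ / 4 + π * I * (-z + 1 / 2))
      = -(cexp (π * I * τ / 4 + π * I * (z + 1 / 2))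
      * cexp (-π * I * (τ + 2 * (z + 1 / 2 - τ / 2)))) := by
    rw [← Complex.exp_add, ← Complex.exp_add_pi_mul_I]
    ring_nf
  rw [theta_eq_exp_mul_jacobiTheta₂, theta_eq_exp_mul_jacobiTheta₂,
    ← jacobiTheta₂_neg_left (-z + 1 / 2 + τ / 2), ← jacobiTheta₂_add_left,
    show -(-z + 1 / 2 + τ / 2) + 1 = z + 1 / 2 - τ / 2 by ring,
    show z + 1 / 2 + τ / 2 = (z + 1 / 2 - τ / 2) + τ by ring, jacobiTheta₂_add_left', hexp]
  ring

theorem theta_zero (τ : ℂ) : theta τ 0 = 0 := by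
  have hodd := theta_neg τ 0
  rw [neg_zero] at hodd
  exact self_eq_neg.mp hodd

theorem theta_sub_comm (τ a b : ℂ) : theta τ (a - b) = -theta τ (b - a) := by
  rw [← theta_neg, neg_sub]

theorem integral_jacobiTheta₂_term (n : ℤ) (τ : ℂ) :
    ∫ x in (0 : ℝ)..1, jacobiTheta₂_term n x τ = if n = 0 then 1 else 0 := by
  split_ifs with hn
  · simp [jacobiTheta₂_term, hn]
  · have hterm (x : ℝ) : jacobiTheta₂_term n x τ
        = cexp (π * I * n ^ 2 * τ) * cexp ((2 * π * I * n) * x) := by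
      rw [jacobiTheta₂_term, ← Complex.exp_add]
      ring_nf
    have hc : (2 * π * I * n : ℂ) ≠ 0 := by simp [Real.pi_ne_zero, I_ne_zero, hn]
    have hone : cexp (2 * π * I * n * (1 : ℝ)) = 1 :=
      Complex.exp_eq_one_iff.mpr ⟨n, by push_cast; ring⟩
    simp_rw [hterm]
    rw [intervalIntegral.integral_const_mul, integral_exp_mul_complex hc, hone]
    simp

theorem integral_jacobiTheta₂ {τ : ℂ} (hτ : 0 < τ.im) :
    ∫ x in (0 : ℝ)..1, jacobiTheta₂ x τ = 1 := by
  have hsum := intervalIntegral.hasSum_integral_of_dominated_convergence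
    (μ := MeasureTheory.volume) (a := (0 : ℝ)) (b := 1)
    (F := fun (n : ℤ) (x : ℝ) => jacobiTheta₂_term n x τ)
    (f := fun x : ℝ => jacobiTheta₂ x τ) (fun n _ => ‖jacobiTheta₂_term n 0 τ‖)
    (fun n => by
      apply Continuous.aestronglyMeasurable
      unfold jacobiTheta₂_term
      fun_prop)
    (fun n => Eventually.of_forall fun x _ => by simp [norm_jacobiTheta₂_term])
    (Eventually.of_forall fun _ _ => ((summable_jacobiTheta₂_term_iff 0 τ).mpr hτ).norm)
    (by simp)
    (Eventually.of_forall fun x _ => hasSum_jacobiTheta₂_term x hτ)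
  simp_rw [integral_jacobiTheta₂_term] at hsum
  exact hsum.unique (hasSum_ite_eq (0 : ℤ) (1 : ℂ))

theorem exists_theta_ne_zero {τ : ℂ} (hτ : 0 < τ.im) : ∃ z, theta τ z ≠ 0 := by
  by_contra! h
  have hJ (z : ℂ) : jacobiTheta₂ z τ = 0 := by
    have hz := h (z - 1 / 2 - τ / 2)
    rw [theta_eq_exp_mul_jacobiTheta₂, neg_eq_zero, mul_eq_zero,
      show z - 1 / 2 - τ / 2 + 1 / 2 + τ / 2 = z by ring] at hz
    exact hz.resolve_left (exp_ne_zero _)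
  simpa [hJ] using integral_jacobiTheta₂ hτ

/-! ### The product `∏ (1 - qⁿ w)` -/

/-- The infinite product `∏_{n ≥ 0} (1 - qⁿ w)`, i.e. the `q`-Pochhammer symbol `(w; q)_∞`. -/
def qProd (q w : ℂ) : ℂ := ∏' n : ℕ, (1 + -(q ^ n * w))

theorem summable_qProd {q : ℂ} (hq : ‖q‖ < 1) (w : ℂ) :
    Summable fun n : ℕ => ‖-(q ^ n * w)‖ := by
  simp only [norm_neg, norm_mul, norm_pow]
  exact (summable_geometric_of_lt_one (norm_nonneg _) hq).mul_right _

theorem qProd_eq_one_sub_mul {q : ℂ} (hq : ‖q‖ < 1) (w : ℂ) :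
    qProd q w = (1 - w) * qProd q (q * w) := by
  have hshift : (fun n : ℕ => 1 + -(q ^ (n + 1) * w)) = fun n : ℕ => 1 + -(q ^ n * (q * w)) := by
    funext n
    ring
  have hm : Multipliable fun n : ℕ => 1 + -(q ^ n * (q * w)) :=
    multipliable_one_add_of_summable (f := fun n : ℕ => -(q ^ n * (q * w))) (summable_qProd hq _)
  rw [← hshift] at hm
  have h := tprod_eq_zero_mul' (f := fun n : ℕ => 1 + -(q ^ n * w)) hm
  rw [hshift] at h
  rw [qProd, qProd, h, pow_zero, one_mul, sub_eq_add_neg]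

theorem qProd_ne_zero {q : ℂ} (hq : ‖q‖ < 1) {w : ℂ} (h : ∀ n : ℕ, q ^ n * w ≠ 1) :
    qProd q w ≠ 0 :=
  tprod_one_add_ne_zero_of_summable (f := fun n : ℕ => -(q ^ n * w))
    (fun n h0 => h n (by linear_combination -h0)) (summable_qProd hq w)

theorem differentiable_qProd {q : ℂ} (hq : ‖q‖ < 1) : Differentiable ℂ (qProd q) := by
  intro w
  have hprod := Summable.hasProdLocallyUniformlyOn_nat_one_add
    (K := Metric.ball (0 : ℂ) (‖w‖ + 1)) (f := fun (n : ℕ) (w : ℂ) => -(q ^ n * w))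
    Metric.isOpen_ball (u := fun n => ‖q‖ ^ n * (‖w‖ + 1))
    ((summable_geometric_of_lt_one (norm_nonneg _) hq).mul_right _)
    (Eventually.of_forall fun n x hx => by
      rw [norm_neg, norm_mul, norm_pow]
      have : ‖x‖ < ‖w‖ + 1 := by simpa using hx
      gcongr)
    (fun n => by fun_prop)
  have hd : DifferentiableOn ℂ (qProd q) (Metric.ball (0 : ℂ) (‖w‖ + 1)) :=
    TendstoLocallyUniformlyOn.differentiableOn hprod
      (.of_forall fun _ => DifferentiableOn.fun_finsetProd (fun _ _ => by fun_prop))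
      Metric.isOpen_ball
  exact hd.differentiableAt (Metric.isOpen_ball.mem_nhds (by simp))

/-! ### Entire functions -/

theorem eventually_codiscrete_iff {P : ℂ → Prop} :
    (∀ᶠ z in codiscrete ℂ, P z) ↔ ∀ z, ∀ᶠ w in nhdsWithin z {z}ᶜ, P w := by
  simp only [Filter.Eventually, mem_codiscrete, disjoint_principal_right, compl_compl]

theorem eventually_codiscrete_ne_zero {f : ℂ → ℂ} (hf : Differentiable ℂ f) {z₀ : ℂ}
    (h0 : f z₀ ≠ 0) : ∀ᶠ z in codiscrete ℂ, f z ≠ 0 := by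
  have hf' : AnalyticOnNhd ℂ f Set.univ := fun z _ => hf.analyticAt z
  exact hf'.preimage_zero_mem_codiscrete (x := z₀) h0

theorem exists_prod_ne_zero {ι : Type*} (s : Finset ι) {f : ι → ℂ → ℂ}
    (hf : ∀ i ∈ s, Differentiable ℂ (f i)) (h0 : ∀ i ∈ s, ∃ z, f i z ≠ 0) :
    ∃ z, ∏ i ∈ s, f i z ≠ 0 := by
  have hall : ∀ᶠ z in codiscrete ℂ, ∀ i ∈ s, f i z ≠ 0 :=
    (Filter.eventually_all_finset s).mpr fun i hi =>
      eventually_codiscrete_ne_zero (hf i hi) (h0 i hi).choose_spec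
  obtain ⟨z, hz⟩ := (eventually_codiscrete_iff.mp hall 0).exists
  exact ⟨z, Finset.prod_ne_zero_iff.mpr hz⟩

theorem eq_zero_of_mul_eq_zero {f g : ℂ → ℂ} (hf : Differentiable ℂ f)
    (hg : Differentiable ℂ g) {z₀ : ℂ} (h0 : f z₀ ≠ 0) (h : ∀ z, f z * g z = 0) (z : ℂ) :
    g z = 0 := by
  rcases AnalyticOnNhd.eq_zero_or_eq_zero_of_mul_eq_zero (fun x _ => hf.analyticAt x)
    (fun x _ => hg.analyticAt x) (fun z _ => h z) isPreconnected_univ with hf0 | hg0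
  · exact absurd (hf0 z₀ trivial) h0
  · exact hg0 z trivial

theorem eq_of_mul_eq_mul_left {f g h : ℂ → ℂ} (hf : Differentiable ℂ f)
    (hg : Differentiable ℂ g) (hh : Differentiable ℂ h) {z₀ : ℂ} (h0 : f z₀ ≠ 0)
    (H : ∀ z, f z * g z = f z * h z) (z : ℂ) : g z = h z :=
  sub_eq_zero.mp (eq_zero_of_mul_eq_zero hf (hg.sub hh) h0
    (fun z => by rw [Pi.sub_apply, mul_sub, H, sub_self]) z)

theorem differentiable_dslope {f : ℂ → ℂ} (hf : Differentiable ℂ f) (z₀ : ℂ) :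
    Differentiable ℂ (dslope f z₀) := by
  rw [← differentiableOn_univ] at hf ⊢
  exact (Complex.differentiableOn_dslope univ_mem).mpr hf

theorem exists_entire_quotient {f g : ℂ → ℂ} (hf : Differentiable ℂ f) (hg : Differentiable ℂ g)
    (h : ∀ z, f z = 0 → g z = 0 ∧ deriv f z ≠ 0) :
    ∃ q : ℂ → ℂ, Differentiable ℂ q ∧ ∀ z, g z = f z * q z := by
  classical
  refine ⟨fun z => if f z = 0 then deriv g z / deriv f z else g z / f z, fun z₀ => ?_,
    fun z => ?_⟩
  · by_cases h0 : f z₀ = 0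
    · obtain ⟨hg0, hd⟩ := h z₀ h0
      have hne : dslope f z₀ z₀ ≠ 0 := by rwa [dslope_same]
      refine ((differentiable_dslope hg z₀ z₀).div (differentiable_dslope hf z₀ z₀)
        hne).congr_of_eventuallyEq ?_
      filter_upwards [(differentiable_dslope hf z₀).continuous.continuousAt.eventually_ne hne]
        with z hz
      rcases eq_or_ne z z₀ with rfl | hzz
      · simp [h0]
      · have hs : z - z₀ ≠ 0 := sub_ne_zero.mpr hzz
        rw [dslope_of_ne _ hzz, slope_def_field, h0, sub_zero] at hz
        rw [if_neg (div_ne_zero_iff.mp hz).1, Pi.div_apply, dslope_of_ne _ hzz,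
          dslope_of_ne _ hzz, slope_def_field, slope_def_field, h0, hg0, sub_zero, sub_zero,
          div_div_div_cancel_right₀ hs]
    · refine ((hg z₀).div (hf z₀) h0).congr_of_eventuallyEq ?_
      filter_upwards [(hf z₀).continuousAt.eventually_ne h0] with z hz
      rw [if_neg hz, Pi.div_apply]
  · dsimp only
    split_ifs with h0
    · rw [h0, (h z h0).1, zero_mul]
    · rw [mul_div_cancel₀ _ h0]

/-! ### Theta functions of degree `n` -/

/-- A theta function of degree `n` and multipliers `α`, `β`: an entire function with
`g(z + 1) = α g(z)` and `g(z + τ) = β e^{-2πinz} g(z)`. -/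
structure IsTheta (τ : ℂ) (n : ℕ) (α β : ℂ) (g : ℂ → ℂ) : Prop where
  diff : Differentiable ℂ g
  add_one : ∀ z, g (z + 1) = α * g z
  add_tau : ∀ z, g (z + τ) = β * cexp (-(2 * π * I * n * z)) * g z

namespace IsTheta

variable {τ : ℂ} {n n' : ℕ} {α α' β β' : ℂ} {f g : ℂ → ℂ}

theorem of_theta (hτ : 0 < τ.im) : IsTheta τ 1 (-1) (tauFactor τ) (theta τ) :=
  ⟨differentiable_theta hτ, fun z => by rw [theta_add_one]; ring,
    fun z => by rw [theta_add_tau]; simp⟩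

theorem congr (hf : IsTheta τ n α β f) (h1 : α = α') (h2 : β = β') : IsTheta τ n α' β' f :=
  h1 ▸ h2 ▸ hf

theorem zero : IsTheta τ n α β fun _ => 0 :=
  ⟨differentiable_const _, by simp, by simp⟩

theorem one : IsTheta τ 0 1 1 fun _ => 1 := ⟨differentiable_const _, by simp, by simp⟩

theorem exp (γ : ℂ) : IsTheta τ 0 (cexp γ) (cexp (γ * τ)) fun z => cexp (γ * z) :=
  ⟨by fun_prop, fun z => by rw [← Complex.exp_add]; ring_nf,
    fun z => by simp [← Complex.exp_add]; ring_nf⟩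

theorem add (hf : IsTheta τ n α β f) (hg : IsTheta τ n α β g) :
    IsTheta τ n α β fun z => f z + g z :=
  ⟨hf.diff.add hg.diff, fun z => by rw [hf.add_one, hg.add_one]; ring,
    fun z => by rw [hf.add_tau, hg.add_tau]; ring⟩

theorem sub (hf : IsTheta τ n α β f) (hg : IsTheta τ n α β g) :
    IsTheta τ n α β fun z => f z - g z :=
  ⟨hf.diff.sub hg.diff, fun z => by rw [hf.add_one, hg.add_one]; ring,
    fun z => by rw [hf.add_tau, hg.add_tau]; ring⟩

theorem const_mul (hf : IsTheta τ n α β f) (c : ℂ) : IsTheta τ n α β fun z => c * f z :=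
  ⟨hf.diff.const_mul c, fun z => by rw [hf.add_one]; ring, fun z => by rw [hf.add_tau]; ring⟩

theorem sum {ι : Type*} {s : Finset ι} {f : ι → ℂ → ℂ}
    (h : ∀ i ∈ s, IsTheta τ n α β (f i)) : IsTheta τ n α β fun z => ∑ i ∈ s, f i z := by
  classical
  induction s using Finset.induction_on with
  | empty => simpa using zero
  | insert i s his ih =>
    simp only [Finset.sum_insert his]
    exact (h i (Finset.mem_insert_self _ _)).add
      (ih fun j hj => h j (Finset.mem_insert_of_mem hj))

theorem mul (hf : IsTheta τ n α β f) (hg : IsTheta τ n' α' β' g) :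
    IsTheta τ (n + n') (α * α') (β * β') fun z => f z * g z :=
  ⟨hf.diff.mul hg.diff, fun z => by rw [hf.add_one, hg.add_one]; ring,
    fun z => by
      rw [hf.add_tau, hg.add_tau,
        show -(2 * π * I * ((n + n' : ℕ) : ℂ) * z)
          = -(2 * π * I * n * z) + -(2 * π * I * n' * z) by push_cast; ring,
        Complex.exp_add]
      ring⟩

theorem shift (hf : IsTheta τ n α β f) (b : ℂ) :
    IsTheta τ n α (β * cexp (-(2 * π * I * n * b))) fun z => f (z + b) :=
  ⟨hf.diff.comp (differentiable_id.add_const b),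
    fun z => by rw [add_right_comm, hf.add_one],
    fun z => by
      rw [add_right_comm, hf.add_tau, mul_assoc β (cexp _) (cexp _), ← Complex.exp_add]
      ring_nf⟩

theorem left_multiplier_ne_zero (hf : IsTheta τ n α β f) {z₀ : ℂ} (h0 : f z₀ ≠ 0) : α ≠ 0 := by
  rintro rfl
  apply h0
  rw [← sub_add_cancel z₀ 1, hf.add_one, zero_mul]

theorem right_multiplier_ne_zero (hf : IsTheta τ n α β f) {z₀ : ℂ} (h0 : f z₀ ≠ 0) :
    β ≠ 0 := by
  rintro rfl
  apply h0
  rw [← sub_add_cancel z₀ τ, hf.add_tau, zero_mul, zero_mul]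

theorem of_mul (hf : IsTheta τ n α β f) {z₀ : ℂ} (h0 : f z₀ ≠ 0) (hg : Differentiable ℂ g)
    (hfg : IsTheta τ (n + n') (α * α') (β * β') fun z => f z * g z) : IsTheta τ n' α' β' g := by
  refine ⟨hg, fun z => ?_, fun z => ?_⟩
  · refine eq_of_mul_eq_mul_left hf.diff (g := fun z => g (z + 1)) (h := fun z => α' * g z)
      (hg.comp (differentiable_id.add_const 1)) (hg.const_mul α') h0 (fun z => ?_) z
    have hz := hfg.add_one z
    rw [hf.add_one] at hz
    exact mul_left_cancel₀ (hf.left_multiplier_ne_zero h0) (by linear_combination hz)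
  · refine eq_of_mul_eq_mul_left hf.diff (g := fun z => g (z + τ))
      (h := fun z => β' * cexp (-(2 * π * I * n' * z)) * g z)
      (hg.comp (differentiable_id.add_const τ)) (by fun_prop) h0 (fun z => ?_) z
    have hz := hfg.add_tau z
    rw [hf.add_tau,
      show -(2 * π * I * ((n + n' : ℕ) : ℂ) * z)
          = -(2 * π * I * n * z) + -(2 * π * I * n' * z) by push_cast; ring,
        Complex.exp_add] at hz
    exact mul_left_cancel₀
      (mul_ne_zero (hf.right_multiplier_ne_zero h0) (exp_ne_zero (-(2 * π * I * n * z))))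
      (by linear_combination hz)

theorem add_int (hf : IsTheta τ n α β f) (hα : α ≠ 0) (k : ℤ) (z : ℂ) :
    f (z + k) = α ^ k * f z := by
  have step (k : ℤ) : f (z + (k + 1 : ℤ)) = α ^ (k + 1) * f z ↔ f (z + k) = α ^ k * f z := by
    rw [Int.cast_add, Int.cast_one, ← add_assoc, hf.add_one, zpow_add_one₀ hα,
      mul_comm (α ^ k) α, mul_assoc, mul_right_inj' hα]
  induction k using Int.induction_on with
  | zero => simp
  | succ k ih => exact (step k).mpr ih
  | pred k ih => exact (step _).mp (by rwa [sub_add_cancel])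

theorem add_int_mul_tau (hf : IsTheta τ n α β f) (hβ : β ≠ 0) (l : ℤ) (z : ℂ) :
    f (z + l * τ) = β ^ l * cexp (-(π * I * n * l * ((l - 1) * τ + 2 * z))) * f z := by
  have step (l : ℤ) :
      f (z + (l + 1 : ℤ) * τ) = β ^ (l + 1) * cexp (-(π * I * n * (l + 1 : ℤ)
        * (((l + 1 : ℤ) - 1) * τ + 2 * z))) * f z
      ↔ f (z + l * τ) = β ^ l * cexp (-(π * I * n * l * ((l - 1) * τ + 2 * z))) * f z := by
    have hexp : cexp (-(π * I * n * (l + 1 : ℤ) * (((l + 1 : ℤ) - 1) * τ + 2 * z)))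
        = cexp (-(2 * π * I * n * (z + l * τ)))
          * cexp (-(π * I * n * l * ((l - 1) * τ + 2 * z))) := by
      rw [← Complex.exp_add]
      push_cast
      ring_nf
    rw [show z + ((l + 1 : ℤ) : ℂ) * τ = z + l * τ + τ by push_cast; ring, hf.add_tau, hexp,
      zpow_add_one₀ hβ, ← mul_right_inj'
        (mul_ne_zero hβ (exp_ne_zero (-(2 * π * I * n * (z + l * τ))))) (b := f (z + l * τ))]
    ring_nf
  induction l using Int.induction_on with
  | zero => simp
  | succ k ih => exact (step k).mpr ih
  | pred k ih => exact (step _).mp (by rwa [sub_add_cancel])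

theorem add_lattice (hf : IsTheta τ n α β f) (hα : α ≠ 0) (hβ : β ≠ 0) (k l : ℤ) (z : ℂ) :
    f (z + k + l * τ)
      = α ^ k * β ^ l * cexp (-(π * I * n * l * ((l - 1) * τ + 2 * z))) * f z := by
  rw [add_right_comm, hf.add_int hα, hf.add_int_mul_tau hβ]
  ring

theorem add_lattice_eq_zero_iff (hf : IsTheta τ n α β f) (hα : α ≠ 0) (hβ : β ≠ 0) (k l : ℤ)
    (z : ℂ) : f (z + k + l * τ) = 0 ↔ f z = 0 := by
  rw [hf.add_lattice hα hβ]
  simp [hα, hβ, zpow_ne_zero, Complex.exp_ne_zero]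

end IsTheta

/-! ### Theta functions of degree zero -/

theorem exists_eq_add_mul_of_im_pos {τ : ℂ} (hτ : 0 < τ.im) (z : ℂ) :
    ∃ x y : ℝ, z = x + y * τ := by
  refine ⟨(z - (z.im / τ.im : ℝ) * τ).re, z.im / τ.im, ?_⟩
  apply Complex.ext
  · simp
  · simp [hτ.ne']

theorem isBounded_range_of_doublyPeriodic {E : Type*} [PseudoMetricSpace E] {τ : ℂ}
    (hτ : 0 < τ.im) {G : ℂ → E} (hG : Continuous G) (hone : Function.Periodic G 1)
    (htau : Function.Periodic G τ) : Bornology.IsBounded (Set.range G) := by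
  have hK : IsCompact ((fun p : ℝ × ℝ => (p.1 : ℂ) + p.2 * τ) ''
      (Set.Icc 0 1 ×ˢ Set.Icc 0 1)) :=
    (isCompact_Icc.prod isCompact_Icc).image (by fun_prop)
  refine (hK.image hG).isBounded.subset ?_
  rintro _ ⟨z, rfl⟩
  obtain ⟨x, y, rfl⟩ := exists_eq_add_mul_of_im_pos hτ z
  refine ⟨_, ⟨(Int.fract x, Int.fract y), ⟨⟨Int.fract_nonneg _, (Int.fract_lt_one _).le⟩,
    ⟨Int.fract_nonneg _, (Int.fract_lt_one _).le⟩⟩, rfl⟩, ?_⟩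
  refine Eq.trans ?_ ((htau.sub_zsmul_eq (x := x + y * τ - ⌊x⌋ • 1) ⌊y⌋).trans
    (hone.sub_zsmul_eq ⌊x⌋))
  congr 1
  simp only [Int.fract, zsmul_eq_mul]
  push_cast
  ring

theorem exists_norm_exp_eq_and_norm_exp_mul_eq {τ : ℂ} (hτ : 0 < τ.im) {α β : ℂ} (hα : α ≠ 0)
    (hβ : β ≠ 0) : ∃ γ : ℂ, ‖cexp γ‖ = ‖α‖ ∧ ‖cexp (γ * τ)‖ = ‖β‖ := by
  refine ⟨⟨Real.log ‖α‖, (Real.log ‖α‖ * τ.re - Real.log ‖β‖) / τ.im⟩, ?_, ?_⟩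
  · rw [Complex.norm_exp, Real.exp_log (norm_pos_iff.mpr hα)]
  · rw [Complex.norm_exp, Complex.mul_re, div_mul_cancel₀ _ hτ.ne', sub_sub_cancel,
      Real.exp_log (norm_pos_iff.mpr hβ)]

namespace IsTheta

variable {τ α β : ℂ} {g : ℂ → ℂ}

theorem eq_const_of_norm_eq_one (hτ : 0 < τ.im) (hg : IsTheta τ 0 α β g) (hα : ‖α‖ = 1)
    (hβ : ‖β‖ = 1) : ∃ C : ℂ, ∀ z, g z = C := by
  have hnorm := isBounded_range_of_doublyPeriodic hτ (G := fun z => ‖g z‖)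
    hg.diff.continuous.norm (fun z => by simp [hg.add_one, hα])
    (fun z => by simp [hg.add_tau, hβ])
  obtain ⟨M, hM⟩ := isBounded_iff_forall_norm_le.mp hnorm
  refine hg.diff.exists_const_forall_eq_of_bounded
    (isBounded_iff_forall_norm_le.mpr ⟨M, ?_⟩)
  rintro _ ⟨z, rfl⟩
  simpa using hM _ ⟨z, rfl⟩

theorem eq_exp_of_degree_zero (hτ : 0 < τ.im) (hg : IsTheta τ 0 α β g) :
    ∃ C γ : ℂ, ∀ z, g z = C * cexp (γ * z) := by
  by_cases h : ∃ z, g z ≠ 0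
  swap
  · push Not at h
    exact ⟨0, 0, fun z => by rw [h, zero_mul]⟩
  obtain ⟨z₀, h0⟩ := h
  have hα := hg.left_multiplier_ne_zero h0
  have hβ := hg.right_multiplier_ne_zero h0
  obtain ⟨γ, hγα, hγβ⟩ := exists_norm_exp_eq_and_norm_exp_mul_eq hτ hα hβ
  obtain ⟨C, hC⟩ := (hg.mul (exp (-γ))).eq_const_of_norm_eq_one hτ
    (by rw [norm_mul, Complex.exp_neg, norm_inv, hγα, mul_inv_cancel₀ (norm_ne_zero_iff.mpr hα)])
    (by rw [norm_mul, neg_mul, Complex.exp_neg, norm_inv, hγβ,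
      mul_inv_cancel₀ (norm_ne_zero_iff.mpr hβ)])
  refine ⟨C, γ, fun z => ?_⟩
  rw [← hC z, mul_assoc, ← Complex.exp_add, neg_mul, neg_add_cancel, Complex.exp_zero, mul_one]

end IsTheta

/-! ### The zeros of the theta function -/

/-- A function with the quasi-periods of `θ` whose only zeros are the lattice points, all of
them simple. This is the information about `θ` that allows division of theta functions. -/
structure IsSigma (τ : ℂ) (T : ℂ → ℂ) : Prop where
  isTheta : IsTheta τ 1 (-1) (tauFactor τ) T
  lattice_of_eq_zero : ∀ z, T z = 0 → ∃ k l : ℤ, z = k + l * τ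
  map_zero : T 0 = 0
  deriv_ne_zero : deriv T 0 ≠ 0

namespace IsSigma

variable {τ : ℂ} {T : ℂ → ℂ}

theorem lattice_eq_zero (hT : IsSigma τ T) (k l : ℤ) : T (k + l * τ) = 0 := by
  simpa [hT.map_zero] using
    hT.isTheta.add_lattice_eq_zero_iff (by norm_num) (tauFactor_ne_zero τ) k l 0

theorem deriv_ne_zero_of_eq_zero (hT : IsSigma τ T) {z : ℂ} (hz : T z = 0) : deriv T z ≠ 0 := by
  obtain ⟨k, l, rfl⟩ := hT.lattice_of_eq_zero z hz
  set u : ℂ → ℂ := fun z => (-1) ^ k * tauFactor τ ^ l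
    * cexp (-(π * I * (1 : ℕ) * l * ((l - 1) * τ + 2 * z)))
  have hTu : (fun z => T (z + (k + l * τ))) = fun z => u z * T z := by
    ext z
    rw [← add_assoc, hT.isTheta.add_lattice (by norm_num) (tauFactor_ne_zero τ)]
  have hderiv := (((by fun_prop : Differentiable ℂ u) 0).hasDerivAt.fun_mul
    (hT.isTheta.diff 0).hasDerivAt).deriv
  rw [← hTu, deriv_comp_add_const, zero_add, hT.map_zero, mul_zero, zero_add] at hderiv
  rw [hderiv]
  exact mul_ne_zero (mul_ne_zero (mul_ne_zero (zpow_ne_zero _ (by norm_num))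
    (zpow_ne_zero _ (tauFactor_ne_zero τ))) (exp_ne_zero _)) hT.deriv_ne_zero

theorem exists_ne_zero (hT : IsSigma τ T) : ∃ z, T z ≠ 0 := by
  by_contra! h
  exact hT.deriv_ne_zero (by simp [show T = fun _ => 0 from funext h])

theorem isTheta_sub (hT : IsSigma τ T) (a : ℂ) :
    IsTheta τ 1 (-1) (tauFactor τ * cexp (2 * π * I * a)) fun z => T (z - a) := by
  simpa [← sub_eq_add_neg] using hT.isTheta.shift (-a)

theorem exists_quotient (hT : IsSigma τ T) {n : ℕ} {α β : ℂ} {g : ℂ → ℂ}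
    (hg : IsTheta τ (n + 1) α β g) {a : ℂ} (ha : g a = 0) :
    ∃ h : ℂ → ℂ, IsTheta τ n (-α) (β * (tauFactor τ)⁻¹ * cexp (-(2 * π * I * a))) h ∧
      ∀ z, g z = T (z - a) * h z := by
  rcases em (∃ z, g z ≠ 0) with ⟨z₁, h1⟩ | hzero
  swap
  · push Not at hzero
    exact ⟨fun _ => 0, IsTheta.zero, by simpa using hzero⟩
  have hTa := hT.isTheta_sub a
  obtain ⟨h, hd, hh⟩ := exists_entire_quotient hTa.diff hg.diff (fun z hz => by
    constructor
    · obtain ⟨k, l, hkl⟩ := hT.lattice_of_eq_zero _ hz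
      rw [show z = a + k + l * τ by linear_combination hkl]
      exact (hg.add_lattice_eq_zero_iff (hg.left_multiplier_ne_zero h1)
        (hg.right_multiplier_ne_zero h1) k l a).mpr ha
    · rw [deriv_comp_sub_const]
      exact hT.deriv_ne_zero_of_eq_zero hz)
  refine ⟨h, ?_, hh⟩
  obtain ⟨z₀, hz₀⟩ := hT.exists_ne_zero
  refine hTa.of_mul (z₀ := z₀ + a) (by simpa using hz₀) hd ?_
  rw [← funext hh, add_comm 1 n]
  refine hg.congr (by ring) ?_
  have := tauFactor_ne_zero τ
  have := exp_ne_zero (2 * π * I * a)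
  rw [Complex.exp_neg]
  field_simp

end IsSigma

/-- The product `e^{-πiz} ∏_{n ≥ 0} (1 - qⁿ w) ∏_{n ≥ 1} (1 - qⁿ / w)`
with `q = e^{2πiτ}`, `w = e^{2πiz}`; by the Jacobi triple product it is a multiple of `θ`. -/
def thetaProd (τ z : ℂ) : ℂ :=
  cexp (-(π * I * z)) * qProd (cexp (2 * π * I * τ)) (cexp (2 * π * I * z))
    * qProd (cexp (2 * π * I * τ)) (cexp (2 * π * I * τ) * cexp (-(2 * π * I * z)))

theorem norm_nome_lt_one {τ : ℂ} (hτ : 0 < τ.im) : ‖cexp (2 * π * I * τ)‖ < 1 := by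
  have hre : (2 * π * I * τ).re = -(2 * π * τ.im) := by simp
  rw [Complex.norm_exp, Real.exp_lt_one_iff, hre, neg_lt_zero]
  positivity

theorem thetaProd_add_one (τ z : ℂ) : thetaProd τ (z + 1) = -thetaProd τ z := by
  have hhalf : cexp (-(π * I * (z + 1))) = -cexp (-(π * I * z)) := by
    rw [← Complex.exp_sub_pi_mul_I]
    ring_nf
  have hfull : cexp (2 * π * I * (z + 1)) = cexp (2 * π * I * z) := by
    rw [mul_add, mul_one, Complex.exp_add, exp_two_pi_mul_I, mul_one]
  rw [thetaProd, Complex.exp_neg (2 * π * I * (z + 1)), hhalf, hfull, thetaProd,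
    Complex.exp_neg (2 * π * I * z)]
  ring

theorem thetaProd_add_tau {τ : ℂ} (hτ : 0 < τ.im) (z : ℂ) :
    thetaProd τ (z + τ) = tauFactor τ * cexp (-(2 * π * I * z)) * thetaProd τ z := by
  have hq := norm_nome_lt_one hτ
  set q := cexp (2 * π * I * τ) with hqdef
  set w := cexp (2 * π * I * z) with hw
  have hw0 : w ≠ 0 := exp_ne_zero _
  have hq0 : q ≠ 0 := exp_ne_zero _
  have hhalf : cexp (-(π * I * (z + τ))) = cexp (-(π * I * τ)) * cexp (-(π * I * z)) := by
    rw [← Complex.exp_add]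
    ring_nf
  have hfull : cexp (2 * π * I * (z + τ)) = q * w := by
    rw [hqdef, hw, ← Complex.exp_add]
    ring_nf
  have hcancel : q * (q * w)⁻¹ = w⁻¹ := by field_simp
  rw [thetaProd, thetaProd, hhalf, Complex.exp_neg (2 * π * I * (z + τ)), hfull, hcancel,
    ← hqdef, ← hw, Complex.exp_neg (2 * π * I * z), ← hw, qProd_eq_one_sub_mul hq w⁻¹,
    qProd_eq_one_sub_mul hq w, tauFactor]
  field_simp
  ring

theorem isTheta_thetaProd {τ : ℂ} (hτ : 0 < τ.im) :
    IsTheta τ 1 (-1) (tauFactor τ) (thetaProd τ) := by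
  refine ⟨?_, fun z => by rw [thetaProd_add_one, neg_one_mul],
    fun z => by rw [thetaProd_add_tau hτ, Nat.cast_one, mul_one]⟩
  have := differentiable_qProd (norm_nome_lt_one hτ)
  unfold thetaProd
  fun_prop

theorem exists_eq_of_thetaProd_eq_zero {τ : ℂ} (hτ : 0 < τ.im) {z : ℂ}
    (hz : thetaProd τ z = 0) : ∃ k l : ℤ, z = k + l * τ := by
  have hq := norm_nome_lt_one hτ
  by_contra hcon
  refine mul_ne_zero (mul_ne_zero (exp_ne_zero _) (qProd_ne_zero hq fun n hn => hcon ?_))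
    (qProd_ne_zero hq fun n hn => hcon ?_) hz
  · rw [← Complex.exp_nat_mul, ← Complex.exp_add, Complex.exp_eq_one_iff] at hn
    obtain ⟨k, hk⟩ := hn
    refine ⟨k, -n, mul_left_cancel₀ Complex.two_pi_I_ne_zero ?_⟩
    push_cast
    linear_combination hk
  · rw [← Complex.exp_nat_mul, ← Complex.exp_add, ← Complex.exp_add,
      Complex.exp_eq_one_iff] at hn
    obtain ⟨k, hk⟩ := hn
    refine ⟨-k, n + 1, mul_left_cancel₀ Complex.two_pi_I_ne_zero ?_⟩
    push_cast
    linear_combination -hk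

theorem deriv_thetaProd_zero_ne_zero {τ : ℂ} (hτ : 0 < τ.im) : deriv (thetaProd τ) 0 ≠ 0 := by
  have hq := norm_nome_lt_one hτ
  set q := cexp (2 * π * I * τ) with hqdef
  set R : ℂ → ℂ := fun z => qProd q (q * cexp (2 * π * I * z))
    * qProd q (q * cexp (-(2 * π * I * z))) with hR
  have hRd : Differentiable ℂ R := by
    have := differentiable_qProd hq
    fun_prop
  have hfactor : thetaProd τ = fun z => (cexp (-(π * I * z)) - cexp (π * I * z)) * R z := by
    funext z
    have hexp : cexp (π * I * z) = cexp (-(π * I * z)) * cexp (2 * π * I * z) := by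
      rw [← Complex.exp_add]
      ring_nf
    rw [thetaProd, ← hqdef, qProd_eq_one_sub_mul hq, hexp]
    ring
  have hd : HasDerivAt (fun z : ℂ => cexp (-(π * I * z)) - cexp (π * I * z))
      (-(2 * π * I)) 0 := by
    have hlin : HasDerivAt (fun z : ℂ => (π * I : ℂ) * z) (π * I) 0 := by
      simpa using (hasDerivAt_id (0 : ℂ)).const_mul (π * I : ℂ)
    refine (hlin.fun_neg.cexp.fun_sub hlin.cexp).congr_deriv ?_
    rw [mul_zero, neg_zero, Complex.exp_zero]
    ring
  have hqq : qProd q q ≠ 0 := by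
    refine qProd_ne_zero hq fun n hn => ?_
    have hnorm : ‖q ^ (n + 1)‖ = 1 := by rw [pow_succ, hn, norm_one]
    rw [norm_pow] at hnorm
    exact (pow_lt_one₀ (norm_nonneg _) hq n.succ_ne_zero).ne hnorm
  rw [hfactor, (hd.fun_mul (hRd 0).hasDerivAt).deriv]
  simp [hR, hqq, Real.pi_ne_zero]

theorem isSigma_thetaProd {τ : ℂ} (hτ : 0 < τ.im) : IsSigma τ (thetaProd τ) :=
  ⟨isTheta_thetaProd hτ, fun _ => exists_eq_of_thetaProd_eq_zero hτ,
    by simp [thetaProd, qProd_eq_one_sub_mul (norm_nome_lt_one hτ) 1],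
    deriv_thetaProd_zero_ne_zero hτ⟩

theorem exists_theta_eq_mul_thetaProd {τ : ℂ} (hτ : 0 < τ.im) :
    ∃ C ≠ 0, ∀ z, theta τ z = C * thetaProd τ z := by
  obtain ⟨h, hh, hθ⟩ := (isSigma_thetaProd hτ).exists_quotient (n := 0) (IsTheta.of_theta hτ)
    (theta_zero τ)
  obtain ⟨C, hC⟩ := hh.eq_const_of_norm_eq_one hτ (by simp)
    (by simp [tauFactor_ne_zero])
  have hθC (z : ℂ) : theta τ z = C * thetaProd τ z := by rw [hθ, hC, sub_zero, mul_comm]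
  refine ⟨C, ?_, hθC⟩
  rintro rfl
  obtain ⟨z, hz⟩ := exists_theta_ne_zero hτ
  exact hz (by rw [hθC, zero_mul])

theorem isSigma_theta {τ : ℂ} (hτ : 0 < τ.im) : IsSigma τ (theta τ) := by
  obtain ⟨C, hC0, hC⟩ := exists_theta_eq_mul_thetaProd hτ
  refine ⟨IsTheta.of_theta hτ, fun z hz => exists_eq_of_thetaProd_eq_zero hτ ?_, theta_zero τ, ?_⟩
  · rw [hC] at hz
    exact (mul_eq_zero.mp hz).resolve_left hC0
  · rw [funext hC, deriv_const_mul_field]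
    exact mul_ne_zero hC0 (deriv_thetaProd_zero_ne_zero hτ)

theorem theta_eq_zero_iff {τ : ℂ} (hτ : 0 < τ.im) {z : ℂ} :
    theta τ z = 0 ↔ ∃ k l : ℤ, z = k + l * τ := by
  refine ⟨(isSigma_theta hτ).lattice_of_eq_zero z, ?_⟩
  rintro ⟨k, l, rfl⟩
  exact (isSigma_theta hτ).lattice_eq_zero k l

theorem theta_add_eq_zero {τ : ℂ} (hτ : 0 < τ.im) {a b : ℂ} (ha : theta τ a = 0)
    (hb : theta τ b = 0) : theta τ (a + b) = 0 := by
  rw [theta_eq_zero_iff hτ] at *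
  obtain ⟨k, l, rfl⟩ := ha
  obtain ⟨k', l', rfl⟩ := hb
  exact ⟨k + k', l + l', by push_cast; ring⟩

theorem theta_neg_eq_zero {τ : ℂ} {a : ℂ} (ha : theta τ a = 0) : theta τ (-a) = 0 := by
  rw [theta_neg, ha, neg_zero]

theorem theta_sub_eq_zero {τ : ℂ} (hτ : 0 < τ.im) {a b : ℂ} (ha : theta τ a = 0)
    (hb : theta τ b = 0) : theta τ (a - b) = 0 := by
  rw [sub_eq_add_neg]
  exact theta_add_eq_zero hτ ha (theta_neg_eq_zero hb)

theorem eq_zero_of_add_mul_eq_zero {τ : ℂ} (hτ : 0 < τ.im) {k l : ℤ}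
    (h : (k : ℂ) + l * τ = 0) : k = 0 ∧ l = 0 := by
  have hl : l = 0 := by
    have him : (l : ℝ) * τ.im = 0 := by simpa using congrArg Complex.im h
    exact_mod_cast (mul_eq_zero.mp him).resolve_right hτ.ne'
  subst hl
  exact ⟨by simpa using h, rfl⟩

theorem theta_ne_zero_of_two_mul_eq {τ : ℂ} (hτ : 0 < τ.im) {w : ℂ} {k l : ℤ}
    (hw : 2 * w = k + l * τ) (hodd : Odd k ∨ Odd l) : theta τ w ≠ 0 := by
  intro h0
  obtain ⟨k', l', hkl⟩ := (theta_eq_zero_iff hτ).mp h0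
  obtain ⟨hk, hl⟩ := eq_zero_of_add_mul_eq_zero hτ (k := k - 2 * k') (l := l - 2 * l')
    (by push_cast; linear_combination 2 * hkl - hw)
  simp only [Int.odd_iff] at hodd
  omega

theorem theta_half_ne_zero {τ : ℂ} (hτ : 0 < τ.im) : theta τ (1 / 2) ≠ 0 :=
  theta_ne_zero_of_two_mul_eq (k := 1) (l := 0) hτ (by norm_num) (by simp)

/-! ### Zeros of theta functions of degree `n` -/

/-- The points `a i`, `i ∈ s`, are pairwise distinct modulo `ℤ + τℤ` (recall that `θ` vanishes
exactly on this lattice). -/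
def IncongruentOn {ι : Type*} (τ : ℂ) (s : Finset ι) (a : ι → ℂ) : Prop :=
  ∀ i ∈ s, ∀ j ∈ s, i ≠ j → theta τ (a i - a j) ≠ 0

/-- `w` has infinite order modulo `ℤ + τℤ`. -/
def IsGenericStep (τ w : ℂ) : Prop := ∀ k : ℤ, k ≠ 0 → theta τ (k * w) ≠ 0

theorem IsGenericStep.ne_zero {τ w : ℂ} (hw : IsGenericStep τ w) : w ≠ 0 := by
  rintro rfl
  exact hw 1 one_ne_zero (by rw [mul_zero, theta_zero])

theorem IncongruentOn.subset {ι : Type*} {τ : ℂ} {s t : Finset ι} {a : ι → ℂ}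
    (h : IncongruentOn τ s a) (hts : t ⊆ s) : IncongruentOn τ t a :=
  fun i hi j hj => h i (hts hi) j (hts hj)

theorem IsGenericStep.incongruentOn {τ w : ℂ} (hw : IsGenericStep τ w) (s : Finset ℕ) (x : ℂ) :
    IncongruentOn τ s fun k => x - k * w := by
  intro i _ j _ hij
  convert hw ((j : ℤ) - i) (sub_ne_zero.mpr (by exact_mod_cast hij.symm)) using 2
  push_cast
  ring

namespace IsTheta

variable {τ : ℂ} {n : ℕ} {α β : ℂ} {f g : ℂ → ℂ}

theorem eq_zero_congr (hτ : 0 < τ.im) (hf : IsTheta τ n α β f) {a b : ℂ}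
    (h : theta τ (a - b) = 0) : f a = 0 ↔ f b = 0 := by
  rcases em (∃ z, f z ≠ 0) with ⟨z, hz⟩ | hzero
  · obtain ⟨k, l, hkl⟩ := (theta_eq_zero_iff hτ).mp h
    rw [show a = b + k + l * τ by linear_combination hkl]
    exact hf.add_lattice_eq_zero_iff (hf.left_multiplier_ne_zero hz)
      (hf.right_multiplier_ne_zero hz) k l b
  · push Not at hzero
    simp [hzero]

theorem prod_theta (hτ : 0 < τ.im) {ι : Type*} (s : Finset ι) (b : ι → ℂ) :
    IsTheta τ s.card ((-1) ^ s.card)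
      (tauFactor τ ^ s.card * cexp (-(2 * π * I * ∑ i ∈ s, b i)))
      fun z => ∏ i ∈ s, theta τ (z + b i) := by
  classical
  induction s using Finset.induction_on with
  | empty => simpa using one
  | insert i s his ih =>
    simp only [Finset.prod_insert his, Finset.sum_insert his, Finset.card_insert_of_notMem his]
    have hmul := ((IsTheta.of_theta hτ).shift (b i)).mul ih
    rw [add_comm 1] at hmul
    refine hmul.congr (by ring) ?_
    rw [mul_add, neg_add, Complex.exp_add]
    push_cast
    ring_nf

theorem prod_theta_sub (hτ : 0 < τ.im) {ι : Type*} (s : Finset ι) (b : ι → ℂ) :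
    IsTheta τ s.card ((-1) ^ s.card)
      (tauFactor τ ^ s.card * cexp (2 * π * I * ∑ i ∈ s, b i))
      fun z => ∏ i ∈ s, theta τ (z - b i) := by
  have hprod := prod_theta hτ s fun i => -b i
  simp only [← sub_eq_add_neg] at hprod
  refine hprod.congr rfl ?_
  rw [Finset.sum_neg_distrib]
  ring_nf

theorem exists_prod_mul (hτ : 0 < τ.im) {ι : Type*} {s : Finset ι} {a : ι → ℂ}
    (ha : IncongruentOn τ s a) (hg : IsTheta τ (n + s.card) α β g) (h0 : ∀ i ∈ s, g (a i) = 0) :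
    ∃ (h : ℂ → ℂ) (α' β' : ℂ), IsTheta τ n α' β' h ∧
      ∀ z, g z = (∏ i ∈ s, theta τ (z - a i)) * h z := by
  classical
  induction s using Finset.induction_on generalizing α β g with
  | empty => exact ⟨g, α, β, by simpa using hg, by simp⟩
  | insert i s his ih =>
    rw [Finset.card_insert_of_notMem his, ← add_assoc] at hg
    obtain ⟨h₁, hh₁, e₁⟩ :=
      (isSigma_theta hτ).exists_quotient hg (h0 i (Finset.mem_insert_self _ _))
    obtain ⟨h, α', β', hh, e⟩ := ih (ha.subset (Finset.subset_insert _ _)) hh₁ fun j hj => by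
      have hj' := h0 j (Finset.mem_insert_of_mem hj)
      rw [e₁] at hj'
      exact (mul_eq_zero.mp hj').resolve_left
        (ha j (Finset.mem_insert_of_mem hj) i (Finset.mem_insert_self _ _)
          (fun hji => his (hji ▸ hj)))
    refine ⟨h, α', β', hh, fun z => ?_⟩
    rw [e₁, e, Finset.prod_insert his]
    ring

theorem eq_zero_of_card_lt (hτ : 0 < τ.im) {ι : Type*} {s : Finset ι} {a : ι → ℂ}
    (ha : IncongruentOn τ s a) (hg : IsTheta τ n α β g) (h0 : ∀ i ∈ s, g (a i) = 0)
    (hn : n < s.card) (z : ℂ) : g z = 0 := by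
  obtain ⟨t, hts, htn⟩ := Finset.exists_subset_card_eq hn.le
  obtain ⟨i, his, hit⟩ := Finset.exists_of_ssubset (hts.ssubset_of_ne (by
    rintro rfl
    exact hn.ne' htn))
  rw [← zero_add n, ← htn] at hg
  obtain ⟨h, α', β', hh, hprod⟩ := exists_prod_mul hτ (ha.subset hts) hg
    (fun j hj => h0 j (hts hj))
  obtain ⟨C, γ, hC⟩ := hh.eq_exp_of_degree_zero hτ
  have hi := h0 i his
  rw [hprod, hC] at hi
  have hne : ∏ j ∈ t, theta τ (a i - a j) ≠ 0 :=
    Finset.prod_ne_zero_iff.mpr fun j hj => ha i his j (hts hj) (fun hij => hit (hij ▸ hj))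
  have hC0 : C = 0 :=
    (mul_eq_zero.mp ((mul_eq_zero.mp hi).resolve_left hne)).resolve_right (exp_ne_zero _)
  rw [hprod, hC, hC0, zero_mul, mul_zero]

theorem eq_const_mul_of_zeros (hτ : 0 < τ.im) {ι : Type*} {s : Finset ι} {a : ι → ℂ}
    (ha : IncongruentOn τ s a) (hf : IsTheta τ n α β f) (hg : IsTheta τ n α β g)
    (hf0 : ∀ i ∈ s, f (a i) = 0) (hg0 : ∀ i ∈ s, g (a i) = 0) (hn : n ≤ s.card)
    {z₀ : ℂ} (hz₀ : g z₀ ≠ 0) : ∃ r : ℂ, ∀ z, f z = r * g z := by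
  refine ⟨f z₀ / g z₀, fun z => ?_⟩
  have hne (i) (hi : i ∈ s) : theta τ (z₀ - a i) ≠ 0 := fun h =>
    hz₀ ((hg.eq_zero_congr hτ h).mpr (hg0 i hi))
  refine sub_eq_zero.mp (eq_zero_of_card_lt hτ (s := Finset.insertNone s)
    (a := fun o => o.elim z₀ a) ?_ (hf.sub (hg.const_mul (f z₀ / g z₀))) ?_
    (by rw [Finset.card_insertNone]; omega) z)
  · rintro (_ | i) hi (_ | j) hj hij
    · exact absurd rfl hij
    · exact hne j (by simpa using hj)
    · dsimp only [Option.elim]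
      rw [theta_sub_comm]
      exact neg_ne_zero.mpr (hne i (by simpa using hi))
    · exact ha i (by simpa using hi) j (by simpa using hj) (fun h => hij (by rw [h]))
  · rintro (_ | i) hi
    · simp only [Option.elim]
      rw [div_mul_cancel₀ _ hz₀, sub_self]
    · simp [hf0 i (by simpa using hi), hg0 i (by simpa using hi)]

theorem eq_const_mul_of_translation (hτ : 0 < τ.im) {w : ℂ} (hw : IsGenericStep τ w)
    (hf : IsTheta τ n α β f) (hg : IsTheta τ n α β g) {z₀ : ℂ} (hz₀ : g z₀ ≠ 0)
    (h : ∀ z, f (z - w) * g z = f z * g (z - w)) : ∃ r : ℂ, ∀ z, f z = r * g z := by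
  obtain ⟨x, hx⟩ := exists_prod_ne_zero (Finset.range (n + 1))
    (f := fun k z => g (z - k * w))
    (fun k _ => hg.diff.comp (differentiable_id.sub_const _))
    (fun k _ => ⟨z₀ + k * w, by simpa using hz₀⟩)
  have hgk : ∀ k < n + 1, g (x - k * w) ≠ 0 := fun k hk =>
    Finset.prod_ne_zero_iff.mp hx k (Finset.mem_range.mpr hk)
  have hgx : g x ≠ 0 := by simpa using hgk 0 (by omega)
  have hratio : ∀ k < n + 1, f (x - k * w) = f x / g x * g (x - k * w) := by
    intro k
    induction k with
    | zero => intro _; field_simp; simp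
    | succ k ih =>
      intro hk
      have hstep := h (x - k * w)
      rw [ih (by omega),
        show x - k * w - w = x - ((k + 1 : ℕ) : ℂ) * w by push_cast; ring] at hstep
      exact mul_right_cancel₀ (hgk k (by omega)) (by linear_combination hstep)
  refine ⟨f x / g x, fun z => sub_eq_zero.mp ?_⟩
  refine eq_zero_of_card_lt hτ (hw.incongruentOn (Finset.range (n + 1)) x)
    (hf.sub (hg.const_mul (f x / g x))) ?_ (by simp) z
  intro k hk
  rw [hratio k (Finset.mem_range.mp hk), sub_self]

theorem exists_zero (hτ : 0 < τ.im) (hn : n ≠ 0) (hg : IsTheta τ n α β g) : ∃ z, g z = 0 := by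
  by_contra! hne
  have hα := hg.left_multiplier_ne_zero (hne 0)
  have hβ := hg.right_multiplier_ne_zero (hne 0)
  have hpow := prod_theta hτ (Finset.range n) fun _ => 0
  simp only [add_zero, Finset.prod_const, Finset.card_range] at hpow
  have hquot : IsTheta τ 0 ((-1) ^ n / α) _ fun z => theta τ z ^ n / g z :=
    hg.of_mul (hne 0) (hpow.diff.fun_div hg.diff hne) <| by
      simp only [mul_div_cancel₀ _ (hne _), mul_div_cancel₀ _ hα]
      exact hpow.congr rfl (mul_div_cancel₀ _ hβ).symm
  obtain ⟨C, γ, hC⟩ := hquot.eq_exp_of_degree_zero hτ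
  have hC0 : C = 0 := by simpa [theta_zero, hn] using (hC 0).symm
  obtain ⟨z, hz⟩ := exists_theta_ne_zero hτ
  have hCz := hC z
  rw [hC0, zero_mul] at hCz
  exact div_ne_zero (pow_ne_zero n hz) (hne z) hCz

theorem theta_eq_zero_of_degree_zero (hτ : 0 < τ.im) {a : ℂ}
    (hg : IsTheta τ 0 1 (cexp (-(2 * π * I * a))) g) {z₀ : ℂ} (h0 : g z₀ ≠ 0) :
    theta τ a = 0 := by
  obtain ⟨C, γ, hC⟩ := hg.eq_exp_of_degree_zero hτ
  have hC0 : C ≠ 0 := fun h => h0 (by rw [hC, h, zero_mul])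
  have hone : cexp γ = 1 := by
    have h := hg.add_one 0
    rw [hC, hC] at h
    exact mul_left_cancel₀ hC0 (by simpa using h)
  have htau : cexp (γ * τ) = cexp (-(2 * π * I * a)) := by
    have h := hg.add_tau 0
    rw [hC, hC] at h
    exact mul_left_cancel₀ hC0 (by simpa [mul_comm C] using h)
  obtain ⟨k, hk⟩ := Complex.exp_eq_one_iff.mp hone
  obtain ⟨l, hl⟩ := Complex.exp_eq_exp_iff_exists_int.mp htau
  refine (theta_eq_zero_iff hτ).mpr ⟨l, -k, mul_left_cancel₀ Complex.two_pi_I_ne_zero ?_⟩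
  rw [hk] at hl
  push_cast
  linear_combination hl

theorem eq_const_mul_theta (hτ : 0 < τ.im) (hg : IsTheta τ 1 (-1) (tauFactor τ) g) :
    ∃ C : ℂ, ∀ z, g z = C * theta τ z := by
  obtain ⟨a, ha⟩ := exists_theta_ne_zero hτ
  refine ⟨g a / theta τ a, fun z => ?_⟩
  obtain ⟨h, hh, hgh⟩ := (isSigma_theta hτ).exists_quotient (n := 0) (a := a)
    (hg.sub ((of_theta hτ).const_mul (g a / theta τ a))) (by rw [div_mul_cancel₀ _ ha, sub_self])
  have hh0 : h z = 0 := by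
    by_contra hz
    refine ha (theta_eq_zero_of_degree_zero hτ (hh.congr (by norm_num) ?_) hz)
    rw [mul_inv_cancel₀ (tauFactor_ne_zero τ), one_mul]
  exact sub_eq_zero.mp (by rw [hgh, hh0, mul_zero])

end IsTheta

/-! ### Even theta functions -/

/-- The even theta function `θ(z - b) θ(z + b)` of degree two with the zeros `± b`. -/
def pairTheta (τ b z : ℂ) : ℂ := theta τ (z - b) * theta τ (z + b)

theorem pairTheta_neg (τ b z : ℂ) : pairTheta τ b (-z) = pairTheta τ b z := by
  rw [pairTheta, pairTheta, show -z - b = -(z + b) by ring, show -z + b = -(z - b) by ring,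
    theta_neg, theta_neg]
  ring

theorem pairTheta_zero_left (τ z : ℂ) : pairTheta τ 0 z = theta τ z ^ 2 := by
  simp [pairTheta, sq]

theorem pairTheta_self (τ b : ℂ) : pairTheta τ b b = 0 := by
  simp [pairTheta, theta_zero]

theorem pairTheta_symm (τ b z : ℂ) : pairTheta τ b z = -pairTheta τ z b := by
  rw [pairTheta, pairTheta, theta_sub_comm, add_comm]
  ring

theorem isTheta_pairTheta {τ : ℂ} (hτ : 0 < τ.im) (b : ℂ) :
    IsTheta τ 2 1 (tauFactor τ ^ 2) (pairTheta τ b) := by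
  have hmul := ((IsTheta.of_theta hτ).shift (-b)).mul ((IsTheta.of_theta hτ).shift b)
  simp only [← sub_eq_add_neg] at hmul
  refine hmul.congr (by norm_num) ?_
  have hexp : cexp (-(2 * π * I * (1 : ℕ) * -b)) * cexp (-(2 * π * I * (1 : ℕ) * b)) = 1 := by
    rw [← Complex.exp_add]
    simp
  linear_combination tauFactor τ ^ 2 * hexp

theorem isTheta_theta_sq {τ : ℂ} (hτ : 0 < τ.im) :
    IsTheta τ 2 1 (tauFactor τ ^ 2) fun z => theta τ z ^ 2 := by
  simpa only [← pairTheta_zero_left] using isTheta_pairTheta hτ 0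

theorem IsTheta.prod_even {τ : ℂ} {ι : Type*} (s : Finset ι) {f : ι → ℂ → ℂ}
    (hf : ∀ i ∈ s, IsTheta τ 2 1 (tauFactor τ ^ 2) (f i)) :
    IsTheta τ (2 * s.card) 1 (tauFactor τ ^ (2 * s.card)) fun z => ∏ i ∈ s, f i z := by
  classical
  induction s using Finset.induction_on with
  | empty => simpa using IsTheta.one
  | insert i s his ih =>
    simp only [Finset.prod_insert his, Finset.card_insert_of_notMem his]
    rw [show 2 * (s.card + 1) = 2 + 2 * s.card by ring]
    exact ((hf i (Finset.mem_insert_self _ _)).mul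
      (ih fun j hj => hf j (Finset.mem_insert_of_mem hj))).congr (by ring) (by ring)

/-- Lagrange interpolation by theta functions: the even theta function of degree `2n` with
the value `y i` at the node `b i`, for `i ≤ n`. -/
def interp (τ : ℂ) (n : ℕ) (b y : ℕ → ℂ) (z : ℂ) : ℂ :=
  ∑ i ∈ Finset.range (n + 1), y i *
    ∏ j ∈ (Finset.range (n + 1)).erase i, ((pairTheta τ (b j) (b i))⁻¹ * pairTheta τ (b j) z)

theorem isTheta_interp {τ : ℂ} (hτ : 0 < τ.im) (n : ℕ) (b y : ℕ → ℂ) :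
    IsTheta τ (2 * n) 1 (tauFactor τ ^ (2 * n)) (interp τ n b y) := by
  refine IsTheta.sum fun i hi => IsTheta.const_mul ?_ _
  have hprod := IsTheta.prod_even ((Finset.range (n + 1)).erase i)
    (f := fun j z => (pairTheta τ (b j) (b i))⁻¹ * pairTheta τ (b j) z)
    fun j _ => (isTheta_pairTheta hτ (b j)).const_mul _
  rwa [Finset.card_erase_of_mem hi, Finset.card_range, Nat.add_sub_cancel] at hprod

theorem interp_neg (τ : ℂ) (n : ℕ) (b y : ℕ → ℂ) (z : ℂ) :
    interp τ n b y (-z) = interp τ n b y z := by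
  simp only [interp, pairTheta_neg]

theorem interp_node {τ : ℂ} {n : ℕ} {b : ℕ → ℂ} (y : ℕ → ℂ)
    (hb : ∀ i ≤ n, ∀ j ≤ n, i ≠ j → pairTheta τ (b j) (b i) ≠ 0) {i : ℕ} (hi : i ≤ n) :
    interp τ n b y (b i) = y i := by
  have hmem : i ∈ Finset.range (n + 1) := Finset.mem_range.mpr (by omega)
  rw [interp, Finset.sum_eq_single_of_mem i hmem]
  · rw [Finset.prod_eq_one, mul_one]
    intro j hj
    rw [Finset.mem_erase, Finset.mem_range] at hj
    exact inv_mul_cancel₀ (hb i hi j (by omega) hj.1.symm)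
  · intro k _ hki
    rw [Finset.prod_eq_zero (Finset.mem_erase.mpr ⟨hki.symm, hmem⟩), mul_zero]
    rw [pairTheta_self, mul_zero]

theorem IsTheta.eq_const_mul_pairTheta {τ : ℂ} (hτ : 0 < τ.im) {g : ℂ → ℂ}
    (hg : IsTheta τ 2 1 (tauFactor τ ^ 2) g) {b : ℂ} (hb : g b = 0) :
    ∃ C : ℂ, ∀ z, g z = C * pairTheta τ b z := by
  obtain ⟨h, hh, hgh⟩ := (isSigma_theta hτ).exists_quotient hg hb
  obtain ⟨C, hC⟩ := IsTheta.eq_const_mul_theta hτ ((hh.shift (-b)).congr rfl (by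
    rw [mul_assoc, ← Complex.exp_add, Nat.cast_one,
      show -(2 * π * I * b) + -(2 * π * I * 1 * -b) = 0 by ring, Complex.exp_zero, mul_one, sq,
      mul_inv_cancel_right₀ (tauFactor_ne_zero τ)]))
  refine ⟨C, fun z => ?_⟩
  have hCz := hC (z + b)
  rw [add_neg_cancel_right] at hCz
  rw [hgh, hCz, pairTheta]
  ring

theorem pairTheta_half_ne_zero {τ : ℂ} (hτ : 0 < τ.im) {a : ℂ} (ha : theta τ a = 0) :
    pairTheta τ (1 / 2) a ≠ 0 := by
  refine mul_ne_zero (fun h => theta_half_ne_zero hτ ?_) fun h => theta_half_ne_zero hτ ?_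
  · simpa only [sub_sub_cancel] using theta_sub_eq_zero hτ ha h
  · simpa only [add_sub_cancel_left] using theta_sub_eq_zero hτ h ha

theorem pairTheta_addition {τ : ℂ} (hτ : 0 < τ.im) (b z : ℂ) :
    -theta τ (1 / 2) ^ 2 * pairTheta τ b z
      = pairTheta τ (1 / 2) b * theta τ z ^ 2 - theta τ b ^ 2 * pairTheta τ (1 / 2) z := by
  have hzero (b : ℂ) : pairTheta τ b 0 = -theta τ b ^ 2 := by
    rw [pairTheta_symm, pairTheta_zero_left]
  obtain ⟨C, hC⟩ := (((isTheta_theta_sq hτ).const_mul (pairTheta τ (1 / 2) b)).sub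
    ((isTheta_pairTheta hτ (1 / 2)).const_mul (theta τ b ^ 2))).eq_const_mul_pairTheta hτ
    (b := b) (by ring)
  suffices hC' : C = -theta τ (1 / 2) ^ 2 by rw [hC, hC']
  rcases eq_or_ne (theta τ b) 0 with hb | hb
  · have hhalf := hC (1 / 2)
    rw [pairTheta_self, pairTheta_symm τ b] at hhalf
    exact mul_right_cancel₀ (pairTheta_half_ne_zero hτ hb) (by linear_combination hhalf)
  · have h0 := hC 0
    rw [theta_zero, hzero, hzero] at h0
    exact mul_right_cancel₀ (pow_ne_zero 2 hb) (by linear_combination h0)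

/-- The even elliptic function of degree two `θ(z - 1/2) θ(z + 1/2) / θ(z)²`, an affine function
of the Weierstrass function `℘`. -/
def ellX (τ z : ℂ) : ℂ := pairTheta τ (1 / 2) z / theta τ z ^ 2

theorem pairTheta_eq_ellX {τ : ℂ} (hτ : 0 < τ.im) {b z : ℂ} (hb : theta τ b ≠ 0)
    (hz : theta τ z ≠ 0) : pairTheta τ b z
      = (theta τ b ^ 2 / theta τ (1 / 2) ^ 2) * theta τ z ^ 2 * (ellX τ z - ellX τ b) := by
  have hadd := pairTheta_addition hτ b z
  have := theta_half_ne_zero hτ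
  rw [ellX, ellX]
  field_simp
  linear_combination -hadd

theorem ellX_eq_iff {τ : ℂ} (hτ : 0 < τ.im) {b z : ℂ} (hb : theta τ b ≠ 0)
    (hz : theta τ z ≠ 0) : ellX τ z = ellX τ b ↔ pairTheta τ b z = 0 := by
  rw [pairTheta_eq_ellX hτ hb hz]
  simp [hb, hz, theta_half_ne_zero hτ, -one_div, sub_eq_zero]

theorem exists_ellX_eq {τ : ℂ} (hτ : 0 < τ.im) (x : ℂ) :
    ∃ a, theta τ a ≠ 0 ∧ ellX τ a = x := by
  obtain ⟨a, ha⟩ := ((isTheta_pairTheta hτ (1 / 2)).sub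
    ((isTheta_theta_sq hτ).const_mul x)).exists_zero hτ two_ne_zero
  have ha0 : theta τ a ≠ 0 := fun h0 => pairTheta_half_ne_zero hτ h0 (by simpa [h0] using ha)
  refine ⟨a, ha0, ?_⟩
  rw [ellX, div_eq_iff (pow_ne_zero 2 ha0)]
  exact sub_eq_zero.mp ha

/-- Representatives of the three nontrivial points of order two modulo `ℤ + τℤ`. -/
def halfPeriods (τ : ℂ) : Finset ℂ := {1 / 2, τ / 2, 1 / 2 + τ / 2}

theorem exists_halfPeriod {τ : ℂ} (hτ : 0 < τ.im) {a : ℂ} (ha : theta τ a ≠ 0)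
    (h2 : theta τ (2 * a) = 0) : ∃ w ∈ halfPeriods τ, theta τ (a - w) = 0 := by
  obtain ⟨k, l, hkl⟩ := (theta_eq_zero_iff hτ).mp h2
  have ea : a = k / 2 + l * τ / 2 := by linear_combination hkl / 2
  simp only [ne_eq, theta_eq_zero_iff hτ] at ha ⊢
  rcases Int.even_or_odd' k with ⟨k', rfl | rfl⟩ <;> rcases Int.even_or_odd' l with ⟨l', rfl | rfl⟩
  · refine (ha ⟨k', l', ?_⟩).elim
    rw [ea]; push_cast; ring
  · refine ⟨τ / 2, by simp [halfPeriods], k', l', ?_⟩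
    rw [ea]; push_cast; ring
  · refine ⟨1 / 2, by simp [halfPeriods], k', l', ?_⟩
    rw [ea]; push_cast; ring
  · refine ⟨1 / 2 + τ / 2, by simp [halfPeriods], k', l', ?_⟩
    rw [ea]; push_cast; ring

theorem exists_odd_of_mem_halfPeriods {τ w : ℂ} (hw : w ∈ halfPeriods τ) :
    ∃ k l : ℤ, 2 * w = k + l * τ ∧ (Odd k ∨ Odd l) := by
  simp only [halfPeriods, Finset.mem_insert, Finset.mem_singleton] at hw
  rcases hw with h | h | h
  · exact ⟨1, 0, by rw [h]; norm_num, by simp⟩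
  · exact ⟨0, 1, by rw [h]; push_cast; ring, by simp⟩
  · exact ⟨1, 1, by rw [h]; push_cast; ring, by simp⟩

theorem theta_ne_zero_of_mem_halfPeriods {τ : ℂ} (hτ : 0 < τ.im) {w : ℂ}
    (hw : w ∈ halfPeriods τ) : theta τ w ≠ 0 := by
  obtain ⟨k, l, hkl, hodd⟩ := exists_odd_of_mem_halfPeriods hw
  exact theta_ne_zero_of_two_mul_eq hτ hkl hodd

theorem theta_two_mul_of_mem_halfPeriods {τ : ℂ} (hτ : 0 < τ.im) {w : ℂ}
    (hw : w ∈ halfPeriods τ) : theta τ (2 * w) = 0 := by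
  obtain ⟨k, l, hkl, -⟩ := exists_odd_of_mem_halfPeriods hw
  exact (theta_eq_zero_iff hτ).mpr ⟨k, l, hkl⟩

/-! ### Specialization of separable polynomials -/

section Specialization

open Polynomial

theorem finite_eval_eq_zero {p : ℂ[X]} (h : p.eval 0 ≠ 0) : {d : ℂ | p.eval d = 0}.Finite := by
  have hp : p ≠ 0 := by
    rintro rfl
    simp at h
  exact (p.roots.toFinset.finite_toSet).subset fun d hd => by simpa [hp] using hd

theorem finite_not_separable {P : ℂ[X][X]} {m : ℕ} (hm : m ≠ 0) (hP : P.natDegree ≤ m)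
    (h0 : (P.map (evalRingHom 0)).natDegree = m) (hs : (P.map (evalRingHom 0)).Separable) :
    {d : ℂ | ¬ ((P.map (evalRingHom d)).natDegree = m ∧
      (P.map (evalRingHom d)).Separable)}.Finite := by
  have hP' : P.derivative.natDegree ≤ m - 1 := (natDegree_derivative_le P).trans (by omega)
  obtain ⟨U, V, -, -, hUV⟩ := exists_mul_add_mul_eq_C_resultant P P.derivative hP hP' (Or.inl hm)
  set ρ := P.resultant P.derivative m (m - 1)
  have hcoeff : (P.coeff m).eval 0 ≠ 0 := by
    have : (P.map (evalRingHom 0)).coeff m ≠ 0 := by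
      rw [← h0]
      exact leadingCoeff_ne_zero.mpr hs.ne_zero
    simpa using this
  have hres : ρ.eval 0 ≠ 0 := by
    have hne := resultant_ne_zero _ _ hs
    rwa [natDegree_derivative, h0, derivative_map, resultant_map_map] at hne
  refine ((finite_eval_eq_zero hcoeff).union (finite_eval_eq_zero hres)).subset fun d => ?_
  contrapose
  simp only [Set.mem_union, Set.mem_ofPred_eq, not_or, not_not]
  rintro ⟨hcd, hrd⟩
  refine ⟨le_antisymm (natDegree_map_le.trans hP) (le_natDegree_of_ne_zero (by simpa using hcd)),
    C (ρ.eval d)⁻¹ * U.map (evalRingHom d), C (ρ.eval d)⁻¹ * V.map (evalRingHom d), ?_⟩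
  have hmap := congrArg (Polynomial.map (evalRingHom d)) hUV
  rw [Polynomial.map_add, Polynomial.map_mul, Polynomial.map_mul, map_C, coe_evalRingHom] at hmap
  have hinv : C (ρ.eval d)⁻¹ * C (ρ.eval d) = (1 : ℂ[X]) := by
    rw [← C_mul, inv_mul_cancel₀ hrd, C_1]
  rw [derivative_map]
  linear_combination C (ρ.eval d)⁻¹ * hmap + hinv

theorem finite_eval_map_eq_zero {P : ℂ[X][X]} {x : ℂ}
    (h : (P.map (evalRingHom 0)).eval x ≠ 0) :
    {d : ℂ | (P.map (evalRingHom d)).eval x = 0}.Finite := by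
  have heval (d : ℂ) : (P.map (evalRingHom d)).eval x = (P.eval (C x)).eval d := by
    have hhom := Polynomial.hom_eval₂ P (RingHom.id _) (evalRingHom d) (C x)
    rw [eval_map]
    simpa [eval₂_id] using hhom.symm
  simp only [heval] at h ⊢
  exact finite_eval_eq_zero h

theorem exists_injective_roots {p : ℂ[X]} {m : ℕ} (h : p.natDegree = m) (hs : p.Separable) :
    ∃ x : Fin m → ℂ, Function.Injective x ∧
      ∀ t, p.eval t = p.leadingCoeff * ∏ i, (t - x i) := by
  classical
  have hcard : p.roots.toFinset.card = m := by
    rw [Multiset.toFinset_card_of_nodup (nodup_roots hs), ← h]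
    exact IsAlgClosed.card_roots_eq_natDegree
  let e := p.roots.toFinset.equivFinOfCardEq hcard
  refine ⟨fun i => (e.symm i : ℂ), fun i j hij => e.symm.injective (Subtype.ext hij), fun t => ?_⟩
  conv_lhs => rw [(IsAlgClosed.splits p).eq_prod_roots]
  rw [eval_mul, eval_C, eval_multiset_prod, Multiset.map_map,
    Equiv.prod_comp e.symm fun r : p.roots.toFinset => t - (r : ℂ),
    Finset.prod_coe_sort p.roots.toFinset fun r => t - r, Finset.prod,
    Multiset.toFinset_val, (nodup_roots hs).dedup]
  simp

end Specialization

/-! ### Factorization of even theta functions -/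

section Factorization

open Polynomial

/-- Interpolation nodes `b 0 = 0, b 1, …, b n` for even theta functions: they are distinct up to
sign modulo `ℤ + τℤ`, and the nonzero ones are not of order two. -/
structure IsEvenNodes (τ : ℂ) (n : ℕ) (b : ℕ → ℂ) : Prop where
  map_zero : b 0 = 0
  pairTheta_ne_zero : ∀ i ≤ n, ∀ j ≤ n, i ≠ j → pairTheta τ (b j) (b i) ≠ 0
  theta_two_mul_ne_zero : ∀ j ≤ n, j ≠ 0 → theta τ (2 * b j) ≠ 0

/-- `g` is a nonzero multiple of `∏ θ(z - a i) θ(z + a i)`, and all its zeros are simple. -/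
structure IsSimpleFactorization {ι : Type*} [Fintype ι] (τ : ℂ) (g : ℂ → ℂ) (a : ι → ℂ) :
    Prop where
  exists_eq : ∃ K ≠ 0, ∀ z, g z = K * ∏ i, pairTheta τ (a i) z
  theta_two_mul_ne_zero : ∀ i, theta τ (2 * a i) ≠ 0
  pairTheta_ne_zero : ∀ i j, i ≠ j → pairTheta τ (a i) (a j) ≠ 0

/-- `p` has degree `n` and simple roots, none of which is the value of `ellX` at a half period;
so the pull-back of `p` along the double covering `ellX` has simple zeros. -/
structure IsUnramifiedPoly (τ : ℂ) (n : ℕ) (p : ℂ[X]) : Prop where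
  natDegree_eq : p.natDegree = n
  separable : p.Separable
  eval_ne_zero : ∀ w ∈ halfPeriods τ, p.eval (ellX τ w) ≠ 0

/-- The polynomial in `ellX` representing `θ(z - b_j) θ(z + b_j) / θ(z)²`, where `b_0 = 0`. -/
def nodePoly (τ : ℂ) (b : ℕ → ℂ) (j : ℕ) : ℂ[X] :=
  if j = 0 then 1 else C (theta τ (b j) ^ 2 / theta τ (1 / 2) ^ 2) * (X - C (ellX τ (b j)))

/-- The polynomial in `ellX` representing the interpolating function with value `1` at `b i` and
`0` at the other nodes. -/
def lagrangePoly (τ : ℂ) (n : ℕ) (b : ℕ → ℂ) (i : ℕ) : ℂ[X] :=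
  ∏ j ∈ (Finset.range (n + 1)).erase i, (C (pairTheta τ (b j) (b i))⁻¹ * nodePoly τ b j)

/-- The polynomial in `ellX` representing `interp τ n b y`. -/
def interpPoly (τ : ℂ) (n : ℕ) (b y : ℕ → ℂ) : ℂ[X] :=
  ∑ i ∈ Finset.range (n + 1), C (y i) * lagrangePoly τ n b i

/-- The polynomial `interpPoly` for values depending polynomially on a parameter. -/
def familyPoly (τ : ℂ) (n : ℕ) (b : ℕ → ℂ) (Y : ℕ → ℂ[X]) : ℂ[X][X] :=
  ∑ i ∈ Finset.range (n + 1), C (Y i) * (lagrangePoly τ n b i).map C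

variable {τ : ℂ} {n : ℕ} {b y : ℕ → ℂ}

theorem IsEvenNodes.theta_ne_zero (hτ : 0 < τ.im) (hb : IsEvenNodes τ n b) {j : ℕ} (hj : j ≤ n)
    (hj0 : j ≠ 0) : theta τ (b j) ≠ 0 := fun h =>
  hb.theta_two_mul_ne_zero j hj hj0 (two_mul (b j) ▸ theta_add_eq_zero hτ h h)

theorem pairTheta_ne_zero_of_mem_halfPeriods (hτ : 0 < τ.im) {a w : ℂ} (hw : w ∈ halfPeriods τ)
    (ha : theta τ (2 * a) ≠ 0) : pairTheta τ a w ≠ 0 := by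
  have h2w := theta_two_mul_of_mem_halfPeriods hτ hw
  refine mul_ne_zero (fun h => ha ?_) fun h => ha ?_
  · convert theta_sub_eq_zero hτ h2w (theta_add_eq_zero hτ h h) using 2
    ring
  · convert theta_sub_eq_zero hτ (theta_add_eq_zero hτ h h) h2w using 2
    ring

theorem natDegree_nodePoly_le (τ : ℂ) (b : ℕ → ℂ) (j : ℕ) : (nodePoly τ b j).natDegree ≤ 1 := by
  rw [nodePoly]
  split_ifs
  · simp
  · exact (natDegree_C_mul_le _ _).trans (natDegree_X_sub_C_le _)

theorem natDegree_lagrangePoly_le (τ : ℂ) (b : ℕ → ℂ) {i : ℕ} (hi : i ≤ n) :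
    (lagrangePoly τ n b i).natDegree ≤ n := by
  refine (natDegree_prod_le _ _).trans ?_
  refine (Finset.sum_le_sum fun j _ =>
    (natDegree_C_mul_le _ _).trans (natDegree_nodePoly_le τ b j)).trans ?_
  rw [Finset.sum_const, Finset.card_erase_of_mem (Finset.mem_range.mpr (by omega))]
  simp

theorem natDegree_familyPoly_le (τ : ℂ) (n : ℕ) (b : ℕ → ℂ) (Y : ℕ → ℂ[X]) :
    (familyPoly τ n b Y).natDegree ≤ n := by
  refine natDegree_sum_le_of_forall_le _ _ fun i hi => ?_
  refine (natDegree_C_mul_le _ _).trans (natDegree_map_le.trans ?_)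
  exact natDegree_lagrangePoly_le τ b (by simpa [Nat.lt_succ_iff] using hi)

theorem map_familyPoly (τ : ℂ) (n : ℕ) (b : ℕ → ℂ) (Y : ℕ → ℂ[X]) (d : ℂ) :
    (familyPoly τ n b Y).map (evalRingHom d) = interpPoly τ n b fun i => (Y i).eval d := by
  have hC : (evalRingHom d).comp C = RingHom.id ℂ := by ext; simp
  simp only [familyPoly, interpPoly, Polynomial.map_sum, Polynomial.map_mul, map_C,
    Polynomial.map_map, hC, Polynomial.map_id, coe_evalRingHom]

theorem IsEvenNodes.pairTheta_eq_nodePoly (hτ : 0 < τ.im) (hb : IsEvenNodes τ n b) {j : ℕ}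
    (hj : j ≤ n) {z : ℂ} (hz : theta τ z ≠ 0) :
    pairTheta τ (b j) z = theta τ z ^ 2 * (nodePoly τ b j).eval (ellX τ z) := by
  rw [nodePoly]
  split_ifs with hj0
  · rw [hj0, hb.map_zero, pairTheta_zero_left, eval_one, mul_one]
  · rw [pairTheta_eq_ellX hτ (hb.theta_ne_zero hτ hj hj0) hz]
    simp only [eval_mul, eval_C, eval_sub, eval_X]
    ring

theorem IsEvenNodes.interp_eq_interpPoly (hτ : 0 < τ.im) (hb : IsEvenNodes τ n b) (y : ℕ → ℂ)
    {z : ℂ} (hz : theta τ z ≠ 0) :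
    interp τ n b y z = theta τ z ^ (2 * n) * (interpPoly τ n b y).eval (ellX τ z) := by
  rw [interpPoly, eval_finsetSum, Finset.mul_sum, interp]
  refine Finset.sum_congr rfl fun i hi => ?_
  have hfactor : ∀ j ∈ (Finset.range (n + 1)).erase i,
      (pairTheta τ (b j) (b i))⁻¹ * pairTheta τ (b j) z = theta τ z ^ 2 *
        (C (pairTheta τ (b j) (b i))⁻¹ * nodePoly τ b j).eval (ellX τ z) := by
    intro j hj
    rw [Finset.mem_erase, Finset.mem_range] at hj
    rw [hb.pairTheta_eq_nodePoly hτ (by omega) hz, eval_mul, eval_C]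
    ring
  rw [eval_mul, eval_C, lagrangePoly, eval_prod, Finset.prod_congr rfl hfactor,
    Finset.prod_mul_distrib, Finset.prod_const, Finset.card_erase_of_mem hi, Finset.card_range,
    Nat.add_sub_cancel, ← pow_mul]
  ring

theorem IsEvenNodes.exists_interpPoly_eq_prod (hτ : 0 < τ.im) (hb : IsEvenNodes τ n b)
    (hy0 : y 0 ≠ 0) (hy : ∀ i ≤ n, i ≠ 0 → y i = 0) :
    ∃ c ≠ 0, interpPoly τ n b y
      = C c * ∏ j ∈ (Finset.range (n + 1)).erase 0, (X - C (ellX τ (b j))) := by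
  refine ⟨y 0 * ∏ j ∈ (Finset.range (n + 1)).erase 0,
    ((pairTheta τ (b j) (b 0))⁻¹ * (theta τ (b j) ^ 2 / theta τ (1 / 2) ^ 2)),
    mul_ne_zero hy0 (Finset.prod_ne_zero_iff.mpr fun j hj => ?_), ?_⟩
  · rw [Finset.mem_erase, Finset.mem_range] at hj
    exact mul_ne_zero (inv_ne_zero (hb.pairTheta_ne_zero 0 (by omega) j (by omega) hj.1.symm))
      (div_ne_zero (pow_ne_zero 2 (hb.theta_ne_zero hτ (by omega) hj.1))
        (pow_ne_zero 2 (theta_half_ne_zero hτ)))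
  · rw [interpPoly, Finset.sum_eq_single_of_mem 0 (by simp)]
    · rw [C_mul, mul_assoc, lagrangePoly]
      congr 1
      rw [map_prod, ← Finset.prod_mul_distrib]
      refine Finset.prod_congr rfl fun j hj => ?_
      rw [nodePoly, if_neg (Finset.mem_erase.mp hj).1, C_mul, mul_assoc]
    · intro i hi hi0
      rw [hy i (by simpa [Nat.lt_succ_iff] using hi) hi0, C_0, zero_mul]

theorem IsEvenNodes.isUnramifiedPoly_interpPoly (hτ : 0 < τ.im) (hb : IsEvenNodes τ n b)
    (hy0 : y 0 ≠ 0) (hy : ∀ i ≤ n, i ≠ 0 → y i = 0) :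
    IsUnramifiedPoly τ n (interpPoly τ n b y) := by
  obtain ⟨c, hc, hp⟩ := hb.exists_interpPoly_eq_prod hτ hy0 hy
  have hmem {j : ℕ} (hj : j ∈ (Finset.range (n + 1)).erase 0) : j ≤ n ∧ theta τ (b j) ≠ 0 := by
    rw [Finset.mem_erase, Finset.mem_range] at hj
    exact ⟨by omega, hb.theta_ne_zero hτ (by omega) hj.1⟩
  have hinj : Set.InjOn (fun j => ellX τ (b j)) ((Finset.range (n + 1)).erase 0) := by
    intro i hi j hj hij
    by_contra hne
    exact hb.pairTheta_ne_zero i (hmem hi).1 j (hmem hj).1 hne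
      ((ellX_eq_iff hτ (hmem hj).2 (hmem hi).2).mp hij)
  refine ⟨?_, ?_, fun w hw => ?_⟩
  · rw [hp, natDegree_C_mul hc, natDegree_prod_of_monic _ _ fun _ _ => monic_X_sub_C _]
    simp
  · rw [hp]
    exact Separable.unit_mul (isUnit_C.mpr hc.isUnit) (separable_prod_X_sub_C_iff'.mpr hinj)
  · rw [hp, eval_mul, eval_C, eval_prod]
    refine mul_ne_zero hc (Finset.prod_ne_zero_iff.mpr fun j hj => ?_)
    rw [eval_sub, eval_X, eval_C, sub_ne_zero, Ne,
      ellX_eq_iff hτ (hmem hj).2 (theta_ne_zero_of_mem_halfPeriods hτ hw)]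
    exact pairTheta_ne_zero_of_mem_halfPeriods hτ hw
      (hb.theta_two_mul_ne_zero j (hmem hj).1 (Finset.ne_of_mem_erase hj))

theorem finite_not_isUnramifiedPoly (τ : ℂ) (hn : n ≠ 0) {P : ℂ[X][X]} (hP : P.natDegree ≤ n)
    (h0 : IsUnramifiedPoly τ n (P.map (evalRingHom 0))) :
    {d : ℂ | ¬ IsUnramifiedPoly τ n (P.map (evalRingHom d))}.Finite := by
  refine ((finite_not_separable hn hP h0.natDegree_eq h0.separable).union
    ((halfPeriods τ).finite_toSet.biUnion fun w hw =>
      finite_eval_map_eq_zero (h0.eval_ne_zero w hw))).subset fun d => ?_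
  contrapose
  simp only [Set.mem_union, Set.mem_ofPred_eq, Set.mem_iUnion, not_or, not_not, not_exists]
  exact fun ⟨⟨hdeg, hsep⟩, hhalf⟩ => ⟨hdeg, hsep, fun w hw => hhalf w hw⟩

theorem IsEvenNodes.exists_isSimpleFactorization (hτ : 0 < τ.im) (hb : IsEvenNodes τ n b)
    (hp : IsUnramifiedPoly τ n (interpPoly τ n b y)) :
    ∃ a : Fin n → ℂ, IsSimpleFactorization τ (interp τ n b y) a := by
  obtain ⟨x, hx, hpx⟩ := exists_injective_roots hp.natDegree_eq hp.separable
  choose a ha hax using fun i => exists_ellX_eq hτ (x i)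
  set p := interpPoly τ n b y with hp_def
  set K := p.leadingCoeff * ∏ i, (theta τ (1 / 2) ^ 2 / theta τ (a i) ^ 2) with hK
  have hK0 : K ≠ 0 := mul_ne_zero (leadingCoeff_ne_zero.mpr hp.separable.ne_zero)
    (Finset.prod_ne_zero_iff.mpr fun i _ =>
      div_ne_zero (pow_ne_zero 2 (theta_half_ne_zero hτ)) (pow_ne_zero 2 (ha i)))
  have hfactor (z : ℂ) : theta τ z * interp τ n b y z
      = theta τ z * (K * ∏ i, pairTheta τ (a i) z) := by
    by_cases hz : theta τ z = 0
    · rw [hz, zero_mul, zero_mul]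
    have hroot (i) : theta τ (1 / 2) ^ 2 / theta τ (a i) ^ 2 * pairTheta τ (a i) z
        = theta τ z ^ 2 * (ellX τ z - x i) := by
      have := ha i
      have := theta_half_ne_zero hτ
      rw [pairTheta_eq_ellX hτ (ha i) hz, hax]
      field_simp
    rw [hb.interp_eq_interpPoly hτ y hz, ← hp_def, hpx, hK, mul_assoc p.leadingCoeff,
      ← Finset.prod_mul_distrib, Finset.prod_congr rfl fun i _ => hroot i,
      Finset.prod_mul_distrib, Finset.prod_const, Finset.card_univ, Fintype.card_fin, ← pow_mul]
    ring
  have hdiff : Differentiable ℂ fun z => ∏ i, pairTheta τ (a i) z :=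
    Differentiable.fun_finsetProd fun i _ => (isTheta_pairTheta hτ (a i)).diff
  obtain ⟨z₁, hz₁⟩ := exists_theta_ne_zero hτ
  refine ⟨a, ⟨K, hK0, eq_of_mul_eq_mul_left (differentiable_theta hτ) (isTheta_interp hτ _ _ _).diff
    (hdiff.const_mul K) hz₁ hfactor⟩, fun i h2 => ?_, fun i j hij h => ?_⟩
  · obtain ⟨w, hw, hwa⟩ := exists_halfPeriod hτ (ha i) h2
    refine hp.eval_ne_zero w hw ?_
    rw [hpx, Finset.prod_eq_zero (Finset.mem_univ i), mul_zero]
    rw [sub_eq_zero, ← hax i, eq_comm,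
      ellX_eq_iff hτ (theta_ne_zero_of_mem_halfPeriods hτ hw) (ha i), pairTheta, hwa, zero_mul]
  · rw [← ellX_eq_iff hτ (ha i) (ha j), hax, hax] at h
    exact hij (hx h).symm

theorem IsEvenNodes.finite_not_isSimpleFactorization (hτ : 0 < τ.im) (hb : IsEvenNodes τ n b)
    (hn : n ≠ 0) (Y : ℕ → ℂ[X]) (hY0 : (Y 0).eval 0 ≠ 0)
    (hY : ∀ i ≤ n, i ≠ 0 → (Y i).eval 0 = 0) :
    {d : ℂ | ¬ ∃ a : Fin n → ℂ,
      IsSimpleFactorization τ (interp τ n b fun i => (Y i).eval d) a}.Finite := by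
  have hfin := finite_not_isUnramifiedPoly τ hn (natDegree_familyPoly_le τ n b Y)
    (by rw [map_familyPoly]; exact hb.isUnramifiedPoly_interpPoly hτ hY0 hY)
  simp only [map_familyPoly] at hfin
  exact hfin.subset fun d hd h => hd (hb.exists_isSimpleFactorization hτ h)

end Factorization

/-! ### The values of a solution at the multiples of the step -/

/-- `y k` for `0 ≤ k ≤ m` are, up to a factor, the values of a solution of the `q`-Lamé equation at
`± k w`. -/
structure IsLameSeq (τ w : ℂ) (m : ℕ) (ε : ℂ) (y : ℕ → ℂ) : Prop where
  recurrence : ∀ k, 1 ≤ k → k ≤ m → theta τ ((k + m) * w) * y (k - 1)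
    + theta τ ((k - m) * w) * y (k + 1) = ε * theta τ (k * w) * y k
  ne_zero : ∀ k ≤ m, y k ≠ 0

section LamePoly

open Polynomial

/-- The values `(y (m - j), y (m - j + 1))` of a solution at the multiples of the step, obtained
from `y m = 1` by running the recurrence downwards, as polynomials in `ε⁻¹` and up to powers of
`ε⁻¹`. -/
def lamePoly (τ w : ℂ) (m : ℕ) : ℕ → ℂ[X] × ℂ[X]
  | 0 => (1, 0)
  | j + 1 => (C (theta τ ((m - j) * w) / theta τ ((2 * m - j) * w)) * (lamePoly τ w m j).1
      - C (theta τ (-j * w) / theta τ ((2 * m - j) * w)) * X ^ 2 * (lamePoly τ w m j).2,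
      (lamePoly τ w m j).1)

variable {τ w : ℂ} {m : ℕ}

theorem IsGenericStep.theta_ne_zero (hw : IsGenericStep τ w) {c : ℂ} (k : ℤ) (hk : k ≠ 0)
    (hc : c = k) : theta τ (c * w) ≠ 0 :=
  hc ▸ hw k hk

theorem lamePoly_succ_snd (τ w : ℂ) (m j : ℕ) :
    (lamePoly τ w m (j + 1)).2 = (lamePoly τ w m j).1 := rfl

theorem eval_zero_lamePoly_ne_zero (hw : IsGenericStep τ w) {j : ℕ}
    (hj : j ≤ m) : (lamePoly τ w m j).1.eval 0 ≠ 0 := by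
  induction j with
  | zero => simp [lamePoly]
  | succ j ih =>
    have hnum : theta τ ((m - j) * w) ≠ 0 :=
      hw.theta_ne_zero (m - j) (by omega) (by push_cast; ring)
    have hden : theta τ ((2 * m - j) * w) ≠ 0 :=
      hw.theta_ne_zero (2 * m - j) (by omega) (by push_cast; ring)
    simp [lamePoly, hnum, hden, ih (by omega)]

/-- The value of a solution at `k w`, as a polynomial in the inverse of the eigenvalue. -/
def valuePoly (τ w : ℂ) (m k : ℕ) : ℂ[X] := X ^ k * (lamePoly τ w m (m - k)).1

theorem valuePoly_recurrence (hw : IsGenericStep τ w) {k : ℕ} (hk : 1 ≤ k)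
    (hkm : k ≤ m) {d : ℂ} (hd : d ≠ 0) :
    theta τ ((k + m) * w) * (valuePoly τ w m (k - 1)).eval d
      + theta τ ((k - m) * w) * (valuePoly τ w m (k + 1)).eval d
      = d⁻¹ * theta τ (k * w) * (valuePoly τ w m k).eval d := by
  obtain ⟨j, rfl⟩ : ∃ j, m = k + j := ⟨m - k, by omega⟩
  obtain ⟨k, rfl⟩ : ∃ k', k = k' + 1 := ⟨k - 1, by omega⟩
  have hden : theta τ ((2 * ((k + 1 + j : ℕ) : ℂ) - j) * w) ≠ 0 :=
    hw.theta_ne_zero (2 * (k + 1 + j) - j) (by omega) (by push_cast; ring)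
  rw [valuePoly, valuePoly, valuePoly, Nat.add_sub_cancel,
    show k + 1 + j - k = j + 1 by omega, show k + 1 + j - (k + 1) = j by omega]
  rw [show (((k + 1 : ℕ) : ℂ) + ((k + 1 + j : ℕ) : ℂ)) * w
    = (2 * ((k + 1 + j : ℕ) : ℂ) - j) * w by push_cast; ring]
  rcases j with _ | j
  · simp only [add_zero, sub_self, zero_mul, theta_zero, lamePoly]
    simp only [CharP.cast_eq_zero, sub_zero, add_zero] at hden
    simp only [Nat.cast_add, Nat.cast_one, CharP.cast_eq_zero, sub_zero, mul_one, neg_zero,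
      zero_mul, mul_zero, X_pow_mul_C, eval_mul, eval_C, eval_pow, eval_X]
    push_cast at hden
    field_simp
    ring
  · rw [show k + 1 + (j + 1) - (k + 1 + 1) = j by omega,
      show ((((k + 1 : ℕ) : ℂ) - ((k + 1 + (j + 1) : ℕ) : ℂ)) * w)
        = -((j + 1 : ℕ) : ℂ) * w by push_cast; ring]
    rw [lamePoly, lamePoly_succ_snd, show (((k + 1 + (j + 1) : ℕ) : ℂ) - ((j + 1 : ℕ) : ℂ)) * w
      = ((k + 1 : ℕ) : ℂ) * w by push_cast; ring]
    simp only [eval_mul, eval_pow, eval_X, eval_sub, eval_C]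
    field_simp
    ring

theorem eval_zero_valuePoly_zero (hw : IsGenericStep τ w) :
    (valuePoly τ w m 0).eval 0 ≠ 0 := by
  simpa [valuePoly] using eval_zero_lamePoly_ne_zero hw le_rfl

theorem eval_zero_valuePoly {k : ℕ} (hk : k ≠ 0) : (valuePoly τ w m k).eval 0 = 0 := by
  simp [valuePoly, hk]

end LamePoly

/-- The even theta function of degree `2m` with the values `y k ^ 2` at `k w`; it is the product
`ψ(z) ψ(-z)` of a solution and its reflection. -/
def evenProd (τ w : ℂ) (m : ℕ) (y : ℕ → ℂ) : ℂ → ℂ :=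
  interp τ m (fun k => k * w) fun k => y k ^ 2

section Step

variable {τ w ε : ℂ} {m : ℕ} {y : ℕ → ℂ}

theorem IsGenericStep.isEvenNodes (hw : IsGenericStep τ w) (n : ℕ) :
    IsEvenNodes τ n fun k => k * w where
  map_zero := by simp
  pairTheta_ne_zero i _ j _ hij := by
    rw [pairTheta, ← sub_mul, ← add_mul]
    exact mul_ne_zero (hw.theta_ne_zero (i - j) (by omega) (by push_cast; ring))
      (hw.theta_ne_zero (i + j) (by omega) (by push_cast; ring))
  theta_two_mul_ne_zero j _ hj := by
    rw [← mul_assoc]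
    exact hw.theta_ne_zero (2 * j) (by omega) (by push_cast; ring)

theorem isLameSeq_valuePoly (hw : IsGenericStep τ w) (hε : ε ≠ 0)
    (h : ∀ k ≤ m, (lamePoly τ w m (m - k)).1.eval ε⁻¹ ≠ 0) :
    IsLameSeq τ w m ε fun k => (valuePoly τ w m k).eval ε⁻¹ where
  recurrence k hk hkm := by
    simpa only [inv_inv] using valuePoly_recurrence hw hk hkm (inv_ne_zero hε)
  ne_zero k hk := by simp [valuePoly, h k hk, hε]

theorem exists_lameSeq (hτ : 0 < τ.im) (hw : IsGenericStep τ w) (hm : m ≠ 0) :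
    ∃ F : Set ℂ, F.Finite ∧ ∀ ε, ε ∉ F → ε ≠ 0 ∧ ∃ y : ℕ → ℂ, IsLameSeq τ w m ε y ∧
      ∃ a : Fin m → ℂ, IsSimpleFactorization τ (evenProd τ w m y) a := by
  have hfin := (hw.isEvenNodes m).finite_not_isSimpleFactorization hτ hm
    (fun k => valuePoly τ w m k ^ 2) (by simpa using eval_zero_valuePoly_zero hw)
    (fun i _ hi => by simp [eval_zero_valuePoly hi])
  have hfin' : (⋃ k ∈ Finset.range (m + 1),
      {d : ℂ | (lamePoly τ w m (m - k)).1.eval d = 0}).Finite :=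
    (Finset.range (m + 1)).finite_toSet.biUnion fun k _ =>
      finite_eval_eq_zero (eval_zero_lamePoly_ne_zero hw (Nat.sub_le m k))
  refine ⟨{0} ∪ Inv.inv '' (_ ∪ _), (Set.finite_singleton 0).union ((hfin.union hfin').image _),
    fun ε hε => ?_⟩
  have hε0 : ε ≠ 0 := fun h => hε (Or.inl h)
  have hd : ¬_ := fun h => hε (Or.inr ⟨ε⁻¹, h, inv_inv ε⟩)
  rw [Set.mem_union, not_or, Set.mem_ofPred_eq, not_not] at hd
  obtain ⟨a, ha⟩ := hd.1
  refine ⟨hε0, _, isLameSeq_valuePoly hw hε0 fun k hk h0 => hd.2 ?_, a, ?_⟩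
  · exact Set.mem_biUnion (x := k) (by simpa using Nat.lt_succ_of_le hk) h0
  · simpa only [evenProd, Polynomial.eval_pow] using ha

/-- The even extension to `ℤ` of a sequence. -/
def evenExt (y : ℕ → ℂ) (k : ℤ) : ℂ := y k.natAbs

theorem evenExt_neg (y : ℕ → ℂ) (k : ℤ) : evenExt y (-k) = evenExt y k := by
  simp [evenExt]

theorem evenExt_natCast (y : ℕ → ℂ) (k : ℕ) : evenExt y k = y k := by simp [evenExt]

theorem IsLameSeq.evenExt_ne_zero (h : IsLameSeq τ w m ε y) {k : ℤ} (h1 : -m ≤ k) (h2 : k ≤ m) :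
    evenExt y k ≠ 0 := h.ne_zero _ (by omega)

theorem IsLameSeq.recurrence_int (h : IsLameSeq τ w m ε y) {k : ℤ} (h1 : -m ≤ k) (h2 : k ≤ m) :
    theta τ ((k + m) * w) * evenExt y (k - 1) + theta τ ((k - m) * w) * evenExt y (k + 1)
      = ε * theta τ (k * w) * evenExt y k := by
  have hpos (k : ℕ) (hk : 1 ≤ k) (hkm : k ≤ m) : theta τ (((k : ℤ) + m) * w) * evenExt y (k - 1)
      + theta τ (((k : ℤ) - m) * w) * evenExt y (k + 1)
      = ε * theta τ ((k : ℤ) * w) * evenExt y k := by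
    have := h.recurrence k hk hkm
    rw [evenExt_natCast, show ((k : ℤ) - 1) = ((k - 1 : ℕ) : ℤ) by omega, evenExt_natCast,
      show ((k : ℤ) + 1) = ((k + 1 : ℕ) : ℤ) by omega, evenExt_natCast]
    exact_mod_cast this
  rcases lt_trichotomy k 0 with hk | hk | hk
  · obtain ⟨j, rfl⟩ : ∃ j : ℕ, k = -(j : ℤ) := ⟨k.natAbs, by omega⟩
    have := hpos j (by omega) (by omega)
    rw [show (-(j : ℤ) - 1) = -((j : ℤ) + 1) by ring, show (-(j : ℤ) + 1) = -((j : ℤ) - 1) by ring,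
      evenExt_neg, evenExt_neg, evenExt_neg]
    rw [show ((-(j : ℤ) : ℤ) : ℂ) + m = -(((j : ℤ) : ℂ) - m) by push_cast; ring,
      show ((-(j : ℤ) : ℤ) : ℂ) - m = -(((j : ℤ) : ℂ) + m) by push_cast; ring, Int.cast_neg]
    simp only [neg_mul, theta_neg]
    linear_combination -this
  · subst hk
    rw [zero_sub, zero_add, evenExt_neg, Int.cast_zero, zero_add, zero_sub, neg_mul, theta_neg,
      zero_mul, theta_zero]
    ring
  · obtain ⟨j, rfl⟩ : ∃ j : ℕ, k = (j : ℤ) := ⟨k.natAbs, by omega⟩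
    exact hpos j (by omega) (by omega)

theorem IsGenericStep.incongruentOn_int (hw : IsGenericStep τ w) (s : Finset ℤ) :
    IncongruentOn τ s fun k : ℤ => k * w := by
  intro i _ j _ hij
  rw [← sub_mul]
  exact hw.theta_ne_zero (i - j) (sub_ne_zero.mpr hij) (by push_cast; ring)

theorem isTheta_evenProd (hτ : 0 < τ.im) :
    IsTheta τ (2 * m) 1 (tauFactor τ ^ (2 * m)) (evenProd τ w m y) := isTheta_interp hτ _ _ _

theorem evenProd_neg (z : ℂ) : evenProd τ w m y (-z) = evenProd τ w m y z :=
  interp_neg _ _ _ _ _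

theorem evenProd_int (hw : IsGenericStep τ w) {k : ℤ} (h1 : -m ≤ k)
    (h2 : k ≤ m) : evenProd τ w m y (k * w) = evenExt y k ^ 2 := by
  have hnat (k : ℕ) (hk : k ≤ m) : evenProd τ w m y (k * w) = y k ^ 2 :=
    interp_node (b := fun k => k * w) (fun k => y k ^ 2) (hw.isEvenNodes m).pairTheta_ne_zero hk
  rcases le_total 0 k with hk | hk
  · obtain ⟨j, rfl⟩ : ∃ j : ℕ, k = (j : ℤ) := ⟨k.natAbs, by omega⟩
    rw [evenExt_natCast, ← hnat j (by omega)]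
    norm_cast
  · obtain ⟨j, rfl⟩ : ∃ j : ℕ, k = -(j : ℤ) := ⟨k.natAbs, by omega⟩
    rw [evenExt_neg, evenExt_natCast, ← hnat j (by omega), ← evenProd_neg]
    push_cast
    ring_nf

theorem eq_evenProd (hτ : 0 < τ.im) (hw : IsGenericStep τ w) {G : ℂ → ℂ}
    (hG : IsTheta τ (2 * m) 1 (tauFactor τ ^ (2 * m)) G)
    (h : ∀ k : ℤ, -m ≤ k → k ≤ m → G (k * w) = evenExt y k ^ 2) (z : ℂ) :
    G z = evenProd τ w m y z := by
  refine sub_eq_zero.mp (IsTheta.eq_zero_of_card_lt hτ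
    (hw.incongruentOn_int (Finset.Icc (-m : ℤ) m)) (hG.sub (isTheta_evenProd hτ)) ?_ ?_ z)
  · intro k hk
    rw [Finset.mem_Icc] at hk
    rw [h k hk.1 hk.2, evenProd_int hw hk.1 hk.2, sub_self]
  · rw [Int.card_Icc]
    omega

/-- The function `∏ θ(z + k w)`, `-m < k ≤ m`, proportional to the Wronskian
`ψ(z) ψ(-z - w) - ψ(z + w) ψ(-z)` of a solution and its reflection. -/
def wronskProd (τ w : ℂ) (m : ℕ) (z : ℂ) : ℂ := ∏ k ∈ Finset.Ioc (-m : ℤ) m, theta τ (z + k * w)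

/-- The multiplier of `wronskProd` under `z ↦ z + τ`. -/
def wronskFactor (τ w : ℂ) (m : ℕ) : ℂ := tauFactor τ ^ (2 * m) * cexp (-(2 * π * I * (m * w)))

theorem sum_Ioc_neg_self (m : ℕ) : ∑ k ∈ Finset.Ioc (-m : ℤ) m, (k : ℂ) = m := by
  have h : ∑ k ∈ Finset.Ioc (-m : ℤ) m, (k : ℂ) = ∑ k ∈ Finset.Ioc (-m : ℤ) m, (1 - (k : ℂ)) := by
    refine Finset.sum_nbij' (fun k => 1 - k) (fun k => 1 - k) ?_ ?_ ?_ ?_ ?_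
    · intro k hk; rw [Finset.mem_Ioc] at hk ⊢; omega
    · intro k hk; rw [Finset.mem_Ioc] at hk ⊢; omega
    · intro k _; ring
    · intro k _; ring
    · intro k _; push_cast; ring
  rw [Finset.sum_sub_distrib, Finset.sum_const, Int.card_Ioc,
    show ((m : ℤ) - -m).toNat = 2 * m by omega] at h
  simp only [nsmul_eq_mul, mul_one] at h
  push_cast at h
  linear_combination h / 2

theorem isTheta_wronskProd (hτ : 0 < τ.im) :
    IsTheta τ (2 * m) 1 (wronskFactor τ w m) (wronskProd τ w m) := by
  have h := IsTheta.prod_theta hτ (Finset.Ioc (-m : ℤ) m) fun k => k * w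
  rw [Int.card_Ioc, show ((m : ℤ) - -m).toNat = 2 * m by omega, ← Finset.sum_mul,
    sum_Ioc_neg_self] at h
  exact h.congr (by simp [pow_mul]) rfl

theorem wronskProd_eq_zero {z : ℂ} (h : wronskProd τ w m z = 0) :
    ∃ k : ℤ, -m < k ∧ k ≤ m ∧ theta τ (z + k * w) = 0 := by
  obtain ⟨k, hk, h0⟩ := Finset.prod_eq_zero_iff.mp h
  rw [Finset.mem_Ioc] at hk
  exact ⟨k, hk.1, hk.2, h0⟩

theorem wronskProd_int {k : ℤ} (h1 : -m ≤ k) (h2 : k < m) : wronskProd τ w m (k * w) = 0 := by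
  refine Finset.prod_eq_zero (i := -k) (by rw [Finset.mem_Ioc]; omega) ?_
  rw [show (k : ℂ) * w + ((-k : ℤ) : ℂ) * w = 0 by push_cast; ring, theta_zero]

theorem exists_prod_theta_ne_zero (hτ : 0 < τ.im) {ι : Type*} (s : Finset ι) (b : ι → ℂ) :
    ∃ z, ∏ i ∈ s, theta τ (z + b i) ≠ 0 := by
  obtain ⟨z₁, hz₁⟩ := exists_theta_ne_zero hτ
  exact exists_prod_ne_zero s (f := fun i z => theta τ (z + b i))
    (fun i _ => (differentiable_theta hτ).comp (differentiable_id.add_const _))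
    fun i _ => ⟨z₁ - b i, by simpa using hz₁⟩

theorem exists_wronskProd_ne_zero (hτ : 0 < τ.im) (w : ℂ) (m : ℕ) :
    ∃ z, wronskProd τ w m z ≠ 0 :=
  exists_prod_theta_ne_zero hτ _ _

/-- The product `∏ θ(z + k w)`, `-m ≤ k ≤ m`, which contains both `wronskProd τ w m z` and
`wronskProd τ w m (z - w)`. -/
def symmProd (τ w : ℂ) (m : ℕ) (z : ℂ) : ℂ := ∏ k ∈ Finset.Icc (-m : ℤ) m, theta τ (z + k * w)

theorem symmProd_eq_theta_mul (z : ℂ) :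
    symmProd τ w m z = theta τ (z - m * w) * wronskProd τ w m z := by
  rw [symmProd, ← Finset.Ioc_insert_left (show (-m : ℤ) ≤ m by omega),
    Finset.prod_insert (by simp), wronskProd]
  congr 2
  push_cast
  ring

theorem symmProd_eq_theta_mul_shift (z : ℂ) :
    symmProd τ w m z = theta τ (z + m * w) * wronskProd τ w m (z - w) := by
  rw [symmProd, ← Finset.Ico_insert_right (show (-m : ℤ) ≤ m by omega),
    Finset.prod_insert (by simp), wronskProd]
  congr 1
  refine Finset.prod_nbij' (fun k => k + 1) (fun k => k - 1) ?_ ?_ ?_ ?_ ?_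
  · intro k hk; rw [Finset.mem_Ico] at hk; rw [Finset.mem_Ioc]; omega
  · intro k hk; rw [Finset.mem_Ioc] at hk; rw [Finset.mem_Ico]; omega
  · intro k _; ring
  · intro k _; ring
  · intro k _; congr 1; push_cast; ring

theorem wronskProd_shift (z : ℂ) : theta τ (z + m * w) * wronskProd τ w m (z - w)
    = theta τ (z - m * w) * wronskProd τ w m z := by
  rw [← symmProd_eq_theta_mul, symmProd_eq_theta_mul_shift]

theorem wronskProd_symm (z : ℂ) : wronskProd τ w m (-z - w) = wronskProd τ w m z := by
  have h : wronskProd τ w m (-z - w) = ∏ k ∈ Finset.Ioc (-m : ℤ) m, -theta τ (z + k * w) := by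
    refine Finset.prod_nbij' (fun k => 1 - k) (fun k => 1 - k) ?_ ?_ ?_ ?_ ?_
    · intro k hk; rw [Finset.mem_Ioc] at hk ⊢; omega
    · intro k hk; rw [Finset.mem_Ioc] at hk ⊢; omega
    · intro k _; ring
    · intro k _; ring
    · intro k _; rw [← theta_neg]; congr 1; push_cast; ring
  rw [h, Finset.prod_neg, Int.card_Ioc, show ((m : ℤ) - -m).toNat = 2 * m by omega, pow_mul,
    neg_one_sq, one_pow, one_mul, wronskProd]

theorem isTheta_symmProd (hτ : 0 < τ.im) :
    IsTheta τ (2 * m + 1) (-1) (tauFactor τ ^ (2 * m + 1)) (symmProd τ w m) := by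
  have h := ((IsTheta.of_theta hτ).shift (-(m * w))).mul (isTheta_wronskProd (w := w) (m := m) hτ)
  rw [add_comm 1] at h
  have e : symmProd τ w m = fun z => theta τ (z + -(m * w)) * wronskProd τ w m z := by
    funext z
    rw [symmProd_eq_theta_mul, sub_eq_add_neg]
  rw [e]
  refine h.congr (by ring) ?_
  have : cexp (-(2 * π * I * (1 : ℕ) * -(m * w))) * cexp (-(2 * π * I * (m * w)))
      = 1 := by
    rw [← Complex.exp_add]; simp
  rw [wronskFactor]
  linear_combination tauFactor τ ^ (2 * m + 1) * this

theorem symmProd_int {k : ℤ} (h1 : -m ≤ k) (h2 : k ≤ m) : symmProd τ w m (k * w) = 0 := by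
  refine Finset.prod_eq_zero (i := -k) (by rw [Finset.mem_Icc]; omega) ?_
  rw [show (k : ℂ) * w + ((-k : ℤ) : ℂ) * w = 0 by push_cast; ring, theta_zero]

theorem symmProd_neg (z : ℂ) : symmProd τ w m (-z) = -symmProd τ w m z := by
  rw [symmProd_eq_theta_mul, symmProd_eq_theta_mul_shift,
    show -z - m * w = -(z + m * w) by ring, theta_neg, show -z = -(z - w) - w by ring,
    wronskProd_symm]
  ring

theorem exists_symmProd_ne_zero (hτ : 0 < τ.im) (w : ℂ) (m : ℕ) : ∃ z, symmProd τ w m z ≠ 0 :=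
  exists_prod_theta_ne_zero hτ _ _

/-! ### The function `ψ(z) ψ(-z - w) + ψ(z + w) ψ(-z)` -/

/-- `s` is the function `ψ(z) ψ(-z - w) + ψ(z + w) ψ(-z)` attached to the solution `ψ` with
the values `y`. -/
structure IsTrace (τ w : ℂ) (m : ℕ) (ε : ℂ) (y : ℕ → ℂ) (s : ℂ → ℂ) : Prop where
  isTheta : IsTheta τ (2 * m) 1 (wronskFactor τ w m) s
  symm : ∀ z, s (-z - w) = s z
  map_int : ∀ k : ℤ, -m ≤ k → k < m → s (k * w) = 2 * evenExt y k * evenExt y (k + 1)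
  eqn : ∀ z, theta τ (z + m * w) * s (z - w) + theta τ (z - m * w) * s z
    = 2 * ε * theta τ z * evenProd τ w m y z

theorem IsTrace.unique (hτ : 0 < τ.im) (hw : IsGenericStep τ w) {s s' : ℂ → ℂ}
    (h : IsTrace τ w m ε y s) (h' : IsTrace τ w m ε y s') (z : ℂ) : s z = s' z := by
  obtain ⟨z₁, hz₁⟩ := exists_wronskProd_ne_zero hτ w m
  obtain ⟨r, hr⟩ := IsTheta.eq_const_mul_of_zeros hτ
    (hw.incongruentOn_int (Finset.Ico (-m : ℤ) m)) (h.isTheta.sub h'.isTheta)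
    (isTheta_wronskProd hτ)
    (fun k hk => by
      rw [Finset.mem_Ico] at hk
      rw [h.map_int k hk.1 hk.2, h'.map_int k hk.1 hk.2, sub_self])
    (fun k hk => by
      rw [Finset.mem_Ico] at hk
      exact wronskProd_int hk.1 hk.2)
    (by rw [Int.card_Ico]; omega) hz₁
  -- The equation for `s - s' = r * wronskProd` reads `2 * r * symmProd = 0`.
  have hr0 : r = 0 := by
    obtain ⟨x, hx⟩ := exists_symmProd_ne_zero hτ w m
    refine (mul_eq_zero.mp ?_).resolve_right hx
    have hx' := symmProd_eq_theta_mul (τ := τ) (w := w) (m := m) x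
    have hx'' := symmProd_eq_theta_mul_shift (τ := τ) (w := w) (m := m) x
    linear_combination (1 / 2) * (h.eqn x - h'.eqn x - theta τ (x + m * w) * hr (x - w)
      - theta τ (x - m * w) * hr x + r * hx' + r * hx'')
  rw [← sub_eq_zero, hr, hr0, zero_mul]

end Step

section Trace

variable {τ w ε : ℂ} {m : ℕ} {y : ℕ → ℂ} {s : ℂ → ℂ}

theorem IsTheta.mul_shift {n n' : ℕ} {α α' β β' : ℂ} {f g : ℂ → ℂ} (hf : IsTheta τ n α β f)
    (hg : IsTheta τ n' α' β' g) (u v : ℂ) :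
    IsTheta τ (n + n') (α * α') (β * β' * cexp (-(2 * π * I * (n * u + n' * v))))
      fun z => f (z + u) * g (z + v) := by
  refine ((hf.shift u).mul (hg.shift v)).congr rfl ?_
  rw [show -(2 * π * I * (n * u + n' * v)) = -(2 * π * I * n * u) + -(2 * π * I * n' * v) by ring,
    Complex.exp_add]
  ring

theorem isTheta_theta_mul_shift (hτ : 0 < τ.im)
    (hs : IsTheta τ (2 * m) 1 (wronskFactor τ w m) s) :
    IsTheta τ (2 * m + 1) (-1) (tauFactor τ ^ (2 * m + 1))
      fun z => theta τ (z + m * w) * s (z - w) := by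
  have hmul := (IsTheta.of_theta hτ).mul_shift hs (m * w) (-w)
  simp only [← sub_eq_add_neg] at hmul
  rw [add_comm 1] at hmul
  refine hmul.congr (by ring) ?_
  rw [wronskFactor, ← mul_assoc, mul_assoc _ (cexp _), ← Complex.exp_add,
    show -(2 * π * I * (m * w)) + -(2 * π * I * (((1 : ℕ) : ℂ) * (m * w) + ((2 * m : ℕ) : ℂ) * -w))
      = 0 by push_cast; ring, Complex.exp_zero]
  ring

theorem isTheta_theta_mul (hτ : 0 < τ.im) (hs : IsTheta τ (2 * m) 1 (wronskFactor τ w m) s) :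
    IsTheta τ (2 * m + 1) (-1) (tauFactor τ ^ (2 * m + 1)) fun z => theta τ (z - m * w) * s z := by
  have hmul := (IsTheta.of_theta hτ).mul_shift hs (-(m * w)) 0
  simp only [← sub_eq_add_neg, add_zero] at hmul
  rw [add_comm 1] at hmul
  refine hmul.congr (by ring) ?_
  rw [wronskFactor, ← mul_assoc, mul_assoc _ (cexp _), ← Complex.exp_add,
    show -(2 * π * I * (m * w)) + -(2 * π * I * (((1 : ℕ) : ℂ) * -(m * w) + ((2 * m : ℕ) : ℂ) * 0))
      = 0 by push_cast; ring, Complex.exp_zero]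
  ring

/-! The factor `θ((k + m) w)` vanishes at `k = -m`, so that only the values of `f` at points
between `-m` and `m - 1` matter; similarly for `θ((k - m) w)`. -/

theorem theta_mul_map_pred {f : ℂ → ℂ} {v : ℤ → ℂ}
    (hf : ∀ k : ℤ, -m ≤ k → k < m → f (k * w) = v k) {k : ℤ} (hk : -m ≤ k) (hk' : k ≤ m) :
    theta τ (k * w + m * w) * f (k * w - w) = theta τ ((k + m) * w) * v (k - 1) := by
  rw [← add_mul]
  rcases eq_or_lt_of_le hk with rfl | hlt
  · simp [theta_zero]
  · rw [← hf (k - 1) (by omega) (by omega)]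
    push_cast
    ring_nf

theorem theta_mul_map {f : ℂ → ℂ} {v : ℤ → ℂ}
    (hf : ∀ k : ℤ, -m ≤ k → k < m → f (k * w) = v k) {k : ℤ} (hk : -m ≤ k) (hk' : k ≤ m) :
    theta τ (k * w - m * w) * f (k * w) = theta τ ((k - m) * w) * v k := by
  rw [← sub_mul]
  rcases eq_or_lt_of_le hk' with rfl | hlt
  · simp [theta_zero]
  · rw [hf k hk hlt]

theorem exists_symm_interpolant (hτ : 0 < τ.im) (hw : IsGenericStep τ w) (y : ℕ → ℂ) :
    ∃ s, IsTheta τ (2 * m) 1 (wronskFactor τ w m) s ∧ (∀ z, s (-z - w) = s z) ∧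
      ∀ k : ℤ, -m ≤ k → k < m → s (k * w) = 2 * evenExt y k * evenExt y (k + 1) := by
  set b : ℕ → ℂ := fun k => (k + 1 / 2) * w with hb
  set s : ℂ → ℂ := fun z => interp τ m b (fun k => 2 * y k * y (k + 1)) (z + w / 2) with hs
  have hsep : ∀ i ≤ m, ∀ j ≤ m, i ≠ j → pairTheta τ (b j) (b i) ≠ 0 := by
    intro i _ j _ hij
    simp only [hb, pairTheta]
    rw [← sub_mul, ← add_mul]
    exact mul_ne_zero (hw.theta_ne_zero (i - j) (by omega) (by push_cast; ring))
      (hw.theta_ne_zero (i + j + 1) (by omega) (by push_cast; ring))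
  have hsymm (z) : s (-z - w) = s z := by
    simp only [hs]
    rw [show -z - w + w / 2 = -(z + w / 2) by ring, interp_neg]
  have hnat (k : ℕ) (hk : k ≤ m) : s (k * w) = 2 * y k * y (k + 1) := by
    simp only [hs]
    rw [show (k : ℂ) * w + w / 2 = b k by simp only [hb]; ring, interp_node _ hsep hk]
  refine ⟨s, ((isTheta_interp hτ m b _).shift (w / 2)).congr rfl ?_, hsymm, fun k hk hk' => ?_⟩
  · rw [wronskFactor]
    congr 2
    push_cast
    ring
  · rcases le_or_gt 0 k with h0 | h0
    · lift k to ℕ using h0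
      have hval := hnat k (by omega)
      rw [evenExt_natCast, show (k : ℤ) + 1 = ((k + 1 : ℕ) : ℤ) by push_cast; ring,
        evenExt_natCast, ← hval]
      norm_cast
    · obtain ⟨j, rfl⟩ : ∃ j : ℕ, k = -((j + 1 : ℕ) : ℤ) := ⟨(-k - 1).natAbs, by omega⟩
      rw [evenExt_neg, evenExt_natCast, show -((j + 1 : ℕ) : ℤ) + 1 = -(j : ℤ) by push_cast; ring,
        evenExt_neg, evenExt_natCast, ← hsymm,
        show -(((-((j + 1 : ℕ) : ℤ) : ℤ) : ℂ) * w) - w = j * w by push_cast; ring,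
        hnat j (by omega)]
      ring

theorem exists_trace_defect (hτ : 0 < τ.im) (hw : IsGenericStep τ w) (hy : IsLameSeq τ w m ε y)
    (hs : IsTheta τ (2 * m) 1 (wronskFactor τ w m) s)
    (hint : ∀ k : ℤ, -m ≤ k → k < m → s (k * w) = 2 * evenExt y k * evenExt y (k + 1)) :
    ∃ r : ℂ, ∀ z, theta τ (z + m * w) * s (z - w) + theta τ (z - m * w) * s z
      - 2 * ε * (theta τ z * evenProd τ w m y z) = r * symmProd τ w m z := by
  have hprod : IsTheta τ (2 * m + 1) (-1) (tauFactor τ ^ (2 * m + 1))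
      fun z => 2 * ε * (theta τ z * evenProd τ w m y z) := by
    have hmul := (IsTheta.of_theta hτ).mul (isTheta_evenProd (w := w) (m := m) (y := y) hτ)
    rw [add_comm 1] at hmul
    exact (hmul.congr (by ring) (by ring)).const_mul _
  obtain ⟨x, hx⟩ := exists_symmProd_ne_zero hτ w m
  refine IsTheta.eq_const_mul_of_zeros hτ (hw.incongruentOn_int (Finset.Icc (-m : ℤ) m))
    (((isTheta_theta_mul_shift hτ hs).add (isTheta_theta_mul hτ hs)).sub hprod)
    (isTheta_symmProd hτ) (fun k hk => ?_) (fun k hk => ?_) (by rw [Int.card_Icc]; omega) hx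
  all_goals rw [Finset.mem_Icc] at hk
  · rw [theta_mul_map_pred hint hk.1 hk.2, theta_mul_map hint hk.1 hk.2,
      evenProd_int hw hk.1 hk.2, sub_add_cancel]
    linear_combination 2 * evenExt y k * hy.recurrence_int hk.1 hk.2
  · exact symmProd_int hk.1 hk.2

theorem exists_isTrace (hτ : 0 < τ.im) (hw : IsGenericStep τ w)
    (hy : IsLameSeq τ w m ε y) : ∃ s, IsTrace τ w m ε y s := by
  obtain ⟨s₀, htheta, hsymm, hint⟩ := exists_symm_interpolant (m := m) hτ hw y
  obtain ⟨r, hr⟩ := exists_trace_defect hτ hw hy htheta hint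
  refine ⟨fun z => s₀ z - r / 2 * wronskProd τ w m z,
    htheta.sub ((isTheta_wronskProd hτ).const_mul _), fun z => ?_, fun k h1 h2 => ?_, fun z => ?_⟩
  · rw [hsymm, wronskProd_symm]
  · rw [hint k h1 h2, wronskProd_int h1 h2, mul_zero, sub_zero]
  · linear_combination hr z + r / 2 * symmProd_eq_theta_mul (τ := τ) (w := w) (m := m) z
      + r / 2 * symmProd_eq_theta_mul_shift (τ := τ) (w := w) (m := m) z

theorem IsTheta.eq_zero_of_odd (hτ : 0 < τ.im) (hw : IsGenericStep τ w) {E : ℂ → ℂ}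
    (hE : IsTheta τ (2 * m + 2) 1 (tauFactor τ ^ (2 * m + 2)) E) (hodd : ∀ z, E (-z) = -E z)
    (hint : ∀ k : ℤ, -m ≤ k → k ≤ m → E (k * w) = 0) (z : ℂ) : E z = 0 := by
  have hcard : (Finset.Icc (-m : ℤ) m).card = 2 * m + 1 := by
    rw [Int.card_Icc]
    omega
  have hpts : IncongruentOn τ (Finset.Icc (-m : ℤ) m) fun k : ℤ => -(k * w) := by
    intro i hi j hj hij
    simpa only [neg_sub_neg] using hw.incongruentOn_int _ j hj i hi hij.symm
  obtain ⟨h, α, β, hh, hEh⟩ := IsTheta.exists_prod_mul hτ hpts (n := 1) (g := E)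
    (by rw [hcard, add_comm 1]; exact hE) (fun k hk => by
      rw [Finset.mem_Icc] at hk
      simpa using hint (-k) (by omega) (by omega))
  simp only [sub_neg_eq_add] at hEh
  obtain ⟨x, hx⟩ := exists_symmProd_ne_zero hτ w m
  have htheta : IsTheta τ 1 (-1) (tauFactor τ) h := by
    refine (isTheta_symmProd (w := w) (m := m) hτ).of_mul hx hh.diff ?_
    have hEq : (fun z => symmProd τ w m z * h z) = E := funext fun z => (hEh z).symm
    rw [hEq]
    exact hE.congr (by norm_num) (by ring)
  -- `E` is the product of the odd functions `symmProd` and `C * θ`, hence even.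
  obtain ⟨C, hC⟩ := htheta.eq_const_mul_theta hτ
  have hpos : E z = symmProd τ w m z * (C * theta τ z) := by rw [hEh, hC, symmProd]
  have hneg : E (-z) = symmProd τ w m (-z) * (C * theta τ (-z)) := by rw [hEh, hC, symmProd]
  rw [hodd, symmProd_neg, theta_neg] at hneg
  linear_combination (1 / 2) * hpos - (1 / 2) * hneg

theorem isTheta_theta_sq_mul_evenProd_sub (hτ : 0 < τ.im) :
    IsTheta τ (2 * m + 2) 1 (tauFactor τ ^ (2 * m + 2)) fun z =>
      theta τ (z + m * w) ^ 2 * evenProd τ w m y (z - w)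
        - theta τ (z - m * w) ^ 2 * evenProd τ w m y (z + w) := by
  have hmul := (isTheta_theta_sq hτ).mul_shift (isTheta_evenProd (w := w) (m := m) (y := y) hτ)
  have hminus := hmul (m * w) (-w)
  have hplus := hmul (-(m * w)) w
  simp only [← sub_eq_add_neg] at hminus hplus
  rw [add_comm 2] at hminus hplus
  refine (hminus.congr (by norm_num) ?_).sub (hplus.congr (by norm_num) ?_)
  · rw [show -(2 * π * I * (((2 : ℕ) : ℂ) * (m * w) + ((2 * m : ℕ) : ℂ) * -w)) = 0 by
      push_cast; ring, Complex.exp_zero]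
    ring
  · rw [show -(2 * π * I * (((2 : ℕ) : ℂ) * -(m * w) + ((2 * m : ℕ) : ℂ) * w)) = 0 by
      push_cast; ring, Complex.exp_zero]
    ring

theorem IsTrace.eqn_diff_int (hw : IsGenericStep τ w) (hy : IsLameSeq τ w m ε y)
    (hs : IsTrace τ w m ε y s) {k : ℤ} (hk : -m ≤ k) (hk' : k ≤ m) :
    ε * (theta τ (k * w)
        * (theta τ (k * w + m * w) * s (k * w - w) - theta τ (k * w - m * w) * s (k * w)))
      - 2 * (theta τ (k * w + m * w) ^ 2 * evenProd τ w m y (k * w - w)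
        - theta τ (k * w - m * w) ^ 2 * evenProd τ w m y (k * w + w)) = 0 := by
  have hprev := theta_mul_map_pred (τ := τ) hs.map_int hk hk'
  rw [sub_add_cancel] at hprev
  have hnext := theta_mul_map (τ := τ) hs.map_int hk hk'
  have hprev_sq := theta_mul_map_pred (τ := τ) (f := evenProd τ w m y)
    (fun j hj hj' => evenProd_int hw hj hj'.le) hk hk'
  have hnext_sq := theta_mul_map (τ := τ) (f := fun z => evenProd τ w m y (z + w))
    (v := fun j => evenExt y (j + 1) ^ 2) (fun j hj hj' => by
      rw [← evenProd_int (m := m) hw (by omega) (by omega)]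
      push_cast
      ring_nf) hk hk'
  rw [sq, sq, mul_assoc (theta τ _) (theta τ _), mul_assoc (theta τ _) (theta τ _), hprev, hnext,
    hprev_sq, hnext_sq, ← add_mul, ← sub_mul]
  linear_combination (-2) * (theta τ ((k + m) * w) * evenExt y (k - 1)
    - theta τ ((k - m) * w) * evenExt y (k + 1)) * hy.recurrence_int hk hk'

theorem IsTrace.eqn_diff (hτ : 0 < τ.im) (hw : IsGenericStep τ w)
    (hy : IsLameSeq τ w m ε y) (hs : IsTrace τ w m ε y s) (z : ℂ) :
    ε * (theta τ z * (theta τ (z + m * w) * s (z - w) - theta τ (z - m * w) * s z))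
      = 2 * (theta τ (z + m * w) ^ 2 * evenProd τ w m y (z - w)
        - theta τ (z - m * w) ^ 2 * evenProd τ w m y (z + w)) := by
  have hmul := (IsTheta.of_theta hτ).mul
    ((isTheta_theta_mul_shift hτ hs.isTheta).sub (isTheta_theta_mul hτ hs.isTheta))
  rw [add_comm 1] at hmul
  refine sub_eq_zero.mp (IsTheta.eq_zero_of_odd hτ hw
    (((hmul.congr (by norm_num) (by ring)).const_mul ε).sub
      ((isTheta_theta_sq_mul_evenProd_sub hτ).const_mul 2)) (fun z => ?_)
    (fun k hk hk' => hs.eqn_diff_int hw hy hk hk') z)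
  have hs_neg : s (-z) = s (z - w) := by rw [← hs.symm (z - w)]; congr 1; ring
  rw [hs.symm, hs_neg, show -z - w = -(z + w) by ring, show -z + w = -(z - w) by ring,
    evenProd_neg, evenProd_neg, show -z + m * w = -(z - m * w) by ring,
    show -z - m * w = -(z + m * w) by ring]
  simp only [theta_neg]
  ring

theorem IsTrace.isTheta_discriminant (hτ : 0 < τ.im) (hs : IsTrace τ w m ε y s) :
    IsTheta τ (2 * m + 2 * m) (1 * 1) (wronskFactor τ w m * wronskFactor τ w m)
      fun z => s z ^ 2 - 4 * (evenProd τ w m y z * evenProd τ w m y (z + w)) := by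
  have hΦ := isTheta_evenProd (w := w) (m := m) (y := y) hτ
  have hsq := hs.isTheta.mul hs.isTheta
  simp only [← sq (s _)] at hsq
  refine hsq.sub (IsTheta.const_mul ((hΦ.mul (hΦ.shift w)).congr rfl ?_) 4)
  rw [wronskFactor, show -(2 * π * I * (2 * m : ℕ) * w)
    = -(2 * π * I * (m * w)) + -(2 * π * I * (m * w)) by push_cast; ring, Complex.exp_add]
  ring

theorem IsTrace.exists_discriminant_eq (hτ : 0 < τ.im) (hw : IsGenericStep τ w)
    (hy : IsLameSeq τ w m ε y) (hs : IsTrace τ w m ε y s) :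
    ∃ C : ℂ, ∀ z, s z ^ 2 - 4 * (evenProd τ w m y z * evenProd τ w m y (z + w))
      = C ^ 2 * wronskProd τ w m z ^ 2 := by
  set Q : ℂ → ℂ := fun z => s z ^ 2 - 4 * (evenProd τ w m y z * evenProd τ w m y (z + w)) with hQ
  have hQT : IsTheta τ (2 * m + 2 * m) (1 * 1) _ Q := hs.isTheta_discriminant hτ
  have hD := isTheta_wronskProd (w := w) (m := m) hτ
  have hDD := hD.mul hD
  simp only [← sq (wronskProd τ w m _)] at hDD
  -- Multiply the sum and the difference equations of the trace.
  have hrel (z) : theta τ (z + m * w) ^ 2 * Q (z - w) = theta τ (z - m * w) ^ 2 * Q z := by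
    simp only [hQ, sub_add_cancel]
    linear_combination (theta τ (z + m * w) * s (z - w) - theta τ (z - m * w) * s z) * hs.eqn z
      + 2 * evenProd τ w m y z * hs.eqn_diff hτ hw hy z
  obtain ⟨x, hx⟩ := exists_wronskProd_ne_zero hτ w m
  obtain ⟨z₁, hz₁⟩ := exists_theta_ne_zero hτ
  have hθ := differentiable_theta hτ
  have hQd := hQT.diff
  have hDd := hD.diff
  obtain ⟨c, hc⟩ := hQT.eq_const_mul_of_translation hτ hw hDD (z₀ := x) (pow_ne_zero 2 hx)
    (eq_of_mul_eq_mul_left (f := fun z => theta τ (z + m * w) ^ 2)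
      (g := fun z => Q (z - w) * wronskProd τ w m z ^ 2)
      (h := fun z => Q z * wronskProd τ w m (z - w) ^ 2)
      (by fun_prop) (by fun_prop) (by fun_prop) (z₀ := z₁ - m * w) (by simpa using hz₁)
      fun z => by
        linear_combination wronskProd τ w m z ^ 2 * hrel z - Q z
          * (theta τ (z + m * w) * wronskProd τ w m (z - w)
            + theta τ (z - m * w) * wronskProd τ w m z)
          * wronskProd_shift (τ := τ) (w := w) (m := m) z)
  obtain ⟨C, rfl⟩ := IsAlgClosed.exists_pow_nat_eq c two_pos
  exact ⟨C, hc⟩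

end Trace

section Splitting

variable {τ w ε : ℂ} {m : ℕ} {y : ℕ → ℂ}

theorem theta_add_int_ne_zero (hτ : 0 < τ.im) (hw : IsGenericStep τ w) (hy : IsLameSeq τ w m ε y)
    {a : ℂ} (ha : evenProd τ w m y a = 0) {k : ℤ} (hk : -m ≤ k) (hk' : k ≤ m) :
    theta τ (a + k * w) ≠ 0 := by
  intro h
  have hcongr : theta τ (a - ((-k : ℤ) : ℂ) * w) = 0 := by
    rw [← h]
    push_cast
    ring_nf
  rw [(isTheta_evenProd hτ).eq_zero_congr hτ hcongr, evenProd_int hw (by omega) (by omega)] at ha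
  exact hy.evenExt_ne_zero (by omega) (by omega) (pow_eq_zero_iff two_ne_zero |>.mp ha)

theorem wronskProd_ne_zero_of_evenProd_eq_zero (hτ : 0 < τ.im) (hw : IsGenericStep τ w)
    (hy : IsLameSeq τ w m ε y) {a : ℂ} (ha : evenProd τ w m y a = 0) :
    wronskProd τ w m a ≠ 0 := by
  intro h
  obtain ⟨k, hk, hk', hzero⟩ := wronskProd_eq_zero h
  exact theta_add_int_ne_zero hτ hw hy ha hk.le hk' hzero

theorem evenProd_zero_ne_zero (hw : IsGenericStep τ w) (hy : IsLameSeq τ w m ε y) :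
    evenProd τ w m y 0 ≠ 0 := by
  have heq := evenProd_int (y := y) (m := m) hw (k := 0) (by omega) (by omega)
  rw [Int.cast_zero, zero_mul] at heq
  rw [heq]
  exact pow_ne_zero 2 (hy.evenExt_ne_zero (by omega) (by omega))

theorem deriv_pairTheta_ne_zero (hτ : 0 < τ.im) {b z : ℂ} (hb : theta τ (2 * b) ≠ 0)
    (hz : pairTheta τ b z = 0) : deriv (pairTheta τ b) z ≠ 0 := by
  have hθ := differentiable_theta hτ
  have hσ := isSigma_theta hτ
  have hderiv : HasDerivAt (pairTheta τ b) (deriv (theta τ) (z - b) * theta τ (z + b)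
      + theta τ (z - b) * deriv (theta τ) (z + b)) z :=
    ((hθ (z - b)).hasDerivAt.comp_sub_const z b).fun_mul
      ((hθ (z + b)).hasDerivAt.comp_add_const z b)
  have hnot_both : ¬ (theta τ (z - b) = 0 ∧ theta τ (z + b) = 0) := by
    rintro ⟨hminus, hplus⟩
    have h := theta_sub_eq_zero hτ hplus hminus
    rw [show z + b - (z - b) = 2 * b by ring] at h
    exact hb h
  rw [hderiv.deriv]
  rcases mul_eq_zero.mp hz with h | h
  · rw [h, zero_mul, add_zero]
    exact mul_ne_zero (hσ.deriv_ne_zero_of_eq_zero h) fun h' => hnot_both ⟨h, h'⟩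
  · rw [h, mul_zero, zero_add]
    exact mul_ne_zero (fun h' => hnot_both ⟨h', h⟩) (hσ.deriv_ne_zero_of_eq_zero h)

theorem pairTheta_ne_zero_of_pairTheta_eq_zero (hτ : 0 < τ.im) {b b' z : ℂ}
    (h : pairTheta τ b' b ≠ 0) (hz : pairTheta τ b z = 0) : pairTheta τ b' z ≠ 0 := by
  have hT := isTheta_pairTheta hτ b'
  rcases mul_eq_zero.mp hz with hz | hz
  · rwa [Ne, hT.eq_zero_congr hτ hz]
  · rw [← sub_neg_eq_add] at hz
    rwa [Ne, hT.eq_zero_congr hτ hz, pairTheta_neg]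

theorem IsSimpleFactorization.deriv_ne_zero {ι : Type*} [Fintype ι] {g : ℂ → ℂ} {a : ι → ℂ}
    (hg : IsSimpleFactorization τ g a) (hτ : 0 < τ.im) {z : ℂ} (hz : g z = 0) :
    deriv g z ≠ 0 := by
  classical
  obtain ⟨K, hK, hgK⟩ := hg.exists_eq
  rw [hgK, mul_eq_zero, or_iff_right hK, Finset.prod_eq_zero_iff] at hz
  obtain ⟨i, -, hi⟩ := hz
  have hsplit : g = fun z => pairTheta τ (a i) z *
      (K * ∏ j ∈ Finset.univ.erase i, pairTheta τ (a j) z) := by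
    funext z
    rw [hgK, ← Finset.mul_prod_erase _ _ (Finset.mem_univ i)]
    ring
  have hdiff : Differentiable ℂ fun z => K * ∏ j ∈ Finset.univ.erase i, pairTheta τ (a j) z :=
    (Differentiable.fun_finsetProd fun j _ => (isTheta_pairTheta hτ (a j)).diff).const_mul K
  rw [hsplit, (((isTheta_pairTheta hτ (a i)).diff z).hasDerivAt.fun_mul
    (hdiff z).hasDerivAt).deriv, hi, zero_mul, add_zero]
  refine mul_ne_zero (deriv_pairTheta_ne_zero hτ (hg.theta_two_mul_ne_zero i) hi) (mul_ne_zero hK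
    (Finset.prod_ne_zero_iff.mpr fun j hj => ?_))
  exact pairTheta_ne_zero_of_pairTheta_eq_zero hτ
    (hg.pairTheta_ne_zero j i (Finset.ne_of_mem_erase hj)) hi

theorem eq_zero_of_sq_eq_mul {f g s : ℂ → ℂ} {x : ℂ} (hf : DifferentiableAt ℂ f x)
    (hg : DifferentiableAt ℂ g x) (hs : DifferentiableAt ℂ s x) (h : ∀ z, s z * s z = f z * g z)
    (hx : f x = 0) (hderiv : deriv f x ≠ 0) : g x = 0 := by
  have hsx : s x = 0 := mul_self_eq_zero.mp (by rw [h, hx, zero_mul])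
  have hleft := (hs.hasDerivAt.fun_mul hs.hasDerivAt).deriv
  rw [funext h, (hf.hasDerivAt.fun_mul hg.hasDerivAt).deriv, hsx, hx] at hleft
  simp only [zero_mul, mul_zero, add_zero, mul_eq_zero] at hleft
  exact hleft.resolve_left hderiv

/-- If the discriminant vanished, the square `4 Φ Φ(· + w)` would make the zero set of `Φ`, whose
zeros are simple, invariant under translation by `w`. -/
theorem IsTrace.discriminant_ne_zero {s : ℂ → ℂ} (hs : IsTrace τ w m ε y s) (hτ : 0 < τ.im)
    (hw : IsGenericStep τ w) (hm : m ≠ 0) (hy : IsLameSeq τ w m ε y) {a : Fin m → ℂ}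
    (ha : IsSimpleFactorization τ (evenProd τ w m y) a) {C : ℂ}
    (hC : ∀ z, s z ^ 2 - 4 * (evenProd τ w m y z * evenProd τ w m y (z + w))
      = C ^ 2 * wronskProd τ w m z ^ 2) : C ≠ 0 := by
  rintro rfl
  have hΦ := isTheta_evenProd (w := w) (m := m) (y := y) hτ
  have hshift (x : ℂ) (hx : evenProd τ w m y x = 0) : evenProd τ w m y (x - -w) = 0 := by
    have h := eq_zero_of_sq_eq_mul (g := fun z => 4 * evenProd τ w m y (z + w)) (hΦ.diff x)
      (((hΦ.shift w).const_mul 4).diff x) (hs.isTheta.diff x)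
      (fun z => by linear_combination hC z) hx (ha.deriv_ne_zero hτ hx)
    simpa only [sub_neg_eq_add, mul_eq_zero, OfNat.ofNat_ne_zero, false_or] using h
  obtain ⟨x, hx⟩ := hΦ.exists_zero hτ (by omega)
  have hzero (k : ℕ) : evenProd τ w m y (x - k * -w) = 0 := by
    induction k with
    | zero => simpa using hx
    | succ k ih =>
      rw [← hshift _ ih]
      push_cast
      ring_nf
  have hw' : IsGenericStep τ (-w) := fun k hk => by
    simpa only [Int.cast_neg, neg_mul, mul_neg] using hw (-k) (neg_ne_zero.mpr hk)
  exact evenProd_zero_ne_zero hw hy (hΦ.eq_zero_of_card_lt hτ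
    (hw'.incongruentOn (Finset.range (2 * m + 1)) x) (fun k _ => hzero k) (by simp) 0)

/-- The entire form of the equation `L ψ = ε ψ` with step `w = 2η`. -/
def LameEq (τ w : ℂ) (m : ℕ) (ε : ℂ) (ψ : ℂ → ℂ) : Prop :=
  ∀ z, theta τ (z + m * w) * ψ (z - w) + theta τ (z - m * w) * ψ (z + w)
    = ε * theta τ z * ψ z

/-- The theta function with simple zeros at the points congruent to some `a i`. -/
def rootProd (τ : ℂ) {m : ℕ} (a : Fin m → ℂ) (z : ℂ) : ℂ := ∏ i, theta τ (z - a i)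

/-- Bethe functions in terms of their roots: `betheFunction τ η m (t, c)` has roots `η - t i`. -/
def expProd (τ : ℂ) {m : ℕ} (a : Fin m → ℂ) (c z : ℂ) : ℂ := cexp (c * z) * rootProd τ a z

theorem rootProd_neg (a : Fin m → ℂ) (z : ℂ) :
    rootProd τ a (-z) = (-1) ^ m * rootProd τ (-a) z := by
  have hterm (i : Fin m) : theta τ (-z - a i) = -theta τ (z - (-a) i) := by
    rw [← theta_neg, Pi.neg_apply]
    ring_nf
  rw [rootProd, Finset.prod_congr rfl fun i _ => hterm i, Finset.prod_neg, Finset.card_univ,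
    Fintype.card_fin, rootProd]

theorem isTheta_rootProd (hτ : 0 < τ.im) (a : Fin m → ℂ) :
    IsTheta τ m ((-1) ^ m) (tauFactor τ ^ m * cexp (2 * π * I * ∑ i, a i)) (rootProd τ a) := by
  have h := IsTheta.prod_theta_sub hτ Finset.univ a
  rwa [Finset.card_univ, Fintype.card_fin] at h

theorem rootProd_eq_zero {a : Fin m → ℂ} {i : Fin m} {z : ℂ} (h : theta τ (z - a i) = 0) :
    rootProd τ a z = 0 := Finset.prod_eq_zero (Finset.mem_univ i) h

/-- Half of the trace plus (for `-C`, minus) half of the square root `C * wronskProd` of the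
discriminant. These are the roots of `X ^ 2 - s X + Φ Φ(· + w)`. -/
def traceHalf (τ w : ℂ) (m : ℕ) (s : ℂ → ℂ) (C z : ℂ) : ℂ :=
  1 / 2 * (s z + C * wronskProd τ w m z)

theorem traceHalf_sub_traceHalf_neg (s : ℂ → ℂ) (C z : ℂ) :
    traceHalf τ w m s C z - traceHalf τ w m s (-C) z = C * wronskProd τ w m z := by
  rw [traceHalf, traceHalf]
  ring

theorem traceHalf_mul_traceHalf_neg {s : ℂ → ℂ} {C : ℂ}
    (hC : ∀ z, s z ^ 2 - 4 * (evenProd τ w m y z * evenProd τ w m y (z + w))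
      = C ^ 2 * wronskProd τ w m z ^ 2) (z : ℂ) :
    traceHalf τ w m s C z * traceHalf τ w m s (-C) z
      = evenProd τ w m y z * evenProd τ w m y (z + w) := by
  rw [traceHalf, traceHalf]
  linear_combination (1 / 4) * hC z

/-- A choice, among each pair of zeros `± a i` of `Φ = evenProd τ w m y`, of the one at which
`traceHalf τ w m s C` vanishes. -/
structure IsSplitting (τ w : ℂ) (m : ℕ) (ε : ℂ) (y : ℕ → ℂ) (s : ℂ → ℂ) (C K : ℂ)
    (a : Fin m → ℂ) : Prop where
  isTrace : IsTrace τ w m ε y s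
  discriminant_eq : ∀ z, s z ^ 2 - 4 * (evenProd τ w m y z * evenProd τ w m y (z + w))
    = C ^ 2 * wronskProd τ w m z ^ 2
  evenProd_eq : ∀ z, evenProd τ w m y z = K * (rootProd τ a z * rootProd τ (-a) z)
  incongruentOn : IncongruentOn τ Finset.univ a
  traceHalf_eq_zero : ∀ i, traceHalf τ w m s C (a i) = 0
  traceHalf_neg_eq_zero : ∀ i, traceHalf τ w m s (-C) (-a i) = 0

namespace IsTrace

variable {s : ℂ → ℂ} {C : ℂ}

theorem isTheta_traceHalf (hs : IsTrace τ w m ε y s) (hτ : 0 < τ.im) (C : ℂ) :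
    IsTheta τ (2 * m) 1 (wronskFactor τ w m) (traceHalf τ w m s C) :=
  (hs.isTheta.add ((isTheta_wronskProd hτ).const_mul C)).const_mul (1 / 2)

theorem traceHalf_symm (hs : IsTrace τ w m ε y s) (C z : ℂ) :
    traceHalf τ w m s C (-z - w) = traceHalf τ w m s C z := by
  rw [traceHalf, traceHalf, hs.symm, wronskProd_symm]

theorem traceHalf_eqn (hs : IsTrace τ w m ε y s) (C z : ℂ) :
    theta τ (z + m * w) * traceHalf τ w m s C (z - w)
      + theta τ (z - m * w) * traceHalf τ w m s (-C) z = ε * theta τ z * evenProd τ w m y z := by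
  rw [traceHalf, traceHalf]
  linear_combination (1 / 2) * hs.eqn z
    + (C / 2) * wronskProd_shift (τ := τ) (w := w) (m := m) z

theorem traceHalf_neg_eq_zero (hs : IsTrace τ w m ε y s) (hτ : 0 < τ.im)
    (hw : IsGenericStep τ w) (hy : IsLameSeq τ w m ε y) {a : ℂ} (ha : evenProd τ w m y a = 0)
    (h : traceHalf τ w m s C a = 0) : traceHalf τ w m s (-C) (-a) = 0 := by
  have hsymm : traceHalf τ w m s (-C) (-a) = traceHalf τ w m s (-C) (a - w) := by
    rw [← hs.traceHalf_symm _ (a - w)]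
    ring_nf
  have heqn := hs.traceHalf_eqn (-C) a
  rw [neg_neg, h, ha, mul_zero, mul_zero, add_zero] at heqn
  have hθ := theta_add_int_ne_zero hτ hw hy ha (k := m) (by omega) le_rfl
  rw [Int.cast_natCast] at hθ
  rw [hsymm]
  exact (mul_eq_zero.mp heqn).resolve_left hθ

theorem exists_sign (hs : IsTrace τ w m ε y s) (hτ : 0 < τ.im) (hw : IsGenericStep τ w)
    (hy : IsLameSeq τ w m ε y)
    (hC : ∀ z, s z ^ 2 - 4 * (evenProd τ w m y z * evenProd τ w m y (z + w))
      = C ^ 2 * wronskProd τ w m z ^ 2) {a : ℂ} (ha : evenProd τ w m y a = 0) :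
    ∃ b, (b = a ∨ b = -a) ∧ traceHalf τ w m s C b = 0 ∧ traceHalf τ w m s (-C) (-b) = 0 := by
  have hmul := traceHalf_mul_traceHalf_neg hC a
  rw [ha, zero_mul, mul_eq_zero] at hmul
  rcases hmul with h | h
  · exact ⟨a, Or.inl rfl, h, hs.traceHalf_neg_eq_zero hτ hw hy ha h⟩
  · refine ⟨-a, Or.inr rfl, ?_, by rwa [neg_neg]⟩
    simpa only [neg_neg] using hs.traceHalf_neg_eq_zero hτ hw hy ha h

theorem exists_isSplitting (hs : IsTrace τ w m ε y s) (hτ : 0 < τ.im) (hw : IsGenericStep τ w)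
    (hy : IsLameSeq τ w m ε y)
    (hC : ∀ z, s z ^ 2 - 4 * (evenProd τ w m y z * evenProd τ w m y (z + w))
      = C ^ 2 * wronskProd τ w m z ^ 2) {a : Fin m → ℂ}
    (ha : IsSimpleFactorization τ (evenProd τ w m y) a) :
    ∃ K ≠ 0, ∃ b, IsSplitting τ w m ε y s C K b := by
  obtain ⟨K, hK, hΦ⟩ := ha.exists_eq
  have hzero (i : Fin m) : evenProd τ w m y (a i) = 0 := by
    rw [hΦ, Finset.prod_eq_zero (Finset.mem_univ i) (pairTheta_self τ _), mul_zero]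
  choose b hb hsb hsb' using fun i => hs.exists_sign hτ hw hy hC (hzero i)
  have hpair_left (i : Fin m) (z : ℂ) : pairTheta τ (b i) z = pairTheta τ (a i) z := by
    rcases hb i with h | h
    · rw [h]
    · rw [h, pairTheta_symm, pairTheta_neg, ← pairTheta_symm]
  have hpair (i j : Fin m) (hij : i ≠ j) : pairTheta τ (b i) (b j) ≠ 0 := by
    rw [hpair_left]
    rcases hb j with h | h
    · rw [h]; exact ha.pairTheta_ne_zero i j hij
    · rw [h, pairTheta_neg]; exact ha.pairTheta_ne_zero i j hij
  refine ⟨K, hK, b, hs, hC, fun z => ?_, fun i _ j _ hij h => ?_, hsb, hsb'⟩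
  · rw [hΦ, rootProd, rootProd, ← Finset.prod_mul_distrib]
    congr 1
    refine Finset.prod_congr rfl fun i _ => ?_
    rw [← hpair_left, pairTheta, Pi.neg_apply, sub_neg_eq_add]
  · exact hpair j i hij.symm (by rw [pairTheta, h, zero_mul])

end IsTrace

namespace IsSplitting

variable {s : ℂ → ℂ} {C K : ℂ} {a : Fin m → ℂ}

theorem symm (h : IsSplitting τ w m ε y s C K a) : IsSplitting τ w m ε y s (-C) K (-a) where
  isTrace := h.isTrace
  discriminant_eq := by simpa only [neg_sq] using h.discriminant_eq
  evenProd_eq z := by rw [h.evenProd_eq, neg_neg, mul_comm (rootProd τ a z)]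
  incongruentOn i _ j _ hij := by
    simpa only [Pi.neg_apply, neg_sub_neg] using
      h.incongruentOn j (Finset.mem_univ j) i (Finset.mem_univ i) hij.symm
  traceHalf_eq_zero := h.traceHalf_neg_eq_zero
  traceHalf_neg_eq_zero := by simpa only [Pi.neg_apply, neg_neg] using h.traceHalf_eq_zero

theorem evenProd_eq_zero (h : IsSplitting τ w m ε y s C K a) (i : Fin m) :
    evenProd τ w m y (a i) = 0 := by
  rw [h.evenProd_eq, rootProd_eq_zero (by rw [sub_self, theta_zero]), zero_mul, mul_zero]

theorem traceHalf_neg_ne_zero (h : IsSplitting τ w m ε y s C K a) (hτ : 0 < τ.im)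
    (hw : IsGenericStep τ w) (hy : IsLameSeq τ w m ε y) (hC : C ≠ 0) (i : Fin m) :
    traceHalf τ w m s (-C) (a i) ≠ 0 := by
  intro hzero
  have hsub := traceHalf_sub_traceHalf_neg (τ := τ) (w := w) (m := m) s C (a i)
  rw [h.traceHalf_eq_zero, hzero, sub_zero] at hsub
  exact mul_ne_zero hC (wronskProd_ne_zero_of_evenProd_eq_zero hτ hw hy (h.evenProd_eq_zero i))
    hsub.symm

theorem rootProd_zero_ne_zero (h : IsSplitting τ w m ε y s C K a) (hw : IsGenericStep τ w)
    (hy : IsLameSeq τ w m ε y) : rootProd τ a 0 ≠ 0 := fun hzero =>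
  evenProd_zero_ne_zero hw hy (by rw [h.evenProd_eq, hzero, zero_mul, mul_zero])

theorem isTheta_quotient (h : IsSplitting τ w m ε y s C K a) (hτ : 0 < τ.im)
    (hw : IsGenericStep τ w) (hy : IsLameSeq τ w m ε y) {q : ℂ → ℂ} (hq : Differentiable ℂ q)
    (huq : ∀ z, traceHalf τ w m s C z = rootProd τ a z * q z) :
    IsTheta τ m ((-1) ^ m) (tauFactor τ ^ m * cexp (2 * π * I * ∑ i, (-a) i)
      * cexp (-(2 * π * I * m * w))) q := by
  refine (isTheta_rootProd hτ a).of_mul (h.rootProd_zero_ne_zero hw hy) hq ?_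
  rw [← funext huq, ← two_mul]
  refine (h.isTrace.isTheta_traceHalf hτ C).congr (by rw [← mul_pow]; norm_num) ?_
  have hexp : cexp (2 * π * I * ∑ i, a i) * cexp (2 * π * I * ∑ i, (-a) i) = 1 := by
    rw [← Complex.exp_add, ← mul_add, ← Finset.sum_add_distrib]
    simp
  rw [wronskFactor, two_mul m, pow_add, ← mul_assoc (2 * π * I)]
  linear_combination -(tauFactor τ ^ m * tauFactor τ ^ m * cexp (-(2 * π * I * m * w))) * hexp

theorem exists_traceHalf_eq (h : IsSplitting τ w m ε y s C K a) (hτ : 0 < τ.im)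
    (hw : IsGenericStep τ w) (hy : IsLameSeq τ w m ε y) (hC : C ≠ 0) :
    ∃ l, ∀ z, traceHalf τ w m s C z = l * (rootProd τ a z * rootProd τ (-a) (z + w)) := by
  have hu := h.isTrace.isTheta_traceHalf hτ C
  have hv := h.isTrace.isTheta_traceHalf hτ (-C)
  have hΦ := isTheta_evenProd (w := w) (m := m) (y := y) hτ
  have hψ := isTheta_rootProd hτ a
  have hP := isTheta_rootProd hτ (-a)
  obtain ⟨q, α, β, hq, huq⟩ := IsTheta.exists_prod_mul hτ h.incongruentOn (n := m)
    (by simpa only [Finset.card_univ, Fintype.card_fin, ← two_mul] using hu)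
    fun i _ => h.traceHalf_eq_zero i
  have hqv : ∀ z, q z * traceHalf τ w m s (-C) z
      = K * (rootProd τ (-a) z * evenProd τ w m y (z + w)) :=
    eq_of_mul_eq_mul_left hψ.diff (hq.diff.mul hv.diff)
      ((hP.diff.mul (hΦ.shift w).diff).const_mul K) (h.rootProd_zero_ne_zero hw hy) fun z => by
        have hmul := traceHalf_mul_traceHalf_neg h.discriminant_eq z
        rw [h.evenProd_eq z, huq] at hmul
        change rootProd τ a z * q z * _ = _ at hmul
        linear_combination hmul
  have hq_zero (i : Fin m) : q (-a i - w) = 0 := by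
    have hv_ne := h.traceHalf_neg_ne_zero hτ hw hy hC i
    have heq := hqv (-a i - w)
    rw [sub_add_cancel, evenProd_neg, h.evenProd_eq_zero, mul_zero, mul_zero,
      h.isTrace.traceHalf_symm] at heq
    exact (mul_eq_zero.mp heq).resolve_right hv_ne
  obtain ⟨l, hl⟩ := (h.isTheta_quotient hτ hw hy hq.diff huq).eq_const_mul_of_zeros hτ
    (s := Finset.univ) (a := fun i => -a i - w) (fun i _ j _ hij => by
      simpa only [sub_sub_sub_cancel_right, Pi.neg_apply] using
        h.symm.incongruentOn i (Finset.mem_univ i) j (Finset.mem_univ j) hij)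
    (hP.shift w) (fun i _ => hq_zero i)
    (fun i _ => rootProd_eq_zero (i := i) (by simp [theta_zero])) (by simp) (z₀ := -w)
    (by simpa using h.symm.rootProd_zero_ne_zero hw hy)
  exact ⟨l, fun z => by rw [huq, hl]; simp only [rootProd]; ring⟩

theorem exists_traceHalf_eq_and_neg (h : IsSplitting τ w m ε y s C K a) (hτ : 0 < τ.im)
    (hw : IsGenericStep τ w) (hm : m ≠ 0) (hy : IsLameSeq τ w m ε y) (hC : C ≠ 0) :
    ∃ l l', l * l' = K ^ 2 ∧
      (∀ z, traceHalf τ w m s C z = l * (rootProd τ a z * rootProd τ (-a) (z + w))) ∧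
      ∀ z, traceHalf τ w m s (-C) z = l' * (rootProd τ (-a) z * rootProd τ a (z + w)) := by
  obtain ⟨l, hl⟩ := h.exists_traceHalf_eq hτ hw hy hC
  obtain ⟨l', hl'⟩ := h.symm.exists_traceHalf_eq hτ hw hy (neg_ne_zero.mpr hC)
  rw [neg_neg] at hl'
  refine ⟨l, l', ?_, hl, hl'⟩
  have hmul := traceHalf_mul_traceHalf_neg h.discriminant_eq 0
  have hne : evenProd τ w m y 0 * evenProd τ w m y (0 + w) ≠ 0 := by
    have hone := evenProd_int (y := y) (m := m) hw (k := 1) (by omega) (by omega)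
    rw [Int.cast_one, one_mul] at hone
    rw [zero_add, hone]
    exact mul_ne_zero (evenProd_zero_ne_zero hw hy)
      (pow_ne_zero 2 (hy.evenExt_ne_zero (by omega) (by omega)))
  rw [hl, hl', h.evenProd_eq 0, h.evenProd_eq (0 + w)] at hmul
  rw [h.evenProd_eq 0, h.evenProd_eq (0 + w)] at hne
  have hroots : rootProd τ a 0 * rootProd τ (-a) 0
      * (rootProd τ a (0 + w) * rootProd τ (-a) (0 + w)) ≠ 0 := fun hzero =>
    hne (by linear_combination K ^ 2 * hzero)
  exact mul_right_cancel₀ hroots (by linear_combination hmul)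

theorem rootProd_eqn (h : IsSplitting τ w m ε y s C K a) (hτ : 0 < τ.im)
    (hw : IsGenericStep τ w) (hy : IsLameSeq τ w m ε y) {l l' : ℂ}
    (hl : ∀ z, traceHalf τ w m s C z = l * (rootProd τ a z * rootProd τ (-a) (z + w)))
    (hl' : ∀ z, traceHalf τ w m s (-C) z = l' * (rootProd τ (-a) z * rootProd τ a (z + w)))
    (z : ℂ) :
    l * theta τ (z + m * w) * rootProd τ a (z - w) + l' * theta τ (z - m * w) * rootProd τ a (z + w)
      = K * ε * theta τ z * rootProd τ a z := by
  have hθ := differentiable_theta hτ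
  have hψ := (isTheta_rootProd hτ a).diff
  have hP := (isTheta_rootProd hτ (-a)).diff
  refine eq_of_mul_eq_mul_left (f := rootProd τ (-a))
    (g := fun z => l * theta τ (z + m * w) * rootProd τ a (z - w)
      + l' * theta τ (z - m * w) * rootProd τ a (z + w))
    (h := fun z => K * ε * theta τ z * rootProd τ a z) hP (by fun_prop) (by fun_prop)
    (h.symm.rootProd_zero_ne_zero hw hy) (fun z => ?_) z
  have heqn := h.isTrace.traceHalf_eqn C z
  rw [hl, hl', sub_add_cancel, h.evenProd_eq] at heqn
  linear_combination heqn

theorem exists_lameEq (h : IsSplitting τ w m ε y s C K a) (hτ : 0 < τ.im)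
    (hw : IsGenericStep τ w) (hm : m ≠ 0) (hy : IsLameSeq τ w m ε y) (hC : C ≠ 0) (hK : K ≠ 0) :
    ∃ c, LameEq τ w m ε (expProd τ a c) ∧
      ∀ z, expProd τ a c z * expProd τ a c (-z - w) - expProd τ a c (z + w) * expProd τ a c (-z)
        = (-1) ^ m * C / K * wronskProd τ w m z := by
  obtain ⟨l, l', hll', hl, hl'⟩ := h.exists_traceHalf_eq_and_neg hτ hw hm hy hC
  obtain ⟨c, hcw⟩ : ∃ c, cexp (c * w) = l' / K := by
    refine ⟨Complex.log (l' / K) / w, ?_⟩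
    rw [div_mul_cancel₀ _ hw.ne_zero, Complex.exp_log (div_ne_zero
      (right_ne_zero_of_mul (hll' ▸ pow_ne_zero 2 hK)) hK)]
  have hcw' : cexp (-(c * w)) = l / K := by
    rw [Complex.exp_neg, hcw, inv_div, div_eq_div_iff
      (right_ne_zero_of_mul (hll' ▸ pow_ne_zero 2 hK)) hK, hll', sq]
  refine ⟨c, fun z => ?_, fun z => ?_⟩
  · simp only [expProd]
    rw [show c * (z - w) = c * z + -(c * w) by ring, mul_add c z w, Complex.exp_add,
      Complex.exp_add, hcw, hcw']
    field_simp
    linear_combination h.rootProd_eqn hτ hw hy hl hl' z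
  · simp only [expProd]
    have hleft : cexp (c * z) * cexp (c * (-z - w)) = l / K := by
      rw [← hcw', ← Complex.exp_add]
      ring_nf
    have hright : cexp (c * (z + w)) * cexp (c * -z) = l' / K := by
      rw [← hcw, ← Complex.exp_add]
      ring_nf
    rw [show -z - w = -(z + w) by ring] at hleft ⊢
    rw [rootProd_neg, rootProd_neg, mul_div_right_comm, mul_assoc _ C,
      ← traceHalf_sub_traceHalf_neg s C z, hl, hl']
    linear_combination (-1) ^ m * rootProd τ a z * rootProd τ (-a) (z + w) * hleft
      - (-1) ^ m * rootProd τ a (z + w) * rootProd τ (-a) z * hright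

theorem theta_step_ne_zero (h : IsSplitting τ w m ε y s C K a) (hτ : 0 < τ.im)
    (hw : IsGenericStep τ w) (hy : IsLameSeq τ w m ε y) (hC : C ≠ 0) (i j : Fin m) :
    theta τ (a i - a j + w) ≠ 0 := by
  intro hzero
  obtain ⟨l', hl'⟩ := h.symm.exists_traceHalf_eq hτ hw hy (neg_ne_zero.mpr hC)
  refine h.traceHalf_neg_ne_zero hτ hw hy hC i ?_
  rw [hl', neg_neg, rootProd_eq_zero (a := a) (z := a i + w) (i := j)
    (by rwa [add_sub_right_comm]), mul_zero, mul_zero]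

end IsSplitting

theorem exists_expProd_solution (hτ : 0 < τ.im) (hw : IsGenericStep τ w) (hm : m ≠ 0)
    (hy : IsLameSeq τ w m ε y) {a : Fin m → ℂ}
    (ha : IsSimpleFactorization τ (evenProd τ w m y) a) :
    ∃ (b : Fin m → ℂ) (c C : ℂ), C ≠ 0 ∧ LameEq τ w m ε (expProd τ b c) ∧
      IncongruentOn τ Finset.univ b ∧ (∀ i, evenProd τ w m y (b i) = 0) ∧
      (∀ i j, theta τ (b i - b j + w) ≠ 0) ∧
      ∀ z, expProd τ b c z * expProd τ b c (-z - w) - expProd τ b c (z + w) * expProd τ b c (-z)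
        = C * wronskProd τ w m z := by
  obtain ⟨s, hs⟩ := exists_isTrace hτ hw hy
  obtain ⟨C, hC⟩ := hs.exists_discriminant_eq hτ hw hy
  have hC0 := hs.discriminant_ne_zero hτ hw hm hy ha hC
  obtain ⟨K, hK, b, h⟩ := hs.exists_isSplitting hτ hw hy hC ha
  obtain ⟨c, hLame, hcross⟩ := h.exists_lameEq hτ hw hm hy hC0 hK
  exact ⟨b, c, (-1) ^ m * C / K, div_ne_zero (mul_ne_zero (pow_ne_zero _ (by norm_num)) hC0) hK,
    hLame, h.incongruentOn, h.evenProd_eq_zero, h.theta_step_ne_zero hτ hw hy hC0, hcross⟩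

end Splitting

section LameRoots

variable {τ w ε c d : ℂ} {m : ℕ} {y : ℕ → ℂ} {a b : Fin m → ℂ}

theorem isTheta_expProd (hτ : 0 < τ.im) (a : Fin m → ℂ) (c : ℂ) :
    IsTheta τ m (cexp c * (-1) ^ m)
      (cexp (c * τ) * (tauFactor τ ^ m * cexp (2 * π * I * ∑ i, a i))) (expProd τ a c) := by
  have h := (IsTheta.exp (τ := τ) c).mul (isTheta_rootProd hτ a)
  rwa [zero_add] at h

theorem expProd_eq_zero_iff {z : ℂ} : expProd τ a c z = 0 ↔ ∃ i, theta τ (z - a i) = 0 := by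
  simp [expProd, rootProd, Finset.prod_eq_zero_iff, Complex.exp_ne_zero]

theorem expProd_self (a : Fin m → ℂ) (c : ℂ) (i : Fin m) : expProd τ a c (a i) = 0 :=
  expProd_eq_zero_iff.mpr ⟨i, by rw [sub_self, theta_zero]⟩

theorem expProd_neg (z : ℂ) : expProd τ (-a) (-c) z = (-1) ^ m * expProd τ a c (-z) := by
  have hroot := rootProd_neg (τ := τ) (-a) (-z)
  rw [neg_neg, neg_neg] at hroot
  rw [expProd, expProd, hroot, neg_mul_comm]
  ring

theorem exists_expProd_ne_zero (hτ : 0 < τ.im) (a : Fin m → ℂ) (c : ℂ) :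
    ∃ z, expProd τ a c z ≠ 0 := by
  obtain ⟨z, hz⟩ := exists_prod_theta_ne_zero hτ Finset.univ (-a)
  exact ⟨z, mul_ne_zero (exp_ne_zero _)
    (by simpa only [rootProd, Pi.neg_apply, ← sub_eq_add_neg] using hz)⟩

namespace LameEq

variable {ψ : ℂ → ℂ}

theorem const_mul (h : LameEq τ w m ε ψ) (C : ℂ) : LameEq τ w m ε fun z => C * ψ z := fun z => by
  linear_combination C * h z

theorem comp_neg (h : LameEq τ w m ε ψ) : LameEq τ w m ε fun z => ψ (-z) := by
  intro z
  have hneg := h (-z)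
  rw [show -z + m * w = -(z - m * w) by ring, show -z - m * w = -(z + m * w) by ring, theta_neg,
    theta_neg, theta_neg, show -z - w = -(z + w) by ring, show -z + w = -(z - w) by ring] at hneg
  linear_combination -hneg

theorem apply_natCast_mul (h : LameEq τ w m ε ψ) (hw : IsGenericStep τ w)
    (hy : IsLameSeq τ w m ε y) {k : ℕ} (hk : k ≤ m) : ψ (k * w) * y m = y k * ψ (m * w) := by
  induction hj : m - k using Nat.strong_induction_on generalizing k with
  | _ j ih =>
    rcases hk.eq_or_lt with rfl | hlt
    · ring
    have hsucc := ih (m - (k + 1)) (by omega) hlt rfl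
    have hsucc₂ : theta τ (((k + 1 : ℕ) - m) * w) * (ψ (((k + 1 : ℕ) + 1) * w) * y m)
        = theta τ (((k + 1 : ℕ) - m) * w) * (y (k + 1 + 1) * ψ (m * w)) := by
      rcases (Nat.succ_le_of_lt hlt).eq_or_lt with rfl | hlt₂
      · rw [sub_self, zero_mul, theta_zero, zero_mul, zero_mul]
      · rw [← ih (m - (k + 1 + 1)) (by omega) hlt₂ rfl, Nat.cast_succ (k + 1)]
    have hrec := hy.recurrence (k + 1) (by omega) hlt
    have heqn := h ((k + 1 : ℕ) * w)
    rw [← add_mul, ← sub_mul, show ((k + 1 : ℕ) : ℂ) * w - w = k * w by push_cast; ring,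
      show ((k + 1 : ℕ) : ℂ) * w + w = ((k + 1 : ℕ) + 1) * w by ring] at heqn
    rw [Nat.add_sub_cancel] at hrec
    apply mul_left_cancel₀ (hw.theta_ne_zero (c := (k + 1 : ℕ) + m) ((k + 1 : ℕ) + m) (by omega)
      (by push_cast; ring))
    linear_combination y m * heqn - ψ (m * w) * hrec + ε * theta τ ((k + 1 : ℕ) * w) * hsucc
      - hsucc₂

theorem exists_eq_evenExt (h : LameEq τ w m ε ψ) (hw : IsGenericStep τ w)
    (hy : IsLameSeq τ w m ε y) (h0 : ψ (m * w) ≠ 0) :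
    ∃ g ≠ 0, ∀ k : ℤ, -m ≤ k → k ≤ m → ψ (k * w) = evenExt y k * g := by
  have hym := hy.ne_zero m le_rfl
  have hpos {k : ℕ} (hk : k ≤ m) := h.apply_natCast_mul hw hy hk
  have hneg {k : ℕ} (hk : k ≤ m) := h.comp_neg.apply_natCast_mul hw hy hk
  have heven : ψ (-(m * w)) = ψ (m * w) := by
    have hzero := hneg m.zero_le
    rw [Nat.cast_zero, zero_mul, neg_zero, ← zero_mul w, ← Nat.cast_zero, hpos m.zero_le] at hzero
    exact mul_left_cancel₀ (hy.ne_zero 0 m.zero_le) hzero.symm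
  refine ⟨ψ (m * w) / y m, div_ne_zero h0 hym, fun k hk hk' => ?_⟩
  rw [mul_div_assoc', eq_div_iff hym]
  obtain ⟨j, rfl | rfl⟩ := k.eq_nat_or_neg
  · rw [evenExt_natCast, Int.cast_natCast]
    exact hpos (by omega)
  · rw [evenExt_neg, evenExt_natCast, Int.cast_neg, Int.cast_natCast, neg_mul, ← heven]
    exact hneg (by omega)

end LameEq

/-- The function `expProd τ a c` solves the Lamé equation, and its roots `a` are in general
position. By `isBetheSolution_iff_isLameRoots` this is the condition of the Bethe ansatz. -/
structure IsLameRoots (τ w : ℂ) (m : ℕ) (ε : ℂ) (a : Fin m → ℂ) (c : ℂ) : Prop where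
  incongruentOn : IncongruentOn τ Finset.univ a
  add_ne_zero : ∀ i, theta τ (a i + m * w) ≠ 0
  sub_ne_zero : ∀ i, theta τ (a i - m * w) ≠ 0
  step_ne_zero : ∀ i j, theta τ (a i - a j + w) ≠ 0
  lameEq : LameEq τ w m ε (expProd τ a c)

theorem IsLameRoots.neg (h : IsLameRoots τ w m ε a c) : IsLameRoots τ w m ε (-a) (-c) where
  incongruentOn i _ j _ hij := by
    simpa only [Pi.neg_apply, neg_sub_neg] using
      h.incongruentOn j (Finset.mem_univ j) i (Finset.mem_univ i) hij.symm
  add_ne_zero i := by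
    rw [Pi.neg_apply, neg_add_eq_sub, theta_sub_comm, neg_ne_zero]
    exact h.sub_ne_zero i
  sub_ne_zero i := by
    rw [Pi.neg_apply, ← neg_add', theta_neg, neg_ne_zero]
    exact h.add_ne_zero i
  step_ne_zero i j := by
    simpa only [Pi.neg_apply, neg_sub_neg] using h.step_ne_zero j i
  lameEq := by
    simpa only [← expProd_neg] using h.lameEq.comp_neg.const_mul ((-1) ^ m)

theorem IsLameRoots.expProd_ne_zero (h : IsLameRoots τ w m ε a c) : expProd τ a c (m * w) ≠ 0 := by
  rw [Ne, expProd_eq_zero_iff]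
  rintro ⟨i, hi⟩
  refine h.sub_ne_zero i ?_
  rw [theta_sub_comm, hi, neg_zero]

/-- The first term `ψ(z) ψ₋(z + w)` of the difference Wronskian of `ψ = expProd τ a c` and
`ψ₋ = expProd τ (-a) (-c)`. The second term is the first term for `(-a, -c)`. -/
def crossProd (τ w : ℂ) {m : ℕ} (a : Fin m → ℂ) (c z : ℂ) : ℂ :=
  expProd τ a c z * expProd τ (-a) (-c) (z + w)

theorem crossProd_neg (z : ℂ) :
    crossProd τ w (-a) (-c) z = expProd τ a c (z + w) * expProd τ (-a) (-c) z := by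
  rw [crossProd, neg_neg, neg_neg, mul_comm]

theorem crossProd_mul_crossProd_neg (z : ℂ) :
    crossProd τ w a c z * crossProd τ w (-a) (-c) z
      = expProd τ a c z * expProd τ (-a) (-c) z
        * (expProd τ a c (z + w) * expProd τ (-a) (-c) (z + w)) := by
  rw [crossProd_neg, crossProd]
  ring

theorem isTheta_crossProd (hτ : 0 < τ.im) (a : Fin m → ℂ) (c : ℂ) :
    IsTheta τ (2 * m) 1 (wronskFactor τ w m) (crossProd τ w a c) := by
  have h := (isTheta_expProd hτ a c).mul ((isTheta_expProd hτ (-a) (-c)).shift w)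
  rw [← two_mul] at h
  have hsign : ((-1 : ℂ) ^ m) * (-1) ^ m = 1 := by rw [← mul_pow]; norm_num
  have hexp : cexp c * cexp (-c) = 1 := by rw [← Complex.exp_add, add_neg_cancel, exp_zero]
  have hexp_tau : cexp (c * τ) * cexp (-c * τ) = 1 := by
    rw [← Complex.exp_add, neg_mul, add_neg_cancel, exp_zero]
  have hexp_sum : cexp (2 * π * I * ∑ i, a i) * cexp (2 * π * I * ∑ i, (-a) i) = 1 := by
    rw [← Complex.exp_add, ← mul_add, ← Finset.sum_add_distrib]
    simp
  refine h.congr ?_ ?_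
  · linear_combination ((-1 : ℂ) ^ m) * (-1) ^ m * hexp + hsign
  · rw [wronskFactor, two_mul m, pow_add, ← mul_assoc (2 * (π : ℂ) * I) (m : ℂ) w]
    linear_combination tauFactor τ ^ m * tauFactor τ ^ m * cexp (-(2 * π * I * m * w)) *
      (cexp (2 * π * I * ∑ i, a i) * cexp (2 * π * I * ∑ i, (-a) i) * hexp_tau + hexp_sum)

theorem isTheta_expProd_mul_neg (hτ : 0 < τ.im) (a : Fin m → ℂ) (c : ℂ) :
    IsTheta τ (2 * m) 1 (tauFactor τ ^ (2 * m))
      fun z => expProd τ a c z * expProd τ (-a) (-c) z := by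
  have hcross : crossProd τ 0 a c = fun z => expProd τ a c z * expProd τ (-a) (-c) z := by
    funext z
    rw [crossProd, add_zero]
  exact hcross ▸ (isTheta_crossProd hτ a c).congr rfl (by simp [wronskFactor])

theorem crossProd_symm (z : ℂ) : crossProd τ w a c (-z - w) = crossProd τ w a c z := by
  rw [crossProd, crossProd, sub_add_cancel, expProd_neg, expProd_neg, neg_neg, neg_add']
  ring

theorem LameEq.crossProd_eqn (h : LameEq τ w m ε (expProd τ a c))
    (h' : LameEq τ w m ε (expProd τ (-a) (-c))) (z : ℂ) :
    theta τ (z + m * w) * (crossProd τ w a c (z - w) + crossProd τ w (-a) (-c) (z - w))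
      + theta τ (z - m * w) * (crossProd τ w a c z + crossProd τ w (-a) (-c) z)
      = 2 * ε * theta τ z * (expProd τ a c z * expProd τ (-a) (-c) z) := by
  simp only [crossProd_neg]
  simp only [crossProd, sub_add_cancel]
  linear_combination expProd τ (-a) (-c) z * h z + expProd τ a c z * h' z

namespace IsLameRoots

theorem exists_values (h : IsLameRoots τ w m ε a c) (hw : IsGenericStep τ w)
    (hy : IsLameSeq τ w m ε y) :
    ∃ g ≠ 0, ∀ k : ℤ, -m ≤ k → k ≤ m → expProd τ a c (k * w) = evenExt y k * g ∧
      expProd τ (-a) (-c) (k * w) = (-1) ^ m * (evenExt y k * g) := by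
  obtain ⟨g, hg, hval⟩ := h.lameEq.exists_eq_evenExt hw hy h.expProd_ne_zero
  refine ⟨g, hg, fun k hk hk' => ⟨hval k hk hk', ?_⟩⟩
  rw [expProd_neg, show -((k : ℂ) * w) = ((-k : ℤ) : ℂ) * w by push_cast; ring,
    hval _ (by omega) (by omega), evenExt_neg]

theorem exists_mul_evenProd_and_trace (h : IsLameRoots τ w m ε a c) (hτ : 0 < τ.im)
    (hw : IsGenericStep τ w) (hy : IsLameSeq τ w m ε y) {s : ℂ → ℂ} (hs : IsTrace τ w m ε y s) :
    ∃ G ≠ 0, (∀ z, expProd τ a c z * expProd τ (-a) (-c) z = G * evenProd τ w m y z) ∧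
      ∀ z, crossProd τ w a c z + crossProd τ w (-a) (-c) z = G * s z := by
  obtain ⟨g, hg, hval⟩ := h.exists_values hw hy
  set G : ℂ := (-1) ^ m * g ^ 2 with hG
  have hG0 : G ≠ 0 := mul_ne_zero (pow_ne_zero _ (by norm_num)) (pow_ne_zero _ hg)
  have hnorm (z : ℂ) :
      G⁻¹ * (expProd τ a c z * expProd τ (-a) (-c) z) = evenProd τ w m y z := by
    refine eq_evenProd hτ hw ((isTheta_expProd_mul_neg hτ a c).const_mul G⁻¹)
      (fun k hk hk' => ?_) z
    rw [(hval k hk hk').1, (hval k hk hk').2, inv_mul_eq_iff_eq_mul₀ hG0, hG]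
    ring
  have htrace : IsTrace τ w m ε y fun z =>
      G⁻¹ * (crossProd τ w a c z + crossProd τ w (-a) (-c) z) := by
    refine ⟨((isTheta_crossProd hτ a c).add (isTheta_crossProd hτ _ _)).const_mul _,
      fun z => by simp only [crossProd_symm], fun k hk hk' => ?_, fun z => ?_⟩
    · have hk₁ : (k : ℂ) * w + w = ((k + 1 : ℤ) : ℂ) * w := by push_cast; ring
      obtain ⟨hval₀, hval₀'⟩ := hval k (by omega) (by omega)
      obtain ⟨hval₁, hval₁'⟩ := hval (k + 1) (by omega) (by omega)
      rw [crossProd_neg, crossProd, hk₁, hval₀, hval₀', hval₁, hval₁',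
        inv_mul_eq_iff_eq_mul₀ hG0, hG]
      ring
    · linear_combination G⁻¹ * h.lameEq.crossProd_eqn h.neg.lameEq z
        + 2 * ε * theta τ z * hnorm z
  exact ⟨G, hG0, fun z => (inv_mul_eq_iff_eq_mul₀ hG0).mp (hnorm z),
    fun z => (inv_mul_eq_iff_eq_mul₀ hG0).mp (htrace.unique hτ hw hs z)⟩

theorem crossProd_eq_or (ha : IsLameRoots τ w m ε a c) (hb : IsLameRoots τ w m ε b d)
    (hτ : 0 < τ.im) (hw : IsGenericStep τ w) (hy : IsLameSeq τ w m ε y) {s : ℂ → ℂ}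
    (hs : IsTrace τ w m ε y s) :
    ∃ r ≠ 0, (∀ z, crossProd τ w b d z = r * crossProd τ w a c z) ∨
      ∀ z, crossProd τ w b d z = r * crossProd τ w (-a) (-c) z := by
  obtain ⟨G, hG, hΦa, hsa⟩ := ha.exists_mul_evenProd_and_trace hτ hw hy hs
  obtain ⟨H, hH, hΦb, hsb⟩ := hb.exists_mul_evenProd_and_trace hτ hw hy hs
  refine ⟨H / G, div_ne_zero hH hG, ?_⟩
  have hda := (isTheta_crossProd (w := w) hτ a c).diff
  have hda' := (isTheta_crossProd (w := w) hτ (-a) (-c)).diff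
  have hdb := (isTheta_crossProd (w := w) hτ b d).diff
  -- Both normalized pairs are the roots of the quadratic `X ^ 2 - s X + Φ Φ(· + w)`.
  have hmul (z : ℂ) : (crossProd τ w b d z - H / G * crossProd τ w a c z)
      * (crossProd τ w b d z - H / G * crossProd τ w (-a) (-c) z) = 0 := by
    have hna := crossProd_mul_crossProd_neg (τ := τ) (w := w) (a := a) (c := c) z
    have hnb := crossProd_mul_crossProd_neg (τ := τ) (w := w) (a := b) (c := d) z
    rw [hΦa, hΦa] at hna
    rw [hΦb, hΦb] at hnb
    field_simp
    linear_combination H ^ 2 * hna - G ^ 2 * hnb - G * H * crossProd τ w b d z * hsa z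
      + G ^ 2 * crossProd τ w b d z * hsb z
  by_cases h0 : ∀ z, crossProd τ w b d z - H / G * crossProd τ w a c z = 0
  · exact Or.inl fun z => sub_eq_zero.mp (h0 z)
  · push Not at h0
    obtain ⟨z₀, hz₀⟩ := h0
    exact Or.inr fun z => sub_eq_zero.mp (eq_zero_of_mul_eq_zero
      (hdb.fun_sub (hda.const_mul _)) (hdb.fun_sub (hda'.const_mul _)) hz₀ hmul z)

end IsLameRoots

theorem exists_perm_of_expProd_eq_zero (hτ : 0 < τ.im) (hb : IncongruentOn τ Finset.univ b)
    (h : ∀ i, expProd τ a c (b i) = 0) :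
    ∃ (σ : Equiv.Perm (Fin m)) (k l : Fin m → ℤ), ∀ i, b i = a (σ i) + k i + l i * τ := by
  choose f hf using fun i => expProd_eq_zero_iff.mp (h i)
  have hinj : Function.Injective f := by
    intro i j hij
    by_contra hne
    refine hb i (Finset.mem_univ i) j (Finset.mem_univ j) hne ?_
    rw [← sub_sub_sub_cancel_right (b i) (b j) (a (f i))]
    exact theta_sub_eq_zero hτ (hf i) (hij ▸ hf j)
  choose k l hkl using fun i => (theta_eq_zero_iff hτ).mp (hf i)
  exact ⟨Equiv.ofBijective f (Finite.injective_iff_bijective.mp hinj), k, l, fun i => by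
    rw [Equiv.ofBijective_apply]; linear_combination hkl i⟩

theorem exists_expProd_eq_mul (hτ : 0 < τ.im) (c d : ℂ) {σ : Equiv.Perm (Fin m)} {k l : Fin m → ℤ}
    (h : ∀ i, b i = a (σ i) + k i + l i * τ) : ∃ C ≠ 0, ∀ z, expProd τ b d z
      = C * cexp ((d - c + 2 * π * I * ((∑ i, l i : ℤ) : ℂ)) * z) * expProd τ a c z := by
  have hfactor (i : Fin m) : ∃ C ≠ 0, ∀ z, theta τ (z - b i)
      = C * cexp (2 * π * I * l i * z) * theta τ (z - a (σ i)) := by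
    refine ⟨(-1) ^ (-k i) * tauFactor τ ^ (-l i)
      * cexp (π * I * l i * ((-l i - 1) * τ - 2 * a (σ i))), ?_, fun z => ?_⟩
    · exact mul_ne_zero (mul_ne_zero (zpow_ne_zero _ (by norm_num))
        (zpow_ne_zero _ (tauFactor_ne_zero τ))) (exp_ne_zero _)
    · have hlattice := (IsTheta.of_theta hτ).add_lattice (by norm_num) (tauFactor_ne_zero τ)
        (-k i) (-l i) (z - a (σ i))
      rw [h i, show z - (a (σ i) + k i + l i * τ)
        = z - a (σ i) + ((-k i : ℤ) : ℂ) + ((-l i : ℤ) : ℂ) * τ by push_cast; ring, hlattice,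
        mul_assoc _ (cexp _) (cexp _), ← Complex.exp_add]
      congr 3
      push_cast
      ring
  choose C hC hCz using hfactor
  refine ⟨∏ i, C i, Finset.prod_ne_zero_iff.mpr fun i _ => hC i, fun z => ?_⟩
  have hexp : cexp ((d - c + 2 * π * I * ((∑ i, l i : ℤ) : ℂ)) * z) * cexp (c * z)
      = cexp (d * z) * cexp (2 * π * I * (∑ i, (l i : ℂ)) * z) := by
    rw [← Complex.exp_add, ← Complex.exp_add]
    congr 1
    push_cast
    ring
  simp only [expProd, rootProd, hCz]
  rw [Finset.prod_mul_distrib, Finset.prod_mul_distrib, ← Complex.exp_sum,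
    Equiv.prod_comp σ fun i => theta τ (z - a i), ← Finset.sum_mul, ← Finset.mul_sum]
  linear_combination -(∏ i, C i) * (∏ i, theta τ (z - a i)) * hexp

/-- Two solutions whose quotient is `C * cexp (γ * z)` with `cexp (γ * w) = 1`, in terms of their
data: the roots agree up to order and modulo the lattice, and the translation of the root `a (σ i)`
by `l i * τ` is compensated by the exponent. -/
def RootsEquiv (τ w : ℂ) {m : ℕ} (a : Fin m → ℂ) (c : ℂ) (b : Fin m → ℂ) (d : ℂ) : Prop :=
  ∃ (σ : Equiv.Perm (Fin m)) (k l : Fin m → ℤ) (n : ℤ), (∀ i, b i = a (σ i) + k i + l i * τ) ∧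
    (d - c + 2 * π * I * ((∑ i, l i : ℤ) : ℂ)) * w = 2 * π * I * n

/-- At `m * w` one of the two terms of the Lamé equation vanishes, so a factor that is not
`w`-periodic would change the eigenvalue. -/
theorem IsLameRoots.exp_eq_one_of_expProd_eq_mul (ha : IsLameRoots τ w m ε a c)
    (hb : IsLameRoots τ w m ε b d) (hw : IsGenericStep τ w) (hm : m ≠ 0) (hε : ε ≠ 0) {C γ : ℂ}
    (hC : C ≠ 0) (h : ∀ z, expProd τ b d z = C * cexp (γ * z) * expProd τ a c z) :
    cexp (-(γ * w)) = 1 := by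
  have heqa := ha.lameEq (m * w)
  have heqb := hb.lameEq (m * w)
  rw [sub_self, theta_zero, zero_mul, add_zero] at heqa heqb
  rw [h, h, mul_sub, sub_eq_add_neg (γ * (m * w)), Complex.exp_add] at heqb
  have hne : C * cexp (γ * (m * w)) * (ε * theta τ (m * w) * expProd τ a c (m * w)) ≠ 0 :=
    mul_ne_zero (mul_ne_zero hC (exp_ne_zero _)) (mul_ne_zero (mul_ne_zero hε
      (hw.theta_ne_zero m (by omega) (by push_cast; ring))) ha.expProd_ne_zero)
  apply mul_left_cancel₀ hne
  linear_combination heqb - C * cexp (γ * (m * w)) * cexp (-(γ * w)) * heqa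

theorem IsLameRoots.rootsEquiv_of_crossProd_eq (ha : IsLameRoots τ w m ε a c)
    (hb : IsLameRoots τ w m ε b d) (hτ : 0 < τ.im) (hw : IsGenericStep τ w) (hm : m ≠ 0)
    (hε : ε ≠ 0) (hy : IsLameSeq τ w m ε y) {s : ℂ → ℂ} (hs : IsTrace τ w m ε y s)
    {r : ℂ} (hr : r ≠ 0) (hab : ∀ z, crossProd τ w b d z = r * crossProd τ w a c z)
    (hne : ∀ z, evenProd τ w m y z = 0 → crossProd τ w a c z ≠ crossProd τ w (-a) (-c) z) :
    RootsEquiv τ w a c b d := by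
  obtain ⟨G, -, hΦa, -⟩ := ha.exists_mul_evenProd_and_trace hτ hw hy hs
  obtain ⟨H, hH, hΦb, -⟩ := hb.exists_mul_evenProd_and_trace hτ hw hy hs
  have hzero (i : Fin m) : expProd τ a c (b i) = 0 := by
    have hΦ : evenProd τ w m y (b i) = 0 := by
      have h := hΦb (b i)
      rw [expProd_self, zero_mul] at h
      exact (mul_eq_zero.mp h.symm).resolve_left hH
    have hcross : crossProd τ w a c (b i) = 0 := by
      have h := hab (b i)
      rw [crossProd, expProd_self, zero_mul] at h
      exact (mul_eq_zero.mp h.symm).resolve_left hr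
    by_contra hψ
    have hψ_neg := hΦa (b i)
    rw [hΦ, mul_zero, mul_eq_zero] at hψ_neg
    exact hne _ hΦ (by rw [hcross, crossProd_neg, hψ_neg.resolve_left hψ, mul_zero])
  obtain ⟨σ, k, l, hσ⟩ := exists_perm_of_expProd_eq_zero hτ hb.incongruentOn hzero
  obtain ⟨C, hC, hCz⟩ := exists_expProd_eq_mul hτ c d hσ
  obtain ⟨n, hn⟩ := Complex.exp_eq_one_iff.mp
    (ha.exp_eq_one_of_expProd_eq_mul hb hw hm hε hC hCz)
  refine ⟨σ, k, l, -n, hσ, ?_⟩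
  push_cast at hn ⊢
  linear_combination -hn

theorem RootsEquiv.crossProd_eq (hτ : 0 < τ.im) (h : RootsEquiv τ w a c (-a) (-c)) (z : ℂ) :
    crossProd τ w a c z = crossProd τ w (-a) (-c) z := by
  obtain ⟨σ, k, l, n, hσ, hn⟩ := h
  obtain ⟨C, -, hC⟩ := exists_expProd_eq_mul hτ c (-c) hσ
  have hexp : cexp ((-c - c + 2 * π * I * ((∑ i, l i : ℤ) : ℂ)) * w) = 1 :=
    Complex.exp_eq_one_iff.mpr ⟨n, by rw [hn, mul_comm]⟩
  rw [crossProd_neg, crossProd, hC, hC, mul_add, Complex.exp_add, hexp]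
  ring

theorem exists_isLameRoots (hτ : 0 < τ.im) (hw : IsGenericStep τ w) (hm : m ≠ 0)
    (hy : IsLameSeq τ w m ε y) {a : Fin m → ℂ}
    (ha : IsSimpleFactorization τ (evenProd τ w m y) a) :
    ∃ (b : Fin m → ℂ) (c : ℂ), IsLameRoots τ w m ε b c ∧ ∃ C ≠ 0, ∀ z,
      crossProd τ w b c z - crossProd τ w (-b) (-c) z = C * wronskProd τ w m z := by
  obtain ⟨b, c, C, hC, heqn, hinc, hroot, hstep, hwronsk⟩ :=
    exists_expProd_solution hτ hw hm hy ha
  refine ⟨b, c, ⟨hinc, fun i => ?_, fun i => ?_, hstep, heqn⟩, (-1) ^ m * C,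
    mul_ne_zero (pow_ne_zero _ (by norm_num)) hC, fun z => ?_⟩
  · have hadd := theta_add_int_ne_zero hτ hw hy (hroot i) (k := m) (by omega) le_rfl
    rwa [Int.cast_natCast] at hadd
  · have hsub := theta_add_int_ne_zero hτ hw hy (hroot i) (k := -m) le_rfl (by omega)
    rwa [Int.cast_neg, Int.cast_natCast, neg_mul, ← sub_eq_add_neg] at hsub
  · rw [crossProd_neg, crossProd, expProd_neg, expProd_neg, neg_add', mul_assoc _ C, ← hwronsk z]
    ring

theorem IsLameRoots.rootsEquiv_or_rootsEquiv_neg (ha : IsLameRoots τ w m ε a c)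
    (hb : IsLameRoots τ w m ε b d) (hτ : 0 < τ.im) (hw : IsGenericStep τ w) (hm : m ≠ 0)
    (hε : ε ≠ 0) (hy : IsLameSeq τ w m ε y)
    (hne : ∀ z, wronskProd τ w m z ≠ 0 → crossProd τ w a c z ≠ crossProd τ w (-a) (-c) z) :
    RootsEquiv τ w a c b d ∨ RootsEquiv τ w (-a) (-c) b d := by
  have hne' (z : ℂ) (hz : evenProd τ w m y z = 0) :=
    hne z (wronskProd_ne_zero_of_evenProd_eq_zero hτ hw hy hz)
  obtain ⟨s, hs⟩ := exists_isTrace hτ hw hy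
  obtain ⟨r, hr, h | h⟩ := ha.crossProd_eq_or hb hτ hw hy hs
  · exact Or.inl (ha.rootsEquiv_of_crossProd_eq hb hτ hw hm hε hy hs hr h hne')
  · refine Or.inr (ha.neg.rootsEquiv_of_crossProd_eq hb hτ hw hm hε hy hs hr h fun z hz => ?_)
    rw [neg_neg, neg_neg]
    exact (hne' z hz).symm

end LameRoots

/-! ### The Bethe ansatz equations -/

section Bethe

variable {τ w η ε c : ℂ} {m : ℕ} {a : Fin m → ℂ} {p q : Param m}

/-- The zeros of the Bethe function of `p`, one in each class modulo `ℤ + τℤ`. -/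
def betheRoots (η : ℂ) {m : ℕ} (p : Param m) : Fin m → ℂ := fun i => η - p.1 i

theorem betheRoots_reflect (η : ℂ) (p : Param m) :
    betheRoots η (reflect η p) = -betheRoots η p := by
  funext i
  simp only [betheRoots, reflect, Pi.neg_apply]
  ring

theorem exists_betheRoots_eq (η : ℂ) (a : Fin m → ℂ) (c : ℂ) :
    ∃ p : Param m, betheRoots η p = a ∧ p.2 = c :=
  ⟨(fun i => η - a i, c), funext fun i => sub_sub_cancel η (a i), rfl⟩

theorem betheFunction_eq_expProd (τ η : ℂ) (p : Param m) :
    betheFunction τ η m p = expProd τ (betheRoots η p) p.2 := by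
  funext z
  simp only [betheFunction, expProd, rootProd, betheRoots, sub_sub_eq_add_sub]

theorem betheEigenvalue_eq_div (τ η : ℂ) (p : Param m) :
    betheEigenvalue τ η m p
      = theta τ (2 * (m * (2 * η))) * expProd τ (betheRoots η p) p.2 (m * (2 * η) - 2 * η)
        / (theta τ (m * (2 * η)) * expProd τ (betheRoots η p) p.2 (m * (2 * η))) := by
  have hexp : cexp (p.2 * (m * (2 * η) - 2 * η))
      = cexp (p.2 * (m * (2 * η))) * cexp (-2 * η * p.2) := by
    rw [← Complex.exp_add]
    ring_nf
  have hnum (i : Fin m) :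
      p.1 i + (2 * m - 3) * η = m * (2 * η) - 2 * η - betheRoots η p i := by
    rw [betheRoots]
    ring
  have hden (i : Fin m) : p.1 i + (2 * m - 1) * η = m * (2 * η) - betheRoots η p i := by
    rw [betheRoots]
    ring
  simp only [betheEigenvalue, expProd, rootProd, hnum, hden, Finset.prod_div_distrib]
  rw [hexp, show 4 * η * m = 2 * (m * (2 * η)) by ring, show 2 * η * m = m * (2 * η) by ring,
    mul_div_assoc', mul_div_assoc', div_mul_eq_mul_div, div_div,
    ← mul_div_mul_left _ _ (exp_ne_zero (p.2 * (m * (2 * η))))]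
  congr 1 <;> ring

/-- At `2ηm` one of the two terms of the Lamé equation vanishes, which gives the formula for the
eigenvalue. -/
theorem betheEigenvalue_eq_of_lameEq (hw : IsGenericStep τ (2 * η)) (hm : m ≠ 0)
    (h : LameEq τ (2 * η) m ε (expProd τ (betheRoots η p) p.2))
    (h0 : expProd τ (betheRoots η p) p.2 (m * (2 * η)) ≠ 0) :
    betheEigenvalue τ η m p = ε := by
  have hθ : theta τ (m * (2 * η)) ≠ 0 := hw.theta_ne_zero m (by omega) (by push_cast; ring)
  rw [betheEigenvalue_eq_div, div_eq_iff (mul_ne_zero hθ h0)]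
  have hval := h (m * (2 * η))
  rw [sub_self, theta_zero, ← two_mul] at hval
  linear_combination hval

theorem bethe_equation_iff_lame_equation_at_root (hw : IsGenericStep τ w) (i : Fin m)
    (hsub : theta τ (a i - m * w) ≠ 0) (hstep : ∀ j, theta τ (a i - a j + w) ≠ 0) :
    theta τ (-(a i + m * w)) / theta τ (-(a i - m * w)) * ∏ j ∈ Finset.univ.erase i,
        (theta τ (a i - a j - w) / theta τ (a i - a j + w)) = cexp (2 * w * c)
      ↔ theta τ (a i + m * w) * expProd τ a c (a i - w)
        + theta τ (a i - m * w) * expProd τ a c (a i + w) = 0 := by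
  have hprod : ∏ j ∈ Finset.univ.erase i, theta τ (a i - a j + w) ≠ 0 :=
    Finset.prod_ne_zero_iff.mpr fun j _ => hstep j
  have hθ : theta τ w ≠ 0 := by simpa using hw 1 one_ne_zero
  have hexp : cexp (c * (a i + w)) = cexp (c * (a i - w)) * cexp (2 * w * c) := by
    rw [← Complex.exp_add]
    ring_nf
  have hpred : rootProd τ a (a i - w)
      = -theta τ w * ∏ j ∈ Finset.univ.erase i, theta τ (a i - a j - w) := by
    simp only [rootProd, sub_right_comm (a i) w]
    rw [← Finset.mul_prod_erase _ _ (Finset.mem_univ i), sub_self, zero_sub, theta_neg]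
  have hsucc : rootProd τ a (a i + w)
      = theta τ w * ∏ j ∈ Finset.univ.erase i, theta τ (a i - a j + w) := by
    simp only [rootProd, add_sub_right_comm (a i) w]
    rw [← Finset.mul_prod_erase _ _ (Finset.mem_univ i), sub_self, zero_add]
  rw [theta_neg, theta_neg, neg_div_neg_eq, Finset.prod_div_distrib, div_mul_div_comm,
    div_eq_iff (mul_ne_zero hsub hprod), expProd, expProd, hexp, hpred, hsucc]
  constructor
  · intro h
    linear_combination -(cexp (c * (a i - w)) * theta τ w) * h
  · intro h
    apply mul_left_cancel₀ (mul_ne_zero (exp_ne_zero (c * (a i - w))) hθ)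
    linear_combination -h

theorem IsTheta.exists_expProd_mul (hτ : 0 < τ.im) (ha : IncongruentOn τ Finset.univ a) (c : ℂ)
    {n : ℕ} {α β : ℂ} {g : ℂ → ℂ} (hg : IsTheta τ (m + n) (cexp c * (-1) ^ m * α)
      (cexp (c * τ) * (tauFactor τ ^ m * cexp (2 * π * I * ∑ i, a i)) * β) g)
    (h0 : ∀ i, g (a i) = 0) :
    ∃ h, IsTheta τ n α β h ∧ ∀ z, g z = expProd τ a c z * h z := by
  obtain ⟨f, α', β', hf, hgf⟩ := IsTheta.exists_prod_mul (n := n) hτ ha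
    (by rwa [Finset.card_univ, Fintype.card_fin, add_comm n]) fun i _ => h0 i
  have hfactor (z : ℂ) : g z = expProd τ a c z * (cexp (-(c * z)) * f z) := by
    have hexp : cexp (c * z) * cexp (-(c * z)) = 1 := by
      rw [← Complex.exp_add, add_neg_cancel, exp_zero]
    rw [hgf, expProd, rootProd]
    linear_combination -(∏ i, theta τ (z - a i)) * f z * hexp
  obtain ⟨z₀, hz₀⟩ := exists_expProd_ne_zero hτ a c
  have hdiff := hf.diff
  exact ⟨_, (isTheta_expProd hτ a c).of_mul hz₀ (by fun_prop) (by rwa [← funext hfactor]), hfactor⟩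

/-- The left-hand side of the Lamé equation is a theta function of degree `m + 1`, hence divisible
by `expProd τ a c` once it vanishes at the `m` roots; the quotient is a multiple of `θ`. -/
theorem exists_lameEq_of_forall_root (hτ : 0 < τ.im) (ha : IncongruentOn τ Finset.univ a)
    (h : ∀ i, theta τ (a i + m * w) * expProd τ a c (a i - w)
        + theta τ (a i - m * w) * expProd τ a c (a i + w) = 0) :
    ∃ ε, LameEq τ w m ε (expProd τ a c) := by
  have hterm (u v : ℂ) (huv : m * u + v = 0) :
      IsTheta τ (m + 1) (cexp c * (-1) ^ m * -1)
        (cexp (c * τ) * (tauFactor τ ^ m * cexp (2 * π * I * ∑ i, a i)) * tauFactor τ)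
        fun z => expProd τ a c (z + u) * theta τ (z + v) :=
    ((isTheta_expProd hτ a c).mul_shift (IsTheta.of_theta hτ) u v).congr rfl
      (by rw [Nat.cast_one, one_mul, huv, mul_zero, neg_zero, exp_zero, mul_one])
  have hsum := (hterm (-w) (m * w) (by ring)).add (hterm w (-(m * w)) (by ring))
  simp only [← sub_eq_add_neg] at hsum
  obtain ⟨f, hf, hquot⟩ := hsum.exists_expProd_mul hτ ha c fun i => by
    linear_combination h i
  obtain ⟨ε, hε⟩ := hf.eq_const_mul_theta hτ
  exact ⟨ε, fun z => by linear_combination hquot z + expProd τ a c z * hε z⟩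

theorem incongruentOn_betheRoots_iff (hτ : 0 < τ.im) :
    IncongruentOn τ Finset.univ (betheRoots η p)
      ↔ ∀ i j : Fin m, i ≠ j → ¬ ∃ k l : ℤ, p.1 i - p.1 j = k + l * τ := by
  simp only [← theta_eq_zero_iff hτ, IncongruentOn, betheRoots, Finset.mem_univ, true_implies,
    sub_sub_sub_cancel_left]
  exact ⟨fun h i j hij => h j i hij.symm, fun h i j hij => h j i hij.symm⟩

/-- `p` satisfies the `i`-th Bethe equation, written in terms of the roots. -/
def BetheEq (τ η : ℂ) (p : Param m) (i : Fin m) : Prop :=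
  theta τ (-(betheRoots η p i + m * (2 * η))) / theta τ (-(betheRoots η p i - m * (2 * η)))
    * ∏ j ∈ Finset.univ.erase i, (theta τ (betheRoots η p i - betheRoots η p j - 2 * η)
      / theta τ (betheRoots η p i - betheRoots η p j + 2 * η)) = cexp (2 * (2 * η) * p.2)

theorem isBetheSolution_iff_betheEq (hτ : 0 < τ.im) : IsBetheSolution τ η m p
    ↔ IncongruentOn τ Finset.univ (betheRoots η p) ∧ ∀ i, BetheEq τ η p i := by
  have hadd (i : Fin m) :
      p.1 i - η * (1 + 2 * m) = -(betheRoots η p i + m * (2 * η)) := by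
    rw [betheRoots]
    ring
  have hsub (i : Fin m) :
      p.1 i - η * (1 - 2 * m) = -(betheRoots η p i - m * (2 * η)) := by
    rw [betheRoots]
    ring
  have hdiff (i j : Fin m) : p.1 j - p.1 i = betheRoots η p i - betheRoots η p j :=
    (sub_sub_sub_cancel_left _ _ _).symm
  rw [incongruentOn_betheRoots_iff hτ, IsBetheSolution]
  simp only [BetheEq, ← hadd, ← hsub, ← hdiff, show 2 * (2 * η) = 4 * η by ring]

namespace BetheEq

variable {i : Fin m}

theorem add_ne_zero (h : BetheEq τ η p i) : theta τ (betheRoots η p i + m * (2 * η)) ≠ 0 := by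
  intro h0
  refine h.trans_ne (exp_ne_zero _) ?_
  rw [theta_neg, h0, neg_zero, zero_div, zero_mul]

theorem sub_ne_zero (h : BetheEq τ η p i) : theta τ (betheRoots η p i - m * (2 * η)) ≠ 0 := by
  intro h0
  refine h.trans_ne (exp_ne_zero _) ?_
  rw [theta_neg τ (betheRoots η p i - _), h0, neg_zero, div_zero, zero_mul]

theorem step_ne_zero (h : BetheEq τ η p i) (hw : IsGenericStep τ (2 * η)) (j : Fin m) :
    theta τ (betheRoots η p i - betheRoots η p j + 2 * η) ≠ 0 := by
  rcases eq_or_ne j i with rfl | hij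
  · simpa using hw 1 one_ne_zero
  intro h0
  refine h.trans_ne (exp_ne_zero _) ?_
  rw [Finset.prod_eq_zero (Finset.mem_erase.mpr ⟨hij, Finset.mem_univ j⟩) (by rw [h0, div_zero]),
    mul_zero]

end BetheEq

theorem IsBetheSolution.exists_isLameRoots (h : IsBetheSolution τ η m p) (hτ : 0 < τ.im)
    (hw : IsGenericStep τ (2 * η)) : ∃ ε, IsLameRoots τ (2 * η) m ε (betheRoots η p) p.2 := by
  obtain ⟨hinc, heq⟩ := (isBetheSolution_iff_betheEq hτ).mp h
  obtain ⟨ε, hε⟩ := exists_lameEq_of_forall_root hτ hinc fun i =>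
    (bethe_equation_iff_lame_equation_at_root hw i (heq i).sub_ne_zero
      ((heq i).step_ne_zero hw)).mp (heq i)
  exact ⟨ε, hinc, fun i => (heq i).add_ne_zero, fun i => (heq i).sub_ne_zero,
    fun i => (heq i).step_ne_zero hw, hε⟩

theorem IsLameRoots.isBetheSolution (h : IsLameRoots τ (2 * η) m ε (betheRoots η p) p.2)
    (hτ : 0 < τ.im) (hw : IsGenericStep τ (2 * η)) : IsBetheSolution τ η m p := by
  refine (isBetheSolution_iff_betheEq hτ).mpr ⟨h.incongruentOn, fun i => ?_⟩
  refine (bethe_equation_iff_lame_equation_at_root hw i (h.sub_ne_zero i) (h.step_ne_zero i)).mpr ?_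
  rw [h.lameEq, expProd_self, mul_zero]

theorem isBetheSolution_iff_isLameRoots (hτ : 0 < τ.im) (hw : IsGenericStep τ (2 * η))
    (hm : m ≠ 0) : IsBetheSolution τ η m p ∧ betheEigenvalue τ η m p = ε
      ↔ IsLameRoots τ (2 * η) m ε (betheRoots η p) p.2 := by
  constructor
  · rintro ⟨hp, rfl⟩
    obtain ⟨ε, hε⟩ := hp.exists_isLameRoots hτ hw
    rwa [betheEigenvalue_eq_of_lameEq hw hm hε.lameEq hε.expProd_ne_zero]
  · intro h
    exact ⟨h.isBetheSolution hτ hw,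
      betheEigenvalue_eq_of_lameEq hw hm h.lameEq h.expProd_ne_zero⟩

theorem related_iff_rootsEquiv (hη : η ≠ 0) : Related τ η p q ↔
    RootsEquiv τ (2 * η) (betheRoots η p) p.2 (betheRoots η q) q.2 := by
  constructor
  · rintro ⟨σ, k, l, n, hroots, hexp⟩
    refine ⟨σ, -k, -l, n, fun i => ?_, ?_⟩
    · rw [betheRoots, betheRoots, hroots]
      push_cast [Pi.neg_apply]
      ring
    · rw [hexp]
      push_cast [Pi.neg_apply]
      rw [Finset.sum_neg_distrib]
      field_simp
      ring
  · rintro ⟨σ, k, l, n, hroots, hexp⟩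
    refine ⟨σ, -k, -l, n, fun i => ?_, ?_⟩
    · have hi := hroots i
      rw [betheRoots, betheRoots] at hi
      push_cast [Pi.neg_apply]
      linear_combination -hi
    · have hperiod : π * I / η * n
          = q.2 - p.2 + 2 * π * I * ((∑ i, l i : ℤ) : ℂ) := by
        field_simp
        linear_combination -hexp / 2
      rw [hperiod]
      push_cast [Pi.neg_apply]
      rw [Finset.sum_neg_distrib]
      ring

end Bethe

/-! ### Meromorphic solutions -/

section Meromorphic

variable {τ η ε : ℂ} {m : ℕ} {f g : ℂ → ℂ}

theorem eventually_codiscrete_comp_add {P : ℂ → Prop} (h : ∀ᶠ z in codiscrete ℂ, P z) (b : ℂ) :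
    ∀ᶠ z in codiscrete ℂ, P (z + b) := by
  rw [eventually_codiscrete_iff] at *
  intro z
  refine (tendsto_nhdsWithin_iff.mpr ⟨?_, ?_⟩ : Tendsto (· + b) _ _).eventually (h (z + b))
  · exact ((continuous_add_const b).tendsto z).mono_left nhdsWithin_le_nhds
  · filter_upwards [self_mem_nhdsWithin] with w hw
    exact fun h => hw (add_right_cancel h)

theorem eventually_codiscrete_theta_ne_zero (hτ : 0 < τ.im) :
    ∀ᶠ z in codiscrete ℂ, theta τ z ≠ 0 := by
  obtain ⟨z, hz⟩ := exists_theta_ne_zero hτ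
  exact eventually_codiscrete_ne_zero (differentiable_theta hτ) hz

theorem lameOp_eq_iff {z : ℂ} (hz : theta τ z ≠ 0) : lameOp τ η m f z = ε * f z ↔
    theta τ (z + m * (2 * η)) * f (z - 2 * η) + theta τ (z - m * (2 * η)) * f (z + 2 * η)
      = ε * theta τ z * f z := by
  rw [lameOp, mul_comm (2 * η), div_mul_eq_mul_div, div_mul_eq_mul_div, ← add_div, div_eq_iff hz,
    mul_right_comm ε]

theorem LameEq.isLameSolution (hτ : 0 < τ.im) (h : LameEq τ (2 * η) m ε f)
    (hf : Differentiable ℂ f) : IsLameSolution τ η m ε f := by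
  refine ⟨fun z => (hf.analyticAt z).meromorphicAt, ?_⟩
  filter_upwards [eventually_codiscrete_theta_ne_zero hτ] with z hz
  exact (lameOp_eq_iff hz).mpr (h z)

/-- The difference Wronskian of `f` and `g` with step `2η`: its nonvanishing means that `f` and `g`
are linearly independent over the `2η`-periodic functions. -/
def wronskian (η : ℂ) (f g : ℂ → ℂ) (z : ℂ) : ℂ := f z * g (z + 2 * η) - f (z + 2 * η) * g z

theorem meromorphic_wronskian (hf : Meromorphic f) (hg : Meromorphic g) :
    Meromorphic (wronskian η f g) :=
  (hf.mul (Meromorphic.meromorphic_fun_comp_add_const_iff_meromorphic.mpr hg)).sub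
    ((Meromorphic.meromorphic_fun_comp_add_const_iff_meromorphic.mpr hf).mul hg)

theorem IsLameSolution.wronskian_add (hτ : 0 < τ.im) (hf : IsLameSolution τ η m ε f)
    (hg : IsLameSolution τ η m ε g) : ∀ᶠ z in codiscrete ℂ,
      theta τ (z + 2 * η + m * (2 * η)) * wronskian η f g z
        = theta τ (z + 2 * η - m * (2 * η)) * wronskian η f g (z + 2 * η) := by
  filter_upwards [eventually_codiscrete_comp_add (eventually_codiscrete_theta_ne_zero hτ) (2 * η),
    eventually_codiscrete_comp_add hf.2 (2 * η), eventually_codiscrete_comp_add hg.2 (2 * η)]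
    with z hz hfz hgz
  rw [lameOp_eq_iff hz, add_sub_cancel_right] at hfz hgz
  simp only [wronskian]
  linear_combination g (z + 2 * η) * hfz - f (z + 2 * η) * hgz

theorem isPeriodicMeromorphic_wronskian_div (hτ : 0 < τ.im) {f' g' : ℂ → ℂ}
    (hf : IsLameSolution τ η m ε f) (hg : IsLameSolution τ η m ε g)
    (hf' : IsLameSolution τ η m ε f') (hg' : IsLameSolution τ η m ε g')
    (hW : ∀ᶠ z in codiscrete ℂ, wronskian η f g z ≠ 0) :
    IsPeriodicMeromorphic η fun z => wronskian η f' g' z / wronskian η f g z := by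
  refine ⟨(meromorphic_wronskian hf'.1 hg'.1).div (meromorphic_wronskian hf.1 hg.1), ?_⟩
  filter_upwards [hf.wronskian_add hτ hg, hf'.wronskian_add hτ hg', hW,
    eventually_codiscrete_comp_add hW (2 * η),
    eventually_codiscrete_comp_add (eventually_codiscrete_theta_ne_zero hτ) (2 * η + m * (2 * η))]
    with z hfg hfg' hz hz_add hθ
  rw [← add_assoc] at hθ
  rw [div_eq_div_iff hz_add hz]
  apply mul_left_cancel₀ hθ
  linear_combination wronskian η f' g' (z + 2 * η) * hfg - wronskian η f g (z + 2 * η) * hfg'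

theorem linIndepOverPeriodic_of_wronskian_ne_zero
    (hW : ∀ᶠ z in codiscrete ℂ, wronskian η f g z ≠ 0) : LinIndepOverPeriodic η f g := by
  intro A B hA hB h
  have hzero : ∀ᶠ z in codiscrete ℂ, A z = 0 ∧ B z = 0 := by
    filter_upwards [h, eventually_codiscrete_comp_add h (2 * η), hA.2, hB.2, hW]
      with z hz hz_add hAz hBz hWz
    rw [hAz, hBz] at hz_add
    refine ⟨(mul_eq_zero.mp ?_).resolve_right hWz, (mul_eq_zero.mp ?_).resolve_right hWz⟩
    · rw [wronskian]
      linear_combination g (z + 2 * η) * hz - g z * hz_add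
    · rw [wronskian]
      linear_combination f z * hz_add - f (z + 2 * η) * hz
  exact ⟨hzero.mono fun _ h => h.1, hzero.mono fun _ h => h.2⟩

/-- Cramer's rule: the coefficients are quotients of Wronskians of solutions. -/
theorem IsLameSolution.isCombOverPeriodic (hτ : 0 < τ.im) (hf : IsLameSolution τ η m ε f)
    (hg : IsLameSolution τ η m ε g) (hW : ∀ᶠ z in codiscrete ℂ, wronskian η f g z ≠ 0)
    {F : ℂ → ℂ} (hF : IsLameSolution τ η m ε F) : IsCombOverPeriodic η f g F := by
  refine ⟨_, _, isPeriodicMeromorphic_wronskian_div hτ hf hg hF hg hW,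
    isPeriodicMeromorphic_wronskian_div hτ hf hg hf hF hW, ?_⟩
  filter_upwards [hW] with z hz
  field_simp
  simp only [wronskian]
  ring

end Meromorphic

section BetheSolutions

variable {τ η ε : ℂ} {m : ℕ} {y : ℕ → ℂ} {p : Param m}

theorem countable_not_isGenericStep (hτ : 0 < τ.im) :
    {η | ¬ IsGenericStep τ (2 * η)}.Countable := by
  refine (Set.countable_range fun x : ℤ × ℤ × ℤ =>
    ((x.2.1 : ℂ) + x.2.2 * τ) / (x.1 * 2)).mono fun η hη => ?_
  simp only [Set.mem_ofPred_eq, IsGenericStep, not_forall, not_not] at hη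
  obtain ⟨k, hk, hzero⟩ := hη
  obtain ⟨a, b, hab⟩ := (theta_eq_zero_iff hτ).mp hzero
  have hk' : (k : ℂ) ≠ 0 := Int.cast_ne_zero.mpr hk
  refine ⟨(k, a, b), ?_⟩
  simp only [← hab]
  field_simp

theorem IsLameRoots.isLameSolution (h : IsLameRoots τ (2 * η) m ε (betheRoots η p) p.2)
    (hτ : 0 < τ.im) : IsLameSolution τ η m ε (betheFunction τ η m p) := by
  rw [betheFunction_eq_expProd]
  exact h.lameEq.isLameSolution hτ (isTheta_expProd hτ _ _).diff

theorem IsLameRoots.reflect (h : IsLameRoots τ (2 * η) m ε (betheRoots η p) p.2) :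
    IsLameRoots τ (2 * η) m ε (betheRoots η (reflect η p)) (reflect η p).2 := by
  rw [betheRoots_reflect]
  exact h.neg

theorem wronskian_betheFunction_reflect (τ η : ℂ) (p : Param m) (z : ℂ) :
    wronskian η (betheFunction τ η m p) (betheFunction τ η m (reflect η p)) z
      = crossProd τ (2 * η) (betheRoots η p) p.2 z
        - crossProd τ (2 * η) (-betheRoots η p) (-p.2) z := by
  rw [crossProd_neg, crossProd, wronskian, betheFunction_eq_expProd, betheFunction_eq_expProd,
    betheRoots_reflect]
  rfl

theorem exists_isLameRoots_betheRoots (hτ : 0 < τ.im) (hw : IsGenericStep τ (2 * η)) (hm : m ≠ 0)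
    (hy : IsLameSeq τ (2 * η) m ε y) {a : Fin m → ℂ}
    (ha : IsSimpleFactorization τ (evenProd τ (2 * η) m y) a) :
    ∃ p : Param m, IsLameRoots τ (2 * η) m ε (betheRoots η p) p.2 ∧
      ∀ z, wronskProd τ (2 * η) m z ≠ 0 →
        wronskian η (betheFunction τ η m p) (betheFunction τ η m (reflect η p)) z ≠ 0 := by
  obtain ⟨b, c, hb, C, hC, hwronsk⟩ := exists_isLameRoots hτ hw hm hy ha
  obtain ⟨p, rfl, rfl⟩ := exists_betheRoots_eq η b c
  refine ⟨p, hb, fun z hz => ?_⟩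
  rw [wronskian_betheFunction_reflect, hwronsk]
  exact mul_ne_zero hC hz

theorem not_related_reflect (hτ : 0 < τ.im) (hη : η ≠ 0) {z : ℂ}
    (hz : wronskian η (betheFunction τ η m p) (betheFunction τ η m (reflect η p)) z ≠ 0) :
    ¬ Related τ η p (reflect η p) := by
  intro h
  rw [related_iff_rootsEquiv hη, betheRoots_reflect] at h
  rw [wronskian_betheFunction_reflect] at hz
  exact hz (sub_eq_zero.mpr (RootsEquiv.crossProd_eq hτ h z))

theorem IsLameRoots.solutionClasses_eq (hp : IsLameRoots τ (2 * η) m ε (betheRoots η p) p.2)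
    (hτ : 0 < τ.im) (hw : IsGenericStep τ (2 * η)) (hm : m ≠ 0) (hε : ε ≠ 0)
    (hy : IsLameSeq τ (2 * η) m ε y) (hW : ∀ z, wronskProd τ (2 * η) m z ≠ 0 →
      wronskian η (betheFunction τ η m p) (betheFunction τ η m (LameBethe.reflect η p)) z ≠ 0) :
    solutionClasses τ η m ε = {toClass τ η p, toClass τ η (LameBethe.reflect η p)} := by
  have hη : η ≠ 0 := right_ne_zero_of_mul hw.ne_zero
  refine Set.Subset.antisymm ?_ ?_
  · rintro _ ⟨q, hq, rfl⟩
    refine (hp.rootsEquiv_or_rootsEquiv_neg ((isBetheSolution_iff_isLameRoots hτ hw hm).mp hq) hτ hw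
      hm hε hy fun z hz => ?_).imp (fun h => ?_) fun h => ?_
    · rw [← _root_.sub_ne_zero, ← wronskian_betheFunction_reflect]
      exact hW z hz
    · exact Quotient.sound ((related_iff_rootsEquiv hη).mpr h).symm
    · rw [← betheRoots_reflect] at h
      exact Quotient.sound ((related_iff_rootsEquiv hη).mpr h).symm
  · rintro _ (rfl | rfl)
    · exact ⟨p, (isBetheSolution_iff_isLameRoots hτ hw hm).mpr hp, rfl⟩
    · exact ⟨_, (isBetheSolution_iff_isLameRoots hτ hw hm).mpr hp.reflect, rfl⟩

end BetheSolutions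

end LameBethe

end

theorem mainTheorem7 (m : ℕ) (hm : 1 ≤ m) (τ : ℂ) (hτ : 0 < τ.im) :
    ∃ N : Set ℂ, N.Countable ∧ ∀ η : ℂ, η ∉ N →
      ∃ F : Set ℂ, F.Finite ∧ ∀ ε : ℂ, ε ∉ F →
        ∃ p : LameBethe.Param m,
          (LameBethe.IsBetheSolution τ η m p ∧ LameBethe.betheEigenvalue τ η m p = ε) ∧
          (LameBethe.IsBetheSolution τ η m (LameBethe.reflect η p) ∧
            LameBethe.betheEigenvalue τ η m (LameBethe.reflect η p) = ε) ∧
          LameBethe.toClass τ η p ≠ LameBethe.toClass τ η (LameBethe.reflect η p) ∧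
          LameBethe.solutionClasses τ η m ε =
            {LameBethe.toClass τ η p, LameBethe.toClass τ η (LameBethe.reflect η p)} ∧
          LameBethe.IsLameSolution τ η m ε (LameBethe.betheFunction τ η m p) ∧
          LameBethe.IsLameSolution τ η m ε
            (LameBethe.betheFunction τ η m (LameBethe.reflect η p)) ∧
          LameBethe.LinIndepOverPeriodic η (LameBethe.betheFunction τ η m p)
            (LameBethe.betheFunction τ η m (LameBethe.reflect η p)) ∧
          ∀ f : ℂ → ℂ, LameBethe.IsLameSolution τ η m ε f →
            LameBethe.IsCombOverPeriodic η (LameBethe.betheFunction τ η m p)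
              (LameBethe.betheFunction τ η m (LameBethe.reflect η p)) f := by
  open LameBethe in
  refine ⟨_, countable_not_isGenericStep hτ, fun η hη => ?_⟩
  have hw : IsGenericStep τ (2 * η) := not_not.mp hη
  have hη_ne : η ≠ 0 := right_ne_zero_of_mul hw.ne_zero
  have hm_ne : m ≠ 0 := Nat.one_le_iff_ne_zero.mp hm
  obtain ⟨F, hF, hF_lameSeq⟩ := exists_lameSeq hτ hw hm_ne
  refine ⟨F, hF, fun ε hε => ?_⟩
  obtain ⟨hε_ne, y, hy, a, ha⟩ := hF_lameSeq ε hε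
  obtain ⟨p, hp, hW⟩ := exists_isLameRoots_betheRoots hτ hw hm_ne hy ha
  obtain ⟨z, hz⟩ := exists_wronskProd_ne_zero hτ (2 * η) m
  have hW_codiscrete : ∀ᶠ z in codiscrete ℂ,
      wronskian η (betheFunction τ η m p) (betheFunction τ η m (reflect η p)) z ≠ 0 :=
    (eventually_codiscrete_ne_zero (isTheta_wronskProd hτ).diff hz).mono hW
  have hsol := hp.isLameSolution hτ
  have hsol_reflect := hp.reflect.isLameSolution hτ
  exact ⟨p, (isBetheSolution_iff_isLameRoots hτ hw hm_ne).mpr hp,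
    (isBetheSolution_iff_isLameRoots hτ hw hm_ne).mpr hp.reflect,
    fun h => not_related_reflect hτ hη_ne (hW z hz) (Quotient.exact h),
    hp.solutionClasses_eq hτ hw hm_ne hε_ne hy hW, hsol, hsol_reflect,
    linIndepOverPeriodic_of_wronskian_ne_zero hW_codiscrete,
    fun _ hf => hsol.isCombOverPeriodic hτ hsol_reflect hW_codiscrete hf⟩
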